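/- Let $0<\rho<1$ and let $\arg\in(-\pi,\pi]$ and $\log$ be principal branches. For integers $0<p<N$ let $M_\gamma$ be the tilted generator of TASEP with $p$ particles on the ring $\mathbb Z/N\mathbb Z$, $$(M_\gamma\phi)(\eta)=\sum_{x}\eta_{x+1}(1-\eta_x)\big(e^\gamma\phi(\eta^{x,x+1})-\phi(\eta)\big),$$ acting on functions of the configurations $\eta\in\{0,1\}^{\mathbb Z/N\mathbb Z}$ with $\sum_x\eta_x=p$, where $\eta^{x,x+1}$ is $\eta$ with $\eta_x,\eta_{x+1}$ exchanged. Let $\lambda_1(\gamma;N)$ be its eigenvalue with the largest real part and $\lambda_2(\gamma;N)$ an eigenvalue with the second largest real part (eigenvalues counted with multiplicity). For $C\in\mathbb C\setminus[0,\infty)$ and $1\le j\le N$ let $u_j(C)$ be the unique solution of $(1-u)^p(1+u)^{N-p}=C$ such that $\frac p\pi\arg(u-1)+\frac{N-p}\pi\arg(u+1)$ lies in $(-p+2(j-1),-p+2j]$ modulo $2N$; for $C>0$ let $u_j(C)=\lim_{\delta\uparrow0}u_j(Ce^{i\delta})$. A number $\lambda$ is said to be given by a set $A\subseteq\{1,\dots,N\}$,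 $|A|=p$, with parameter $C\neq0$, if $$2^Ne^{\gamma N}\prod_{j\in A}\frac{u_j(C)-1}{u_j(C)+1}+C=0\quad\text{and}\quad\lambda=\frac12\sum_{j\in A}(u_j(C)-1).$$ Put $r_{\rm cr}=2^{1/\rho}\rho(1-\rho)^{1/\rho-1}$. For $r>r_{\rm cr}$ there is a unique $u_*=u_*(r)$ with $\operatorname{Im}u_*>0$, $(1-u_*)^\rho(1+u_*)^{1-\rho}=r^\rho$ and $\rho\arg(1-u_*)+(1-\rho)\arg(1+u_*)=0$. With $\operatorname{Li}_2(z)=-\int_0^z\frac{\log(1-u)}u\,du$ on $\mathbb C\setminus[1,\infty)$, let $$\begin{aligned}G_\infty(z)&=\frac1\pi\Big\{\frac{1-\rho}\rho\log|1+z|\arg(1+z)+\log2\,\arg(1-z)-\operatorname{Im}\operatorname{Li}_2\Big(\frac12-\frac z2\Big)\Big\},\\ \Lambda_\infty(z)&=\frac1\pi\Big\{\frac{\operatorname{Im}z}2+(\rho-1)\arg(1+z)\Big\},\\ g_\infty(z)&=\frac{\pi i}{z-1+2\rho}\Big\{1-z^2-\frac{2\rho\operatorname{Im}z}{\arg(1+z)}\Big\}.\end{aligned}$$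 **Theorem.** For every $\gamma>0$ the equation $\gamma=G_\infty(u_*(r))$ has a unique solution $r=r_*(\gamma)>r_{\rm cr}$; $r_*$ is strictly increasing in $\gamma$, and $r_*(\gamma)\to r_{\rm cr}$ as $\gamma\to0+$. Let $\Lambda(\gamma,\rho)=\Lambda_\infty(u_*(r_*(\gamma)))$ and $g(\gamma,\rho)=g_\infty(u_*(r_*(\gamma)))$. Fix $\gamma>0$ and let $N\to\infty$ with $p=\rho N$ an integer. Assume that for all sufficiently large $N$ the eigenvalue $\lambda_1(\gamma;N)$ is given by $A=\{1,\dots,p\}$ with some parameter, and $\lambda_2(\gamma;N)$ is given by $A=\{1,\dots,p-1,p+1\}$ or by $A=\{2,\dots,p,N\}$ with some parameter. Then: 1. the limiting form of the consistency equations of both eigenvalues is $\gamma=G_\infty(u_*(r))$: if $C_N$ are parameters with which these sets give $\lambda_1(\gamma;N)$, respectively $\lambda_2(\gamma;N)$, then $|C_N|^{1/p}\to r_*(\gamma)$; 2. $\limsup_{N\to\infty}|\lambda_1(\gamma;N)-N\Lambda(\gamma,\rho)|<\infty$; 3. $N(\lambda_1(\gamma;N)-\lambda_2(\gamma;N))\to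 g(\gamma,\rho)$ along those $N$ for which $\lambda_2$ is given by $\{1,\dots,p-1,p+1\}$, and $N(\lambda_1(\gamma;N)-\lambda_2(\gamma;N))\to\overline{g(\gamma,\rho)}$ along those $N$ for which $\lambda_2$ is given by $\{2,\dots,p,N\}$. -/

import Mathlib

open Filter Topology

noncomputable section

namespace TASEP

/-! ### The tilted generator of TASEP on a ring -/

/-- Configurations of `p` particles on the ring with `N` sites, at most one particle per site. -/
def Config (N p : ℕ) : Type := {η : Fin N → Fin 2 // ∑ x, (η x : ℕ) = p}

instance (N p : ℕ) : Fintype (Config N p) :=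
  inferInstanceAs (Fintype {η : Fin N → Fin 2 // ∑ x, (η x : ℕ) = p})

instance (N p : ℕ) : DecidableEq (Config N p) :=
  inferInstanceAs (DecidableEq {η : Fin N → Fin 2 // ∑ x, (η x : ℕ) = p})

/-- Exchange of the occupation numbers at the sites `x` and `x + 1`; the cyclic successor
`x + 1` of `x` is `finRotate N x`. -/
def Config.exchange {N p : ℕ} (η : Config N p) (x : Fin N) : Config N p :=
  ⟨fun y => η.1 (Equiv.swap x (finRotate N x) y), by
    rw [Equiv.sum_comp (Equiv.swap x (finRotate N x)) (fun y => (η.1 y : ℕ))]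
    exact η.2⟩

/-- The matrix of the tilted generator
`(L_γ g)(η) = ∑ₓ η_{x+1} (1 - η_x) (e^γ g(η^{x,x+1}) - g(η))`. -/
def tiltedMatrix (N p : ℕ) (γ : ℝ) : Matrix (Config N p) (Config N p) ℂ :=
  Matrix.of fun η η' => ∑ x : Fin N,
    ((η.1 (finRotate N x) : ℕ) : ℂ) * (1 - ((η.1 x : ℕ) : ℂ)) *
      ((Real.exp γ : ℂ) * (if η' = η.exchange x then 1 else 0) - (if η' = η then 1 else 0))

/-- The eigenvalues of the tilted matrix, with algebraic multiplicity. -/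
def spectrumMultiset (N p : ℕ) (γ : ℝ) : Multiset ℂ := (tiltedMatrix N p γ).charpoly.roots

/-- `l₁` is an eigenvalue with the largest real part. -/
def IsLargestEigenvalue (N p : ℕ) (γ : ℝ) (l₁ : ℂ) : Prop :=
  l₁ ∈ spectrumMultiset N p γ ∧ ∀ μ ∈ spectrumMultiset N p γ, μ.re ≤ l₁.re

/-- `l₂` has the largest real part among the eigenvalues that remain once one copy of the
largest eigenvalue `l₁` is removed. -/
def IsSecondEigenvalue (N p : ℕ) (γ : ℝ) (l₁ l₂ : ℂ) : Prop :=
  l₂ ∈ (spectrumMultiset N p γ).erase l₁ ∧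
    ∀ μ ∈ (spectrumMultiset N p γ).erase l₁, μ.re ≤ l₂.re

/-! ### Bethe roots -/

/-- The labelling function `F(u) = (p/π) arg(u - 1) + ((N - p)/π) arg(u + 1) ∈ (-N, N]`. -/
def labelF (N p : ℕ) (u : ℂ) : ℝ :=
  (p : ℝ) / Real.pi * (u - 1).arg + ((N : ℝ) - p) / Real.pi * (u + 1).arg

/-- `u` solves `(1 - u)^p (1 + u)^(N - p) = C` and `F(u)` lies in the image of the interval
`(-p + 2(j - 1), -p + 2j]` modulo `2N`. -/
def IsLabelledRoot (N p j : ℕ) (C u : ℂ) : Prop :=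
  (1 - u) ^ p * (1 + u) ^ (N - p) = C ∧
    ∃ m : ℤ, labelF N p u + 2 * N * m ∈
      Set.Ioc (-(p : ℝ) + 2 * ((j : ℝ) - 1)) (-(p : ℝ) + 2 * j)

/-- `u = u_j(C)`, for `C ≠ 0` and `j ∈ {1, …, N}`: off the positive half-line it is the root
of label `j`; on the positive half-line it is the limit of `u_j(C e^{iδ})` as `δ ↑ 0`. -/
def IsBetheRoot (N p j : ℕ) (C u : ℂ) : Prop :=
  (¬ (C.im = 0 ∧ 0 ≤ C.re) ∧ IsLabelledRoot N p j C u) ∨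
  ((C.im = 0 ∧ 0 < C.re) ∧ ∃ v : ℝ → ℂ,
    (∀ᶠ δ : ℝ in 𝓝[<] 0,
      IsLabelledRoot N p j (C * Complex.exp (Complex.I * (δ : ℂ))) (v δ)) ∧
    Tendsto v (𝓝[<] 0) (𝓝 u))

/-- `C ≠ 0` solves the consistency equation
`2^N e^{γN} ∏_{j ∈ A} (u_j(C) - 1)/(u_j(C) + 1) + C = 0` for the index set `A`,
and the corresponding value `½ ∑_{j ∈ A} (u_j(C) - 1)` is `l`. -/
def Realizes (N p : ℕ) (γ : ℝ) (A : Finset ℕ) (C l : ℂ) : Prop :=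
  C ≠ 0 ∧ ∃ u : ℕ → ℂ, (∀ j ∈ A, IsBetheRoot N p j C (u j)) ∧
    (2 : ℂ) ^ N * (Real.exp (γ * N) : ℂ) * ∏ j ∈ A, (u j - 1) / (u j + 1) + C = 0 ∧
    l = 1 / 2 * ∑ j ∈ A, (u j - 1)

/-- The index set `{1, …, p}`. -/
def choiceOne (p : ℕ) : Finset ℕ := Finset.Icc 1 p

/-- The index set `{1, …, p - 1, p + 1}`. -/
def choiceTwo (p : ℕ) : Finset ℕ := insert (p + 1) (Finset.Icc 1 (p - 1))

/-- The index set `{2, …, p, N}`. -/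
def choiceTwo' (N p : ℕ) : Finset ℕ := insert N (Finset.Icc 2 p)

/-- The root-selection assumption for `γ > 0` at given `N` and `p`: `l₁` is given by
`{1, …, p}`, and `l₂` by `{1, …, p - 1, p + 1}` or by `{2, …, p, N}`. -/
def RootSelection (N p : ℕ) (γ : ℝ) (l₁ l₂ : ℂ) : Prop :=
  (∃ C, Realizes N p γ (choiceOne p) C l₁) ∧
    ((∃ C, Realizes N p γ (choiceTwo p) C l₂) ∨ ∃ C, Realizes N p γ (choiceTwo' N p) C l₂)

/-! ### The limit functions -/

/-- The critical radius `r_cr = 2^{1/ρ} ρ (1 - ρ)^{1/ρ - 1}`. -/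
def rCrit (ρ : ℝ) : ℝ := (2 : ℝ) ^ (1 / ρ) * ρ * (1 - ρ) ^ (1 / ρ - 1)

/-- The equations that determine `u_*(r)`, for `r > r_cr`. -/
def IsUStar (ρ r : ℝ) (u : ℂ) : Prop :=
  (1 - u) ^ (ρ : ℂ) * (1 + u) ^ ((1 - ρ : ℝ) : ℂ) = ((r ^ ρ : ℝ) : ℂ) ∧
    ρ * (1 - u).arg + (1 - ρ) * (1 + u).arg = 0 ∧ 0 < u.im

/-- `u_*(r)`, the solution of the above equations. -/
def uStar (ρ r : ℝ) : ℂ := Classical.epsilon (IsUStar ρ r)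

/-- The dilogarithm `-∫₀^z log(1 - u)/u du` on `ℂ \ [1, ∞)`, along the segment `u = t z`. -/
def dilog (z : ℂ) : ℂ := -∫ t in (0 : ℝ)..1, Complex.log (1 - (t : ℂ) * z) / (t : ℂ)

def GInf (ρ : ℝ) (z : ℂ) : ℝ :=
  1 / Real.pi * ((1 - ρ) / ρ * Real.log ‖1 + z‖ * (1 + z).arg
    + Real.log 2 * (1 - z).arg - (dilog (1 / 2 - z / 2)).im)

def LambdaInf (ρ : ℝ) (z : ℂ) : ℝ :=
  1 / Real.pi * (z.im / 2 + (ρ - 1) * (1 + z).arg)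

def gInf (ρ : ℝ) (z : ℂ) : ℂ :=
  (Real.pi : ℂ) * Complex.I / (z - 1 + 2 * (ρ : ℂ)) *
    (1 - z ^ 2 - ((2 * ρ * z.im / (1 + z).arg : ℝ) : ℂ))

/-- `r > r_cr` solves the limiting consistency equation `γ = G_∞(u_*(r))`. -/
def IsRStar (ρ γ r : ℝ) : Prop := rCrit ρ < r ∧ γ = GInf ρ (uStar ρ r)

/-- `r_*(γ)`, the solution of the limiting consistency equation. -/
def rStar (ρ γ : ℝ) : ℝ := Classical.epsilon (IsRStar ρ γ)

/-- `Λ(γ, ρ)`. -/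
def Lam (γ ρ : ℝ) : ℝ := LambdaInf ρ (uStar ρ (rStar ρ γ))

/-- `g(γ, ρ)`. -/
def gapConst (γ ρ : ℝ) : ℂ := gInf ρ (uStar ρ (rStar ρ γ))

end TASEP

end

namespace TASEP

/-! ### The logarithmic coordinate -/

/-! In the coordinate ζ(w) = ρ log(w - 1) + (1 - ρ) log(w + 1) the Bethe equation is linear: by
`pow_mul_pow_eq_exp` all roots lie on the vertical line Re ζ = log|C|/N, their angles Im ζ are
spaced by 2π/N, and the labels 1, …, p asymptotically fill |Im ζ| ≤ ρπ. By `zeta_injOn` and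
`mem_zetaImage`, ζ can be inverted for |Im ζ| < ρπ and, to the right of the critical abscissa
`xCrit` = ρ log r_cr, even for |Im ζ| < π.

Put `ell` w = log((1 + w)/2). In modulus the consistency equation says that the mean of Re `ell`
over the chosen roots is γ (`BetheSol.sum_ell_re`). Since `primK` is a primitive of `ell` with
respect to ζ, the mean over the limiting arc is Im `primK` at the upper endpoint divided by ρπ.
Beyond `xCrit` this endpoint is u_* and the mean is G_∞(u_*), as a function of the abscissa
`consist`. Up to `xCrit` the arc ends on the slit (-1, 1), where `primK` is real, so the mean
vanishes. Now `consist` has derivative arg(1 + u_*)/(ρπ) > 0 and grows from 0 to ∞, which gives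
existence, uniqueness and monotonicity of r_*. A priori bounds and compactness give convergence of
the modulus (`tendsto_of_betheSol`).

For the eigenvalues, modulus and phase are merged into one complex shift σ of fixed symmetric nodes.
Once its branch is settled, the consistency equation prescribes the node sum of `ell`: it is pγ for
the ground state, with an additional term of order 1/N for the excited one
(`eventually_nodeSum_eq`). The Riemann sum estimate determines a node sum up to O(1), which suffices
for λ₁. For the gap, the two shifts are compared with each other: by `nodeSum_sub_isLittleO` an
increment of a node sum is an explicit multiple of N(τ - σ) up to a relatively small error. Applied
to `ell` this yields the limit of N²(τ - σ); applied to the roots it yields the limit of N(λ₁ - λ₂)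
(`tendsto_gap`). The set {2, …, p, N} is reduced to {1, …, p - 1, p + 1} by complex conjugation. -/

/-- The plane cut along `(-∞, 1]`. -/
def cutPlane : Set ℂ := {w | w - 1 ∈ Complex.slitPlane}

/-- The logarithmic coordinate `ρ log (w - 1) + (1 - ρ) log (w + 1)`. -/
noncomputable def zeta (ρ : ℝ) (w : ℂ) : ℂ :=
  ρ * Complex.log (w - 1) + (1 - ρ) * Complex.log (w + 1)

/-- `ρ log |w - 1| + (1 - ρ) log |w + 1|`. -/
noncomputable def logMod (ρ : ℝ) (w : ℂ) : ℝ :=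
  ρ * Real.log ‖w - 1‖ + (1 - ρ) * Real.log ‖w + 1‖

/-- The absolute value of the imaginary part of `zeta`; it is continuous off `±1`. -/
noncomputable def absArg (ρ : ℝ) (w : ℂ) : ℝ :=
  ρ * |(w - 1).arg| + (1 - ρ) * |(w + 1).arg|

/-- The critical value `ρ log r_cr` of `logMod`. -/
noncomputable def xCrit (ρ : ℝ) : ℝ :=
  Real.log 2 + ρ * Real.log ρ + (1 - ρ) * Real.log (1 - ρ)

theorem zeta_re (ρ : ℝ) (w : ℂ) : (zeta ρ w).re = logMod ρ w := by
  simp [zeta, logMod, Complex.log_re]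

theorem zeta_im (ρ : ℝ) (w : ℂ) :
    (zeta ρ w).im = ρ * (w - 1).arg + (1 - ρ) * (w + 1).arg := by
  simp [zeta, Complex.log_im]

theorem mem_cutPlane_iff {w : ℂ} : w ∈ cutPlane ↔ 1 < w.re ∨ w.im ≠ 0 := by
  simp [cutPlane, Complex.mem_slitPlane_iff]

theorem mem_cutPlane_of_im_pos {w : ℂ} (h : 0 < w.im) : w ∈ cutPlane :=
  mem_cutPlane_iff.2 (Or.inr h.ne')

theorem isOpen_cutPlane : IsOpen cutPlane :=
  Complex.isOpen_slitPlane.preimage (by fun_prop)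

theorem add_one_mem_slitPlane {w : ℂ} (h : w ∈ cutPlane) : w + 1 ∈ Complex.slitPlane := by
  rw [mem_cutPlane_iff] at h
  rw [Complex.mem_slitPlane_iff]
  rcases h with h | h
  · left; simp; linarith
  · right; simpa using h

theorem conj_mem_cutPlane {w : ℂ} (h : w ∈ cutPlane) : (starRingEnd ℂ) w ∈ cutPlane := by
  rw [mem_cutPlane_iff] at h ⊢
  simpa using h

theorem zeta_conj {ρ : ℝ} {w : ℂ} (h : w ∈ cutPlane) :
    zeta ρ ((starRingEnd ℂ) w) = (starRingEnd ℂ) (zeta ρ w) := by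
  have h1 : (starRingEnd ℂ) w - 1 = (starRingEnd ℂ) (w - 1) := by simp
  have h2 : (starRingEnd ℂ) w + 1 = (starRingEnd ℂ) (w + 1) := by simp
  rw [zeta, h1, h2, Complex.log_conj _ (Complex.slitPlane_arg_ne_pi h),
    Complex.log_conj _ (Complex.slitPlane_arg_ne_pi (add_one_mem_slitPlane h))]
  simp [zeta]

theorem arg_pos_of_im_pos {z : ℂ} (h : 0 < z.im) : 0 < z.arg :=
  lt_of_le_of_ne (Complex.arg_nonneg_iff.2 h.le) fun h0 => by
    have := (Complex.arg_eq_zero_iff.1 h0.symm).2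
    linarith

theorem absArg_eq_of_im_nonneg {ρ : ℝ} {w : ℂ} (h : 0 ≤ w.im) :
    absArg ρ w = (zeta ρ w).im := by
  have h1 : 0 ≤ (w - 1).arg := Complex.arg_nonneg_iff.2 (by simpa using h)
  have h2 : 0 ≤ (w + 1).arg := Complex.arg_nonneg_iff.2 (by simpa using h)
  rw [absArg, zeta_im, abs_of_nonneg h1, abs_of_nonneg h2]

theorem absArg_eq_of_im_neg {ρ : ℝ} {w : ℂ} (h : w.im < 0) :
    absArg ρ w = -(zeta ρ w).im := by
  have h1 : (w - 1).arg < 0 := Complex.arg_neg_iff.2 (by simpa using h)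
  have h2 : (w + 1).arg < 0 := Complex.arg_neg_iff.2 (by simpa using h)
  rw [absArg, zeta_im, abs_of_neg h1, abs_of_neg h2]
  ring

theorem zeta_im_pos {ρ : ℝ} (h0 : 0 < ρ) (h1 : ρ < 1) {w : ℂ} (h : 0 < w.im) :
    0 < (zeta ρ w).im := by
  rw [zeta_im]
  have h2 : 0 < (w - 1).arg := arg_pos_of_im_pos (by simpa using h)
  have h3 : 0 < (w + 1).arg := arg_pos_of_im_pos (by simpa using h)
  have : 0 < 1 - ρ := by linarith
  positivity

theorem zeta_im_neg {ρ : ℝ} (h0 : 0 < ρ) (h1 : ρ < 1) {w : ℂ} (h : w.im < 0) :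
    (zeta ρ w).im < 0 := by
  rw [zeta_im]
  have h2 : (w - 1).arg < 0 := Complex.arg_neg_iff.2 (by simpa using h)
  have h3 : (w + 1).arg < 0 := Complex.arg_neg_iff.2 (by simpa using h)
  nlinarith [mul_pos h0 (neg_pos.2 h2), mul_pos (sub_pos.2 h1) (neg_pos.2 h3)]

theorem absArg_eq_abs_zeta_im {ρ : ℝ} (h0 : 0 < ρ) (h1 : ρ < 1) (w : ℂ) :
    absArg ρ w = |(zeta ρ w).im| := by
  rcases le_or_gt 0 w.im with h | h
  · rw [absArg_eq_of_im_nonneg h, abs_of_nonneg]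
    rw [← absArg_eq_of_im_nonneg h, absArg]
    have : 0 < 1 - ρ := by linarith
    positivity
  · rw [absArg_eq_of_im_neg h, abs_of_neg (zeta_im_neg h0 h1 h)]

theorem arg_eq_zero_of_real {w : ℂ} (h : w.im = 0) (h' : 0 ≤ w.re) : w.arg = 0 :=
  Complex.arg_eq_zero_iff.2 ⟨h', h⟩

theorem arg_eq_pi_of_real {w : ℂ} (h : w.im = 0) (h' : w.re < 0) : w.arg = Real.pi :=
  Complex.arg_eq_pi_iff.2 ⟨h', h⟩

theorem absArg_of_one_lt {ρ : ℝ} {w : ℂ} (h : w.im = 0) (h' : 1 ≤ w.re) : absArg ρ w = 0 := by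
  rw [absArg, arg_eq_zero_of_real (w := w - 1) (by simpa using h) (by simpa using h'),
    arg_eq_zero_of_real (w := w + 1) (by simpa using h) (by simp; linarith)]
  simp

theorem absArg_of_mem_Ioo {ρ : ℝ} {w : ℂ} (h : w.im = 0) (h' : -1 ≤ w.re) (h'' : w.re < 1) :
    absArg ρ w = ρ * Real.pi := by
  rw [absArg, arg_eq_pi_of_real (w := w - 1) (by simpa using h) (by simpa using h''),
    arg_eq_zero_of_real (w := w + 1) (by simpa using h) (by simp; linarith)]
  simp [abs_of_pos Real.pi_pos]

theorem absArg_of_lt_neg_one {ρ : ℝ} {w : ℂ} (h : w.im = 0) (h' : w.re < -1) :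
    absArg ρ w = Real.pi := by
  rw [absArg, arg_eq_pi_of_real (w := w - 1) (by simpa using h) (by simp; linarith),
    arg_eq_pi_of_real (w := w + 1) (by simpa using h) (by simp; linarith),
    abs_of_pos Real.pi_pos]
  ring

theorem zeta_im_eq_zero {ρ : ℝ} {w : ℂ} (hw : w ∈ cutPlane) (h : w.im = 0) :
    (zeta ρ w).im = 0 := by
  have hre : 1 < w.re := by
    rcases mem_cutPlane_iff.1 hw with hre | hre
    · exact hre
    · exact absurd h hre
  rw [← absArg_eq_of_im_nonneg h.ge, absArg_of_one_lt h hre.le]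

/-! ### Derivative and injectivity of the logarithmic coordinate. -/

/-- The derivative of the logarithmic coordinate. -/
noncomputable def zetaDeriv (ρ : ℝ) (w : ℂ) : ℂ := (w - 1 + 2 * ρ) / ((w - 1) * (w + 1))

theorem zetaDeriv_eq {ρ : ℝ} {w : ℂ} (h1 : w - 1 ≠ 0) (h2 : w + 1 ≠ 0) :
    zetaDeriv ρ w = ρ * (1 / (w - 1)) + (1 - ρ) * (1 / (w + 1)) := by
  rw [zetaDeriv]; field_simp; ring

theorem hasStrictDerivAt_zeta (ρ : ℝ) {w : ℂ} (h : w ∈ cutPlane) :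
    HasStrictDerivAt (zeta ρ) (zetaDeriv ρ w) w := by
  rw [zetaDeriv_eq (Complex.slitPlane_ne_zero h)
    (Complex.slitPlane_ne_zero (add_one_mem_slitPlane h))]
  have h1 : HasStrictDerivAt (fun w : ℂ => Complex.log (w - 1)) (1 / (w - 1)) w :=
    HasStrictDerivAt.clog ((hasStrictDerivAt_id w).sub_const 1) h
  have h2 : HasStrictDerivAt (fun w : ℂ => Complex.log (w + 1)) (1 / (w + 1)) w :=
    HasStrictDerivAt.clog ((hasStrictDerivAt_id w).add_const 1) (add_one_mem_slitPlane h)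
  exact (h1.const_mul (ρ : ℂ)).add (h2.const_mul (1 - ρ : ℂ))

theorem zetaDeriv_ne_zero {ρ : ℝ} (h0 : 0 < ρ) {w : ℂ} (h : w ∈ cutPlane) :
    zetaDeriv ρ w ≠ 0 := by
  refine div_ne_zero ?_ (mul_ne_zero (Complex.slitPlane_ne_zero h)
    (Complex.slitPlane_ne_zero (add_one_mem_slitPlane h)))
  intro h'
  have hr := congrArg Complex.re h'
  have hi := congrArg Complex.im h'
  simp at hr hi
  rcases mem_cutPlane_iff.1 h with h | h
  · linarith
  · exact h hi

theorem one_div_im_neg {w : ℂ} (h : 0 < w.im) : (1 / w).im < 0 := by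
  rw [one_div, Complex.inv_im, neg_div, neg_lt_zero]
  exact div_pos h (Complex.normSq_pos.2 fun h' => by simp [h'] at h)

theorem zetaDeriv_im_neg {ρ : ℝ} (h0 : 0 < ρ) (h1 : ρ < 1) {w : ℂ} (h : 0 < w.im) :
    (zetaDeriv ρ w).im < 0 := by
  rw [zetaDeriv_eq (Complex.slitPlane_ne_zero (mem_cutPlane_of_im_pos h))
    (Complex.slitPlane_ne_zero (add_one_mem_slitPlane (mem_cutPlane_of_im_pos h)))]
  have h2 : (1 / (w - 1)).im < 0 := one_div_im_neg (by simpa using h)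
  have h3 : (1 / (w + 1)).im < 0 := one_div_im_neg (by simpa using h)
  have : (ρ * (1 / (w - 1)) + (1 - ρ) * (1 / (w + 1))).im
      = ρ * (1 / (w - 1)).im + (1 - ρ) * (1 / (w + 1)).im := by
    rw [Complex.add_im, ← Complex.ofReal_one, ← Complex.ofReal_sub]
    simp only [Complex.im_ofReal_mul]
  rw [this]
  nlinarith [mul_pos h0 (neg_pos.2 h2), mul_pos (sub_pos.2 h1) (neg_pos.2 h3)]

/-- A function whose derivative has negative imaginary part along the open segment from `a` to `b`
separates `a` from `b`. -/
theorem ne_of_deriv_im_neg {f f' : ℂ → ℂ} {a b : ℂ} (hab : a ≠ b)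
    (hc : ContinuousOn (fun t : ℝ => f (a + t * (b - a))) (Set.Icc 0 1))
    (hd : ∀ t ∈ Set.Ioo (0 : ℝ) 1, HasDerivAt f (f' (a + t * (b - a))) (a + t * (b - a)))
    (hn : ∀ t ∈ Set.Ioo (0 : ℝ) 1, (f' (a + t * (b - a))).im < 0) : f a ≠ f b := by
  intro heq
  have hba : b - a ≠ 0 := sub_ne_zero.2 hab.symm
  -- Division by `b - a` cancels the factor from the chain rule, so that `g` has derivative Im `f'`;
  -- equal endpoint values would force a zero of it.
  let g : ℝ → ℝ := fun t => (f (a + t * (b - a)) / (b - a)).im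
  have hg : ContinuousOn g (Set.Icc 0 1) :=
    Complex.continuous_im.comp_continuousOn (hc.div_const _)
  have hg' : ∀ t ∈ Set.Ioo (0 : ℝ) 1, HasDerivAt g (f' (a + t * (b - a))).im t := by
    intro t ht
    have hl : HasDerivAt (fun t : ℂ => a + t * (b - a)) (b - a) (t : ℂ) := by
      simpa using ((hasDerivAt_id (t : ℂ)).mul_const (b - a)).const_add a
    have h1 := (((hd t ht).comp (t : ℂ) hl).div_const (b - a)).comp_ofReal
    rw [mul_div_cancel_right₀ _ hba] at h1
    exact (Complex.imCLM.hasFDerivAt.comp_hasDerivAt t h1)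
  obtain ⟨t, ht, h⟩ := exists_hasDerivAt_eq_slope g _ zero_lt_one hg hg'
  have : g 1 = g 0 := by simp [g, heq]
  have := hn t ht
  rw [h] at this
  simp_all

theorem segment_im (a b : ℂ) (t : ℝ) :
    (a + t * (b - a)).im = (1 - t) * a.im + t * b.im := by
  simp; ring

/-- The upper half-plane is convex and both 1/(w - 1) and 1/(w + 1) have negative imaginary part
there, so the derivative of ζ stays in a half-plane (Noshiro–Warschawski). -/
theorem zeta_injOn_upper {ρ : ℝ} (h0 : 0 < ρ) (h1 : ρ < 1) {a b : ℂ} (ha : 0 < a.im)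
    (hb : 0 < b.im) (h : zeta ρ a = zeta ρ b) : a = b := by
  by_contra hab
  have hpos : ∀ t ∈ Set.Icc (0 : ℝ) 1, 0 < (a + t * (b - a)).im := by
    intro t ht
    rw [segment_im]
    rcases eq_or_lt_of_le ht.1 with h | h
    · simp [← h, ha]
    · nlinarith [mul_pos h hb, mul_nonneg (sub_nonneg.2 ht.2) ha.le]
  refine ne_of_deriv_im_neg (f' := zetaDeriv ρ) hab ?_ ?_ ?_ h
  · intro t ht
    have h2 := (hasStrictDerivAt_zeta ρ (mem_cutPlane_of_im_pos (hpos t ht))).hasDerivAt.continuousAt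
    exact (ContinuousAt.comp (f := fun t : ℝ => a + t * (b - a)) h2
      (by fun_prop)).continuousWithinAt
  · intro t ht
    exact (hasStrictDerivAt_zeta ρ
      (mem_cutPlane_of_im_pos (hpos t (Set.Ioo_subset_Icc_self ht)))).hasDerivAt
  · intro t ht
    exact zetaDeriv_im_neg h0 h1 (hpos t (Set.Ioo_subset_Icc_self ht))

theorem logMod_strictMono_real {ρ : ℝ} (h0 : 0 < ρ) (h1 : ρ < 1) {a b : ℂ} (ha : a.im = 0)
    (hb : b.im = 0) (ha1 : 1 < a.re) (hab : a.re < b.re) : logMod ρ a < logMod ρ b := by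
  have ea : a = (a.re : ℂ) := Complex.ext (by simp) (by simp [ha])
  have eb : b = (b.re : ℂ) := Complex.ext (by simp) (by simp [hb])
  have n : ∀ x : ℝ, 1 < x → ‖(x : ℂ) - 1‖ = x - 1 ∧ ‖(x : ℂ) + 1‖ = x + 1 := by
    intro x hx
    constructor
    · rw [← Complex.ofReal_one, ← Complex.ofReal_sub, Complex.norm_real, Real.norm_eq_abs,
        abs_of_pos (by linarith)]
    · rw [← Complex.ofReal_one, ← Complex.ofReal_add, Complex.norm_real, Real.norm_eq_abs,
        abs_of_pos (by linarith)]
  rw [ea, eb, logMod, logMod, (n _ ha1).1, (n _ ha1).2, (n _ (ha1.trans hab)).1,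
    (n _ (ha1.trans hab)).2]
  have l1 := Real.log_lt_log (by linarith : 0 < a.re - 1) (by linarith : a.re - 1 < b.re - 1)
  have l2 := Real.log_lt_log (by linarith : 0 < a.re + 1) (by linarith : a.re + 1 < b.re + 1)
  nlinarith [mul_pos h0 (sub_pos.2 l1), mul_pos (sub_pos.2 h1) (sub_pos.2 l2)]

theorem zeta_im_sign {ρ : ℝ} (h0 : 0 < ρ) (h1 : ρ < 1) {w : ℂ} (hw : w ∈ cutPlane) :
    SignType.sign (zeta ρ w).im = SignType.sign w.im := by
  rcases lt_trichotomy w.im 0 with h | h | h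
  · rw [sign_neg h, sign_neg (zeta_im_neg h0 h1 h)]
  · rw [h, zeta_im_eq_zero hw h]
  · rw [sign_pos h, sign_pos (zeta_im_pos h0 h1 h)]

/-- Im ζ(w) and Im w have the same sign, so the two half-planes and the ray (1, ∞) are treated
separately: the lower half-plane by conjugation, the ray by monotonicity. -/
theorem zeta_injOn {ρ : ℝ} (h0 : 0 < ρ) (h1 : ρ < 1) : Set.InjOn (zeta ρ) cutPlane := by
  intro a ha b hb h
  have hs : SignType.sign a.im = SignType.sign b.im := by
    rw [← zeta_im_sign h0 h1 ha, ← zeta_im_sign h0 h1 hb, h]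
  rcases lt_trichotomy a.im 0 with h2 | h2 | h2
  · have hb' : b.im < 0 := by rwa [sign_neg h2, eq_comm, sign_eq_neg_one_iff] at hs
    have := zeta_injOn_upper h0 h1 (a := (starRingEnd ℂ) a) (b := (starRingEnd ℂ) b)
      (by simpa using h2) (by simpa using hb') (by rw [zeta_conj ha, zeta_conj hb, h])
    exact (starRingEnd ℂ).injective this
  · have hb' : b.im = 0 := by rwa [h2, sign_zero, eq_comm, sign_eq_zero_iff] at hs
    have ha1 : 1 < a.re := (mem_cutPlane_iff.1 ha).resolve_right (by simpa using h2)
    have hb1 : 1 < b.re := (mem_cutPlane_iff.1 hb).resolve_right (by simpa using hb')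
    have hm : logMod ρ a = logMod ρ b := by rw [← zeta_re, ← zeta_re, h]
    rcases lt_trichotomy a.re b.re with h3 | h3 | h3
    · exact absurd hm (logMod_strictMono_real h0 h1 h2 hb' ha1 h3).ne
    · exact Complex.ext h3 (by rw [h2, hb'])
    · exact absurd hm (logMod_strictMono_real h0 h1 hb' h2 hb1 h3).ne'
  · have hb0 : 0 < b.im := by rwa [sign_pos h2, eq_comm, sign_eq_one_iff] at hs
    exact zeta_injOn_upper h0 h1 h2 hb0 h

/-! ### The critical slit -/

/-- Apply log t ≤ t - 1 to t = (1 - y)/(2ρ) and t = (1 + y)/(2(1 - ρ)); with weights ρ and 1 - ρ the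
linear terms cancel. Equality holds at the critical point y = 1 - 2ρ of ζ. -/
theorem logMod_le_xCrit {ρ : ℝ} (h0 : 0 < ρ) (h1 : ρ < 1) {y : ℝ} (hy : -1 < y) (hy' : y < 1) :
    ρ * Real.log (1 - y) + (1 - ρ) * Real.log (1 + y) ≤ xCrit ρ := by
  have h2 : 0 < 1 - ρ := by linarith
  have a1 := Real.log_le_sub_one_of_pos (x := (1 - y) / (2 * ρ)) (by apply div_pos <;> linarith)
  have a2 := Real.log_le_sub_one_of_pos (x := (1 + y) / (2 * (1 - ρ)))
    (by apply div_pos <;> linarith)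
  rw [Real.log_div (by linarith) (by positivity), Real.log_mul (by norm_num) h0.ne'] at a1
  rw [Real.log_div (by linarith) (by positivity), Real.log_mul (by norm_num) h2.ne'] at a2
  have b1 := mul_le_mul_of_nonneg_left a1 h0.le
  have b2 := mul_le_mul_of_nonneg_left a2 h2.le
  have c1 : ρ * ((1 - y) / (2 * ρ) - 1) = (1 - y) / 2 - ρ := by field_simp
  have c2 : (1 - ρ) * ((1 + y) / (2 * (1 - ρ)) - 1) = (1 + y) / 2 - (1 - ρ) := by field_simp
  rw [c1] at b1; rw [c2] at b2
  rw [xCrit]; nlinarith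

theorem logMod_real_le_xCrit {ρ : ℝ} (h0 : 0 < ρ) (h1 : ρ < 1) {w : ℂ} (hw : w.im = 0)
    (h : -1 < w.re) (h' : w.re < 1) : logMod ρ w ≤ xCrit ρ := by
  have n1 : ‖w - 1‖ = 1 - w.re := by
    rw [show w - 1 = ((w.re - 1 : ℝ) : ℂ) from Complex.ext (by simp) (by simp [hw]),
      Complex.norm_real, Real.norm_eq_abs, abs_of_neg (by linarith)]
    ring
  have n2 : ‖w + 1‖ = 1 + w.re := by
    rw [show w + 1 = ((1 + w.re : ℝ) : ℂ) from Complex.ext (by simp [add_comm]) (by simp [hw]),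
      Complex.norm_real, Real.norm_eq_abs, abs_of_pos (by linarith)]
  rw [logMod, n1, n2]
  exact logMod_le_xCrit h0 h1 h h'

/-- On [1 - 2ρ, 1) the function falls continuously from `xCrit` to -∞. -/
theorem exists_real_logMod_eq {ρ : ℝ} (h0 : 0 < ρ) (h1 : ρ < 1) {x : ℝ} (hx : x ≤ xCrit ρ) :
    ∃ y : ℝ, -1 < y ∧ y < 1 ∧ ρ * Real.log (1 - y) + (1 - ρ) * Real.log (1 + y) = x := by
  let f : ℝ → ℝ := fun y => ρ * Real.log (1 - y) + (1 - ρ) * Real.log (1 + y)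
  have hc : ContinuousOn f (Set.Ico (1 - 2 * ρ) 1) := by
    apply ContinuousOn.add
    · exact continuousOn_const.mul (ContinuousOn.log (by fun_prop) fun y hy => by
        have := hy.2; linarith)
    · exact continuousOn_const.mul (ContinuousOn.log (by fun_prop) fun y hy => by
        have := hy.1; linarith)
  have hlim : Tendsto f (𝓝[<] 1) atBot := by
    have t1 : Tendsto (fun y : ℝ => Real.log (1 - y)) (𝓝[<] 1) atBot := by
      refine Real.tendsto_log_nhdsNE_zero.comp (tendsto_nhdsWithin_iff.2 ⟨?_, ?_⟩)
      · have : Tendsto (fun y : ℝ => 1 - y) (𝓝 1) (𝓝 (1 - 1)) :=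
          (continuous_const.sub continuous_id).tendsto 1
        rw [sub_self] at this
        exact this.mono_left nhdsWithin_le_nhds
      · filter_upwards [self_mem_nhdsWithin] with y hy
        have : y < 1 := hy
        simp only [Set.mem_compl_iff, Set.mem_singleton_iff]
        linarith
    have t2 : Tendsto (fun y : ℝ => (1 - ρ) * Real.log (1 + y)) (𝓝[<] 1)
        (𝓝 ((1 - ρ) * Real.log (1 + 1))) := by
      have : ContinuousAt (fun y : ℝ => (1 - ρ) * Real.log (1 + y)) 1 :=
        continuousAt_const.mul (ContinuousAt.log (by fun_prop) (by norm_num))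
      exact this.tendsto.mono_left nhdsWithin_le_nhds
    exact (t1.const_mul_atBot h0).atBot_add t2
  have hval : f (1 - 2 * ρ) = xCrit ρ := by
    simp only [f, xCrit]
    rw [show 1 - (1 - 2 * ρ) = 2 * ρ by ring, show 1 + (1 - 2 * ρ) = 2 * (1 - ρ) by ring,
      Real.log_mul (by norm_num) h0.ne', Real.log_mul (by norm_num) (by linarith)]
    ring
  have hev := hlim.eventually (eventually_le_atBot x)
  obtain ⟨z, hz, hzI⟩ := (hev.and (Ioo_mem_nhdsLT (show 1 - 2 * ρ < 1 by linarith))).exists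
  have := intermediate_value_Icc' hzI.1.le
    (hc.mono (Set.Icc_subset_Ico_right hzI.2)) (show x ∈ Set.Icc (f z) (f (1 - 2 * ρ)) from
      ⟨hz, hval ▸ hx⟩)
  obtain ⟨y, hy, hyx⟩ := this
  exact ⟨y, by linarith [hy.1], by linarith [hy.2, hzI.2], hyx⟩

/-- In the upper half-plane, the level `ρ π` of the angle is only reached above the critical
radius. -/
theorem xCrit_lt_of_im_eq {ρ : ℝ} (h0 : 0 < ρ) (h1 : ρ < 1) {w : ℂ} (hw : 0 < w.im)
    (h : (zeta ρ w).im = ρ * Real.pi) : xCrit ρ < (zeta ρ w).re := by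
  -- Below `f` is the branch of the coordinate that is real on (-1, 1) and equals ζ - iρπ in the
  -- upper half-plane. If Re ζ(w) ≤ `xCrit`, some real `y` would have the same `f`-value as `w`,
  -- although Im `f'` < 0 along the open segment between them.
  by_contra! hx
  obtain ⟨y, hy, hy', hyx⟩ := exists_real_logMod_eq h0 h1 hx
  let f : ℂ → ℂ := fun z => ρ * Complex.log (1 - z) + (1 - ρ) * Complex.log (1 + z)
  have hpos : ∀ t ∈ Set.Ioc (0 : ℝ) 1, 0 < ((y : ℂ) + t * (w - y)).im := by
    intro t ht
    rw [segment_im]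
    simpa using mul_pos ht.1 hw
  have hd : ∀ z : ℂ, 1 - z ∈ Complex.slitPlane → 1 + z ∈ Complex.slitPlane →
      HasDerivAt f (zetaDeriv ρ z) z := by
    intro z hz hz'
    have e := zetaDeriv_eq (ρ := ρ) (w := z)
      (by rw [← neg_sub]; exact neg_ne_zero.2 (Complex.slitPlane_ne_zero hz))
      (by rw [add_comm]; exact Complex.slitPlane_ne_zero hz')
    have a1 : HasDerivAt (fun z : ℂ => Complex.log (1 - z)) (-1 / (1 - z)) z :=
      ((hasDerivAt_id z).const_sub 1).clog hz
    have a2 : HasDerivAt (fun z : ℂ => Complex.log (1 + z)) (1 / (1 + z)) z :=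
      ((hasDerivAt_id z).const_add 1).clog hz'
    rw [e, show 1 / (z - 1) = -1 / (1 - z) by rw [← neg_sub, div_neg, neg_div],
      add_comm z 1]
    exact (a1.const_mul (ρ : ℂ)).add (a2.const_mul (1 - ρ : ℂ))
  have hsl : ∀ z : ℂ, 0 < z.im → 1 - z ∈ Complex.slitPlane ∧ 1 + z ∈ Complex.slitPlane := by
    intro z hz
    simp only [Complex.mem_slitPlane_iff]
    exact ⟨Or.inr (by simpa using hz.ne'), Or.inr (by simpa using hz.ne')⟩
  have hne : (y : ℂ) ≠ w := by rintro rfl; simp at hw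
  refine ne_of_deriv_im_neg (f := f) (f' := zetaDeriv ρ) hne ?_ ?_ ?_ ?_
  · intro t ht
    have h2 : ContinuousAt f ((y : ℂ) + t * (w - y)) := by
      rcases eq_or_lt_of_le ht.1 with h | h
      · have hz : (y : ℂ) + t * (w - y) = y := by simp [← h]
        rw [hz]
        refine (hd y ?_ ?_).continuousAt <;> rw [Complex.mem_slitPlane_iff] <;> left
        · simpa using hy'
        · simp; linarith
      · have := hsl _ (hpos t ⟨h, ht.2⟩)
        exact (hd _ this.1 this.2).continuousAt
    exact (ContinuousAt.comp (f := fun t : ℝ => (y : ℂ) + t * (w - y)) h2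
      (by fun_prop)).continuousWithinAt
  · intro t ht
    have := hsl _ (hpos t ⟨ht.1, ht.2.le⟩)
    exact hd _ this.1 this.2
  · intro t ht
    exact zetaDeriv_im_neg h0 h1 (hpos t ⟨ht.1, ht.2.le⟩)
  · apply Complex.ext
    · have n1 : ‖(1 : ℂ) - y‖ = 1 - y := by
        rw [← Complex.ofReal_one, ← Complex.ofReal_sub, Complex.norm_real, Real.norm_eq_abs,
          abs_of_pos (by linarith)]
      have n2 : ‖(1 : ℂ) + y‖ = 1 + y := by
        rw [← Complex.ofReal_one, ← Complex.ofReal_add, Complex.norm_real, Real.norm_eq_abs,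
          abs_of_pos (by linarith)]
      rw [zeta_re, logMod] at hyx
      simp only [f, Complex.add_re, Complex.re_ofReal_mul, ← Complex.ofReal_one,
        ← Complex.ofReal_sub, Complex.log_re]
      simp only [Complex.ofReal_one, Complex.ofReal_sub]
      rw [n1, n2, hyx, norm_sub_rev 1 w, add_comm 1 w]
    · have i1 : (1 - w).arg = (w - 1).arg - Real.pi := by
        rw [← neg_sub, Complex.arg_neg_eq_arg_sub_pi_of_im_pos (by simpa using hw)]
      have i2 : ((1 : ℂ) - y).arg = 0 := arg_eq_zero_of_real (by simp) (by simp; linarith)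
      have i3 : ((1 : ℂ) + y).arg = 0 := arg_eq_zero_of_real (by simp) (by simp; linarith)
      rw [zeta_im] at h
      simp only [f, Complex.add_im, Complex.im_ofReal_mul, ← Complex.ofReal_one,
        ← Complex.ofReal_sub, Complex.log_im]
      simp only [Complex.ofReal_one, Complex.ofReal_sub]
      rw [i1, i2, i3, add_comm 1 w]
      linarith

/-! ### A priori bounds and compactness -/

theorem norm_sub_one_le (w : ℂ) : ‖w - 1‖ ≤ ‖w + 1‖ + 2 := by
  calc ‖w - 1‖ = ‖(w + 1) - 2‖ := by ring_nf
    _ ≤ ‖w + 1‖ + ‖(2 : ℂ)‖ := norm_sub_le _ _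
    _ = ‖w + 1‖ + 2 := by simp

theorem norm_add_one_le (w : ℂ) : ‖w + 1‖ ≤ ‖w - 1‖ + 2 := by
  calc ‖w + 1‖ = ‖(w - 1) + 2‖ := by ring_nf
    _ ≤ ‖w - 1‖ + ‖(2 : ℂ)‖ := norm_add_le _ _
    _ = ‖w - 1‖ + 2 := by simp

theorem norm_sub_one_pos {w : ℂ} (hw : w ≠ 1) : 0 < ‖w - 1‖ := norm_pos_iff.2 (sub_ne_zero.2 hw)

theorem norm_add_one_pos {w : ℂ} (hw : w ≠ -1) : 0 < ‖w + 1‖ :=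
  norm_pos_iff.2 fun h => hw (eq_neg_of_add_eq_zero_left h)

theorem ne_of_mem_cutPlane {w : ℂ} (hw : w ∈ cutPlane) : w ≠ 1 ∧ w ≠ -1 :=
  ⟨sub_ne_zero.1 (Complex.slitPlane_ne_zero hw), fun h =>
    Complex.slitPlane_ne_zero (add_one_mem_slitPlane hw) (by simp [h])⟩

theorem weighted_lt {ρ a b c : ℝ} (h0 : 0 < ρ) (h1 : ρ < 1) (ha : a < c) (hb : b < c) :
    ρ * a + (1 - ρ) * b < c := by
  nlinarith [mul_pos h0 (sub_pos.2 ha), mul_pos (sub_pos.2 h1) (sub_pos.2 hb)]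

theorem exp_logMod_le {ρ : ℝ} (h0 : 0 < ρ) (h1 : ρ < 1) {w : ℂ} (hw : w ≠ 1) (hw' : w ≠ -1) :
    Real.exp (logMod ρ w) ≤ ‖w + 1‖ + 2 := by
  by_contra! h
  have a1 : Real.log ‖w - 1‖ < logMod ρ w := by
    rw [Real.log_lt_iff_lt_exp (norm_sub_one_pos hw)]
    linarith [norm_sub_one_le w]
  have a2 : Real.log ‖w + 1‖ < logMod ρ w := by
    rw [Real.log_lt_iff_lt_exp (norm_add_one_pos hw')]
    linarith
  exact lt_irrefl _ (weighted_lt h0 h1 a1 a2)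

/-- At least one of |w - 1|, |w + 1| is at most their weighted geometric mean, and the two differ by
at most 2. -/
theorem norm_le_exp_logMod {ρ : ℝ} (h0 : 0 < ρ) (h1 : ρ < 1) {w : ℂ} (hw : w ≠ 1)
    (hw' : w ≠ -1) :
    ‖w - 1‖ ≤ Real.exp (logMod ρ w) + 2 ∧ ‖w + 1‖ ≤ Real.exp (logMod ρ w) + 2 := by
  have key : ‖w - 1‖ ≤ Real.exp (logMod ρ w) ∨ ‖w + 1‖ ≤ Real.exp (logMod ρ w) := by
    by_contra! h
    have a1 : -Real.log ‖w - 1‖ < -logMod ρ w :=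
      neg_lt_neg ((Real.lt_log_iff_exp_lt (norm_sub_one_pos hw)).2 h.1)
    have a2 : -Real.log ‖w + 1‖ < -logMod ρ w :=
      neg_lt_neg ((Real.lt_log_iff_exp_lt (norm_add_one_pos hw')).2 h.2)
    have := weighted_lt h0 h1 a1 a2
    rw [logMod] at this
    linarith
  have := norm_sub_one_le w
  have := norm_add_one_le w
  rcases key with h | h <;> constructor <;> linarith

/-- An upper bound for |w + 1| becomes a lower bound for |w - 1| once the weighted mean is known.
This keeps points of bounded `logMod` away from the singularities. -/
theorem le_norm_sub_one {ρ : ℝ} (h0 : 0 < ρ) (h1 : ρ < 1) {w : ℂ} (hw : w ≠ 1) (hw' : w ≠ -1) :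
    Real.exp ((logMod ρ w - (1 - ρ) * Real.log (Real.exp (logMod ρ w) + 2)) / ρ) ≤ ‖w - 1‖ := by
  rw [← Real.le_log_iff_exp_le (norm_sub_one_pos hw), div_le_iff₀ h0]
  have := Real.log_le_log (norm_add_one_pos hw') (norm_le_exp_logMod h0 h1 hw hw').2
  have := mul_le_mul_of_nonneg_left this (sub_pos.2 h1).le
  have e : logMod ρ w = ρ * Real.log ‖w - 1‖ + (1 - ρ) * Real.log ‖w + 1‖ := rfl
  linarith

theorem le_norm_add_one {ρ : ℝ} (h0 : 0 < ρ) (h1 : ρ < 1) {w : ℂ} (hw : w ≠ 1) (hw' : w ≠ -1) :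
    Real.exp ((logMod ρ w - ρ * Real.log (Real.exp (logMod ρ w) + 2)) / (1 - ρ)) ≤ ‖w + 1‖ := by
  rw [← Real.le_log_iff_exp_le (norm_add_one_pos hw'), div_le_iff₀ (sub_pos.2 h1)]
  have := Real.log_le_log (norm_sub_one_pos hw) (norm_le_exp_logMod h0 h1 hw hw').1
  have := mul_le_mul_of_nonneg_left this h0.le
  have e : logMod ρ w = ρ * Real.log ‖w - 1‖ + (1 - ρ) * Real.log ‖w + 1‖ := rfl
  linarith

theorem abs_arg_eq_arccos {z : ℂ} (hz : z ≠ 0) : |z.arg| = Real.arccos (z.re / ‖z‖) := by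
  rw [← Complex.cos_arg hz, ← Real.cos_abs,
    Real.arccos_cos (abs_nonneg _) (Complex.abs_arg_le_pi z)]

/-- Taking the absolute value removes the jump of the argument across the negative axis. Limits of
roots may lie on the cut, which is why `absArg` is used in place of Im ζ. -/
theorem continuousAt_abs_arg {z : ℂ} (hz : z ≠ 0) : ContinuousAt (fun z : ℂ => |z.arg|) z := by
  have : ContinuousAt (fun z : ℂ => Real.arccos (z.re / ‖z‖)) z :=
    Real.continuous_arccos.continuousAt.comp
      (Complex.continuous_re.continuousAt.div continuous_norm.continuousAt (norm_ne_zero_iff.2 hz))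
  refine this.congr ?_
  filter_upwards [isOpen_ne.mem_nhds hz] with y hy using (abs_arg_eq_arccos hy).symm

theorem continuousAt_absArg {ρ : ℝ} {w : ℂ} (hw : w ≠ 1) (hw' : w ≠ -1) :
    ContinuousAt (absArg ρ) w := by
  have a1 : ContinuousAt (fun w : ℂ => |(w - 1).arg|) w :=
    ContinuousAt.comp (f := fun w : ℂ => w - 1) (continuousAt_abs_arg (sub_ne_zero.2 hw))
      (by fun_prop)
  have a2 : ContinuousAt (fun w : ℂ => |(w + 1).arg|) w :=
    ContinuousAt.comp (f := fun w : ℂ => w + 1)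
      (continuousAt_abs_arg fun h => hw' (eq_neg_of_add_eq_zero_left h)) (by fun_prop)
  exact (continuousAt_const.mul a1).add (continuousAt_const.mul a2)

theorem continuousAt_logMod {ρ : ℝ} {w : ℂ} (hw : w ≠ 1) (hw' : w ≠ -1) :
    ContinuousAt (logMod ρ) w := by
  have a1 : ContinuousAt (fun w : ℂ => Real.log ‖w - 1‖) w :=
    ContinuousAt.log (by fun_prop) (norm_sub_one_pos hw).ne'
  have a2 : ContinuousAt (fun w : ℂ => Real.log ‖w + 1‖) w :=
    ContinuousAt.log (by fun_prop) (norm_add_one_pos hw').ne'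
  exact (continuousAt_const.mul a1).add (continuousAt_const.mul a2)

/-- A sequence along which the logarithmic coordinate converges has a cluster point off `±1`. -/
theorem exists_subseq_tendsto {ρ : ℝ} (h0 : 0 < ρ) (h1 : ρ < 1) {w : ℕ → ℂ}
    (hw : ∀ n, w n ≠ 1 ∧ w n ≠ -1) {x ψ : ℝ}
    (hx : Tendsto (fun n => logMod ρ (w n)) atTop (𝓝 x))
    (hψ : Tendsto (fun n => absArg ρ (w n)) atTop (𝓝 ψ)) :
    ∃ (v : ℂ) (φ : ℕ → ℕ), StrictMono φ ∧ Tendsto (w ∘ φ) atTop (𝓝 v) ∧ v ≠ 1 ∧ v ≠ -1 ∧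
      logMod ρ v = x ∧ absArg ρ v = ψ := by
  have hev : ∀ᶠ n in atTop, w n ∈ Metric.closedBall (1 : ℂ) (Real.exp (x + 1) + 2) := by
    filter_upwards [hx.eventually (eventually_le_nhds (lt_add_one x))] with n hn
    rw [Metric.mem_closedBall, dist_eq_norm]
    refine (norm_le_exp_logMod h0 h1 (hw n).1 (hw n).2).1.trans ?_
    gcongr
  obtain ⟨v, -, φ, hφ, hv⟩ :=
    (isCompact_closedBall (1 : ℂ) (Real.exp (x + 1) + 2)).tendsto_subseq' hev.frequently
  have hx' := hx.comp hφ.tendsto_atTop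
  have hψφ := hψ.comp hφ.tendsto_atTop
  have hpos : ∀ y : ℝ, Real.exp y + 2 ≠ 0 := fun y => by positivity
  have c1 : Continuous fun y : ℝ =>
      Real.exp ((y - (1 - ρ) * Real.log (Real.exp y + 2)) / ρ) := by
    have : Continuous fun y : ℝ => Real.log (Real.exp y + 2) :=
      Continuous.log (by fun_prop) hpos
    fun_prop
  have c2 : Continuous fun y : ℝ =>
      Real.exp ((y - ρ * Real.log (Real.exp y + 2)) / (1 - ρ)) := by
    have : Continuous fun y : ℝ => Real.log (Real.exp y + 2) :=
      Continuous.log (by fun_prop) hpos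
    fun_prop
  -- The lower bounds on the distances to ±1 are continuous in the modulus and hence pass to the
  -- limit.
  have b1 := le_of_tendsto_of_tendsto' ((c1.tendsto x).comp hx') ((hv.sub_const 1).norm)
    fun n => le_norm_sub_one h0 h1 (hw (φ n)).1 (hw (φ n)).2
  have b2 := le_of_tendsto_of_tendsto' ((c2.tendsto x).comp hx') ((hv.add_const 1).norm)
    fun n => le_norm_add_one h0 h1 (hw (φ n)).1 (hw (φ n)).2
  have v1 : v ≠ 1 := by
    rintro rfl
    simp at b1
    exact absurd b1 (not_le.2 (Real.exp_pos _))
  have v2 : v ≠ -1 := by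
    rintro rfl
    simp at b2
    exact absurd b2 (not_le.2 (Real.exp_pos _))
  exact ⟨v, φ, hφ, hv, v1, v2,
    tendsto_nhds_unique ((continuousAt_logMod v1 v2).tendsto.comp hv) hx',
    tendsto_nhds_unique ((continuousAt_absArg v1 v2).tendsto.comp hv) hψφ⟩

/-! ### The inverse of the logarithmic coordinate -/

/-- The image of the cut plane under the logarithmic coordinate. -/
def zetaImage (ρ : ℝ) : Set ℂ := zeta ρ '' cutPlane

theorem isOpen_zetaImage {ρ : ℝ} (h0 : 0 < ρ) : IsOpen (zetaImage ρ) := by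
  rw [isOpen_iff_mem_nhds]
  rintro _ ⟨w, hw, rfl⟩
  rw [← (hasStrictDerivAt_zeta ρ hw).map_nhds_eq (zetaDeriv_ne_zero h0 hw)]
  exact image_mem_map (isOpen_cutPlane.mem_nhds hw)

/-- A point of the plane which is off `±1` and is real but not in the cut plane. -/
theorem absArg_of_notMem {ρ : ℝ} (h0 : 0 < ρ) (h1 : ρ < 1) {w : ℂ} (hw : w ∉ cutPlane)
    (hw1 : w ≠ 1) (hw2 : w ≠ -1) :
    (absArg ρ w = ρ * Real.pi ∧ logMod ρ w ≤ xCrit ρ ∧ w.im = 0 ∧ -1 < w.re) ∨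
      absArg ρ w = Real.pi := by
  rw [mem_cutPlane_iff] at hw
  push Not at hw
  have n1 : w.re ≠ 1 := fun h => hw1 (Complex.ext (by simpa using h) (by simpa using hw.2))
  have n2 : w.re ≠ -1 := fun h => hw2 (Complex.ext (by simpa using h) (by simpa using hw.2))
  have l1 := lt_of_le_of_ne hw.1 n1
  rcases lt_or_gt_of_ne n2 with h | h
  · exact Or.inr (absArg_of_lt_neg_one hw.2 h)
  · exact Or.inl ⟨absArg_of_mem_Ioo hw.2 h.le l1, logMod_real_le_xCrit h0 h1 hw.2 h l1, hw.2, h⟩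

/-- Preimages of a convergent sequence cluster at some point off ±1. On the cut the angle is either
π, or ρπ with modulus at most `xCrit`; the hypothesis excludes both, so the cluster point is a
preimage of the limit. -/
theorem closure_zetaImage_inter {ρ : ℝ} (h0 : 0 < ρ) (h1 : ρ < 1) {ζ : ℂ}
    (hζ : ζ ∈ closure (zetaImage ρ))
    (h : |ζ.im| < ρ * Real.pi ∨ (xCrit ρ < ζ.re ∧ |ζ.im| < Real.pi)) : ζ ∈ zetaImage ρ := by
  obtain ⟨z, hz, hzζ⟩ := mem_closure_iff_seq_limit.1 hζ
  choose w hw hwz using hz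
  have hx : Tendsto (fun n => logMod ρ (w n)) atTop (𝓝 ζ.re) := by
    simp only [← zeta_re, hwz]
    exact (Complex.continuous_re.tendsto _).comp hzζ
  have hψ : Tendsto (fun n => absArg ρ (w n)) atTop (𝓝 |ζ.im|) := by
    simp only [absArg_eq_abs_zeta_im h0 h1, hwz]
    exact ((Complex.continuous_im.tendsto _).comp hzζ).abs
  obtain ⟨v, φ, hφ, hv, v1, v2, e1, e2⟩ :=
    exists_subseq_tendsto h0 h1 (fun n => ne_of_mem_cutPlane (hw n)) hx hψ
  by_cases hvm : v ∈ cutPlane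
  · refine ⟨v, hvm, ?_⟩
    have := (hasStrictDerivAt_zeta ρ hvm).hasDerivAt.continuousAt.tendsto.comp hv
    refine tendsto_nhds_unique this ?_
    have := hzζ.comp hφ.tendsto_atTop
    refine this.congr fun n => ?_
    simp [hwz]
  · exfalso
    have hp : ρ * Real.pi < Real.pi := by nlinarith [Real.pi_pos]
    rcases absArg_of_notMem h0 h1 hvm v1 v2 with ⟨a, b, -, -⟩ | a
    · rcases h with h | h
      · linarith
      · linarith [h.1]
    · rcases h with h | h
      · linarith
      · linarith [h.2]

/-- A base point whose image lies in both regions of `mem_zetaImage`. -/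
theorem zeta_three {ρ : ℝ} (h0 : 0 < ρ) (h1 : ρ < 1) :
    (3 : ℂ) ∈ cutPlane ∧ (zeta ρ 3).im = 0 ∧ xCrit ρ < (zeta ρ 3).re := by
  have h3 : (3 : ℂ) ∈ cutPlane := mem_cutPlane_iff.2 (by norm_num)
  refine ⟨h3, zeta_im_eq_zero h3 (by norm_num), ?_⟩
  rw [zeta_re, logMod, xCrit]
  have e1 : ‖(3 : ℂ) - 1‖ = 2 := by norm_num
  have e2 : ‖(3 : ℂ) + 1‖ = 4 := by norm_num
  rw [e1, e2]
  have l1 := Real.log_lt_log (by norm_num : (0 : ℝ) < 2) (by norm_num : (2 : ℝ) < 4)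
  have l2 := Real.log_neg h0 h1
  have l3 := Real.log_neg (sub_pos.2 h1) (by linarith)
  nlinarith [mul_pos h0 (neg_pos.2 l2), mul_pos (sub_pos.2 h1) (neg_pos.2 l3),
    mul_pos (sub_pos.2 h1) (sub_pos.2 l1)]

theorem convex_strip (a : ℝ) : Convex ℝ {ζ : ℂ | |ζ.im| < a} := by
  have : {ζ : ℂ | |ζ.im| < a} = Complex.imCLM ⁻¹' (Set.Ioo (-a) a) := by
    ext ζ; simp [abs_lt]
  rw [this]
  exact (convex_Ioo _ _).linear_preimage Complex.imCLM.toLinearMap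

/-- Each of the two regions is convex, hence connected, and the image is open, relatively closed in
the region, and meets it at the image of 3. -/
theorem mem_zetaImage {ρ : ℝ} (h0 : 0 < ρ) (h1 : ρ < 1) {ζ : ℂ}
    (h : |ζ.im| < ρ * Real.pi ∨ (xCrit ρ < ζ.re ∧ |ζ.im| < Real.pi)) : ζ ∈ zetaImage ρ := by
  obtain ⟨m, i, r⟩ := zeta_three h0 h1
  rcases h with h | h
  · refine ((convex_strip (ρ * Real.pi)).isPreconnected).subset_of_closure_inter_subset
      (isOpen_zetaImage h0) ⟨zeta ρ 3, ?_, 3, m, rfl⟩ ?_ h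
    · simp only [Set.mem_ofPred_eq, i, abs_zero]
      exact mul_pos h0 Real.pi_pos
    · exact fun z hz => closure_zetaImage_inter h0 h1 hz.1 (Or.inl hz.2)
  · have hc : Convex ℝ ({ζ : ℂ | xCrit ρ < ζ.re} ∩ {ζ : ℂ | |ζ.im| < Real.pi}) :=
      (convex_halfSpace_re_gt _).inter (convex_strip _)
    refine hc.isPreconnected.subset_of_closure_inter_subset
      (isOpen_zetaImage h0) ⟨zeta ρ 3, ⟨r, ?_⟩, 3, m, rfl⟩ ?_ h
    · simp only [Set.mem_ofPred_eq, i, abs_zero]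
      exact Real.pi_pos
    · exact fun z hz => closure_zetaImage_inter h0 h1 hz.1 (Or.inr hz.2)

/-- The inverse of the logarithmic coordinate. -/
noncomputable def zetaInv (ρ : ℝ) : ℂ → ℂ := Function.invFunOn (zeta ρ) cutPlane

theorem zetaInv_mem {ρ : ℝ} {ζ : ℂ} (h : ζ ∈ zetaImage ρ) : zetaInv ρ ζ ∈ cutPlane :=
  Function.invFunOn_mem h

theorem zeta_zetaInv {ρ : ℝ} {ζ : ℂ} (h : ζ ∈ zetaImage ρ) : zeta ρ (zetaInv ρ ζ) = ζ :=
  Function.invFunOn_eq h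

theorem zetaInv_zeta {ρ : ℝ} (h0 : 0 < ρ) (h1 : ρ < 1) {w : ℂ} (h : w ∈ cutPlane) :
    zetaInv ρ (zeta ρ w) = w :=
  (zeta_injOn h0 h1).leftInvOn_invFunOn h

theorem hasDerivAt_zetaInv {ρ : ℝ} (h0 : 0 < ρ) (h1 : ρ < 1) {ζ : ℂ} (h : ζ ∈ zetaImage ρ) :
    HasDerivAt (zetaInv ρ) (zetaDeriv ρ (zetaInv ρ ζ))⁻¹ ζ := by
  obtain ⟨w, hw, rfl⟩ := h
  rw [zetaInv_zeta h0 h1 hw]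
  refine ((hasStrictDerivAt_zeta ρ hw).to_local_left_inverse (zetaDeriv_ne_zero h0 hw)
    ?_).hasDerivAt
  filter_upwards [isOpen_cutPlane.mem_nhds hw] with z hz using zetaInv_zeta h0 h1 hz

theorem conj_mem_zetaImage {ρ : ℝ} {ζ : ℂ} (h : ζ ∈ zetaImage ρ) :
    (starRingEnd ℂ) ζ ∈ zetaImage ρ := by
  obtain ⟨w, hw, rfl⟩ := h
  exact ⟨_, conj_mem_cutPlane hw, zeta_conj hw⟩

theorem zetaInv_conj {ρ : ℝ} (h0 : 0 < ρ) (h1 : ρ < 1) {ζ : ℂ} (h : ζ ∈ zetaImage ρ) :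
    zetaInv ρ ((starRingEnd ℂ) ζ) = (starRingEnd ℂ) (zetaInv ρ ζ) := by
  obtain ⟨w, hw, rfl⟩ := h
  rw [← zeta_conj hw, zetaInv_zeta h0 h1 hw, zetaInv_zeta h0 h1 (conj_mem_cutPlane hw)]

theorem zetaInv_im_pos {ρ : ℝ} (h0 : 0 < ρ) (h1 : ρ < 1) {ζ : ℂ} (h : ζ ∈ zetaImage ρ)
    (hi : 0 < ζ.im) : 0 < (zetaInv ρ ζ).im := by
  have := zeta_im_sign h0 h1 (zetaInv_mem h)
  rwa [zeta_zetaInv h, sign_pos hi, eq_comm, sign_eq_one_iff] at this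

/-! ### The dilogarithm -/

theorem one_sub_mul_mem_slitPlane {z : ℂ} (hz : 1 - z ∈ Complex.slitPlane) {t : ℝ}
    (ht : t ∈ Set.Icc (0 : ℝ) 1) : 1 - (t : ℂ) * z ∈ Complex.slitPlane := by
  have := Complex.starConvex_one_slitPlane.add_smul_mem (y := -z) (by simpa [sub_eq_add_neg] using hz)
    ht.1 ht.2
  simpa [sub_eq_add_neg] using this

/-- On (0, 1] the integrand is the difference quotient at 0 of t ↦ log(1 - tz), which extends
continuously to t = 0. -/
theorem intervalIntegrable_dilog {z : ℂ} (hz : 1 - z ∈ Complex.slitPlane) :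
    IntervalIntegrable (fun t : ℝ => Complex.log (1 - (t : ℂ) * z) / (t : ℂ))
      MeasureTheory.volume 0 1 := by
  let g : ℝ → ℂ := fun t => Complex.log (1 - (t : ℂ) * z)
  have hd : ∀ t ∈ Set.Icc (0 : ℝ) 1, DifferentiableAt ℝ g t := by
    intro t ht
    have h2 : HasDerivAt (fun t : ℂ => 1 - t * z) (-(1 * z)) (t : ℂ) :=
      ((hasDerivAt_id (t : ℂ)).mul_const z).const_sub 1
    exact (h2.clog (one_sub_mul_mem_slitPlane hz ht)).comp_ofReal.differentiableAt
  have hc : ContinuousOn (dslope g 0) (Set.uIcc 0 1) := by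
    rw [Set.uIcc_of_le zero_le_one]
    intro t ht
    refine ContinuousAt.continuousWithinAt ?_
    rcases eq_or_ne t 0 with rfl | h
    · exact continuousAt_dslope_same.2 (hd 0 ht)
    · exact (continuousAt_dslope_of_ne h).2 (hd t ht).continuousAt
  refine hc.intervalIntegrable.congr ?_
  intro t ht
  rw [Set.uIoc_of_le zero_le_one] at ht
  rw [dslope_of_ne _ ht.1.ne', slope_def_module]
  simp only [g, Complex.ofReal_zero, zero_mul, sub_zero, Complex.log_one]
  rw [Complex.real_smul, Complex.ofReal_inv, div_eq_inv_mul]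

/-- Differentiation under the integral sign: the factor t from the chain rule cancels the
denominator. The derivative is left as an integral because `Complex.log_eq_integral` evaluates it in
that form. -/
theorem hasDerivAt_dilog {z : ℂ} (hz : 1 - z ∈ Complex.slitPlane) :
    HasDerivAt dilog (∫ t in (0 : ℝ)..1, (1 - (t : ℂ) * z)⁻¹) z := by
  have hopen : IsOpen {z : ℂ | 1 - z ∈ Complex.slitPlane} :=
    Complex.isOpen_slitPlane.preimage (by fun_prop)
  obtain ⟨ε, hε, hball⟩ := Metric.nhds_basis_closedBall.mem_iff.1 (hopen.mem_nhds hz)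
  have hcont : ContinuousOn (fun q : ℝ × ℂ => (1 - (q.1 : ℂ) * q.2)⁻¹)
      (Set.Icc (0 : ℝ) 1 ×ˢ Metric.closedBall z ε) := by
    refine ContinuousOn.inv₀ (by fun_prop) ?_
    rintro ⟨t, y⟩ ⟨ht, hy⟩
    exact Complex.slitPlane_ne_zero (one_sub_mul_mem_slitPlane (hball hy) ht)
  obtain ⟨B, hB⟩ := (isCompact_Icc.prod (isCompact_closedBall z ε)).exists_bound_of_continuousOn
    hcont
  have key := intervalIntegral.hasDerivAt_integral_of_dominated_loc_of_deriv_le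
    (μ := MeasureTheory.volume) (a := (0 : ℝ)) (b := 1)
    (F := fun (y : ℂ) (t : ℝ) => -(Complex.log (1 - (t : ℂ) * y) / (t : ℂ)))
    (F' := fun y t => (1 - (t : ℂ) * y)⁻¹) (x₀ := z) (s := Metric.closedBall z ε)
    (bound := fun _ => B) (Metric.closedBall_mem_nhds z hε) ?_ ?_ ?_ ?_ ?_ ?_
  · have := key.2
    simp only [intervalIntegral.integral_neg] at this
    exact this
  · filter_upwards [Metric.closedBall_mem_nhds z hε] with y hy
    exact (intervalIntegrable_dilog (hball hy)).neg.def'.aestronglyMeasurable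
  · exact (intervalIntegrable_dilog hz).neg
  · refine ContinuousOn.aestronglyMeasurable ?_ measurableSet_uIoc
    rw [Set.uIoc_of_le zero_le_one]
    refine ContinuousOn.inv₀ (by fun_prop) fun t ht => ?_
    exact Complex.slitPlane_ne_zero
      (one_sub_mul_mem_slitPlane hz (Set.Ioc_subset_Icc_self ht))
  · refine Eventually.of_forall fun t ht y hy => ?_
    rw [Set.uIoc_of_le zero_le_one] at ht
    exact hB (t, y) ⟨Set.Ioc_subset_Icc_self ht, hy⟩
  · exact intervalIntegrable_const
  · refine Eventually.of_forall fun t ht y hy => ?_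
    rw [Set.uIoc_of_le zero_le_one] at ht
    have h2 : HasDerivAt (fun y : ℂ => 1 - (t : ℂ) * y) (-((t : ℂ) * 1)) y :=
      ((hasDerivAt_id y).const_mul (t : ℂ)).const_sub 1
    have hs := one_sub_mul_mem_slitPlane (hball hy) (Set.Ioc_subset_Icc_self ht)
    have h3 := ((h2.clog hs).div_const (t : ℂ)).neg
    have h4 : (t : ℂ) ≠ 0 := Complex.ofReal_ne_zero.2 ht.1.ne'
    have h5 := Complex.slitPlane_ne_zero hs
    convert! h3 using 1
    field_simp

theorem dilog_conj {z : ℂ} (hz : 1 - z ∈ Complex.slitPlane) :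
    dilog ((starRingEnd ℂ) z) = (starRingEnd ℂ) (dilog z) := by
  rw [dilog, dilog, map_neg, intervalIntegral.integral_of_le zero_le_one,
    intervalIntegral.integral_of_le zero_le_one, ← integral_conj]
  congr 1
  refine MeasureTheory.setIntegral_congr_fun measurableSet_Ioc fun t ht => ?_
  have h2 := Complex.log_conj _ (Complex.slitPlane_arg_ne_pi
    (one_sub_mul_mem_slitPlane hz (Set.Ioc_subset_Icc_self ht)))
  simp only [map_sub, map_one, map_mul, Complex.conj_ofReal] at h2
  simp [h2]

/-! ### The primitive of the consistency function -/

/-- The logarithm of `(1 + w) / 2`. -/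
noncomputable def ell (w : ℂ) : ℂ := Complex.log (w + 1) - (Real.log 2 : ℝ)

theorem ell_re (w : ℂ) : (ell w).re = Real.log ‖w + 1‖ - Real.log 2 := by
  simp [ell, Complex.log_re]

theorem ell_im (w : ℂ) : (ell w).im = (w + 1).arg := by
  simp only [ell, Complex.sub_im, Complex.log_im, Complex.ofReal_im, sub_zero]

/-- A primitive of `ell` with respect to the logarithmic coordinate. -/
noncomputable def primK (ρ : ℝ) (w : ℂ) : ℂ :=
  (1 - ρ) * (Complex.log (w + 1) ^ 2 / 2 - (Real.log 2 : ℝ) * Complex.log (w + 1))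
    - ρ * dilog (1 / 2 - w / 2)

theorem half_mem_slitPlane {w : ℂ} (hw : w + 1 ∈ Complex.slitPlane) :
    1 - (1 / 2 - w / 2) ∈ Complex.slitPlane := by
  have e : 1 - (1 / 2 - w / 2) = (w + 1) / 2 := by ring
  rw [e]
  rw [Complex.mem_slitPlane_iff] at hw ⊢
  have e2 : (w + 1) / 2 = ((1 / 2 : ℝ) : ℂ) * (w + 1) := by push_cast; ring
  rw [e2, Complex.re_ofReal_mul, Complex.im_ofReal_mul]
  rcases hw with h | h
  · left; linarith
  · right; simpa using h

/-- Only the logarithm of w + 1 enters, so `primK` continues analytically across (-1, 1), where ζ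
has its cut. This is what makes its boundary values there accessible. -/
theorem differentiableAt_primK (ρ : ℝ) {w : ℂ} (hw : w + 1 ∈ Complex.slitPlane) :
    DifferentiableAt ℂ (primK ρ) w := by
  have h1 : DifferentiableAt ℂ (fun w : ℂ => Complex.log (w + 1)) w :=
    DifferentiableAt.clog (by fun_prop) hw
  have h2 : DifferentiableAt ℂ (fun w : ℂ => dilog (1 / 2 - w / 2)) w :=
    DifferentiableAt.comp (f := fun w : ℂ => 1 / 2 - w / 2) w
      (hasDerivAt_dilog (half_mem_slitPlane hw)).differentiableAt (by fun_prop)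
  unfold primK
  fun_prop

theorem primK_conj (ρ : ℝ) {w : ℂ} (hw : w + 1 ∈ Complex.slitPlane) :
    primK ρ ((starRingEnd ℂ) w) = (starRingEnd ℂ) (primK ρ w) := by
  have h1 := Complex.log_conj _ (Complex.slitPlane_arg_ne_pi hw)
  have h2 := dilog_conj (half_mem_slitPlane hw)
  simp only [map_sub, map_add, map_div₀, map_one, map_ofNat] at h1 h2
  simp only [primK, h1, h2, map_sub, map_mul, map_div₀, map_pow, map_one, map_ofNat,
    Complex.conj_ofReal]

theorem log_half {w : ℂ} (hw : w + 1 ≠ 0) : Complex.log (1 + -(1 / 2 - w / 2)) = ell w := by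
  have e2 : 1 + -(1 / 2 - w / 2) = ((1 / 2 : ℝ) : ℂ) * (w + 1) := by push_cast; ring
  rw [e2, Complex.log_ofReal_mul (by norm_num) hw, ell, one_div, Real.log_inv]
  push_cast; ring

/-- The dilogarithm term has derivative -`ell` w/(w - 1) before weighting, and the remaining terms
give (1 - ρ) `ell` w/(w + 1); together they are `ell` times the partial fractions of ζ'. -/
theorem hasDerivAt_primK (ρ : ℝ) {w : ℂ} (hw : w ∈ cutPlane) :
    HasDerivAt (primK ρ) (ell w * zetaDeriv ρ w) w := by
  have hw1 := add_one_mem_slitPlane hw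
  have n1 := Complex.slitPlane_ne_zero hw
  have n2 := Complex.slitPlane_ne_zero hw1
  have h1 : HasDerivAt (fun w : ℂ => Complex.log (w + 1)) (1 / (w + 1)) w :=
    ((hasDerivAt_id w).add_const 1).clog hw1
  have h2 : HasDerivAt (fun w : ℂ => 1 / 2 - w / 2) (-(1 / 2)) w :=
    ((hasDerivAt_id w).div_const 2).const_sub (1 / 2)
  have h3 := (hasDerivAt_dilog (half_mem_slitPlane hw1)).comp w h2
  have h4 : (∫ t in (0 : ℝ)..1, (1 - (t : ℂ) * (1 / 2 - w / 2))⁻¹) * (-(1 / 2))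
      = -(ell w / (w - 1)) := by
    have := Complex.log_eq_integral (z := -(1 / 2 - w / 2))
      (by simpa [sub_eq_add_neg] using half_mem_slitPlane hw1)
    rw [log_half n2] at this
    have e : ∀ t : ℝ, (1 : ℂ) + t • -(1 / 2 - w / 2) = 1 - (t : ℂ) * (1 / 2 - w / 2) := by
      intro t; rw [Complex.real_smul]; ring
    simp only [e] at this
    generalize (∫ t in (0 : ℝ)..1, (1 - (t : ℂ) * (1 / 2 - w / 2))⁻¹) = J at this ⊢
    rw [this]
    field_simp
    ring
  rw [h4] at h3
  have h5 := ((((h1.pow 2).div_const 2).sub (h1.const_mul ((Real.log 2 : ℝ) : ℂ))).const_mul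
    (1 - ρ : ℂ)).sub (h3.const_mul (ρ : ℂ))
  convert! h5 using 1
  rw [zetaDeriv_eq n1 n2, ell]
  field_simp
  ring

theorem hasDerivAt_ell {w : ℂ} (hw : w ∈ cutPlane) : HasDerivAt ell (1 / (w + 1)) w :=
  (((hasDerivAt_id w).add_const 1).clog (add_one_mem_slitPlane hw)).sub_const _

theorem hasDerivAt_primK_zetaInv {ρ : ℝ} (h0 : 0 < ρ) (h1 : ρ < 1) {ζ : ℂ}
    (h : ζ ∈ zetaImage ρ) :
    HasDerivAt (fun ζ => primK ρ (zetaInv ρ ζ)) (ell (zetaInv ρ ζ)) ζ := by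
  have hm := zetaInv_mem h
  have := (hasDerivAt_primK ρ hm).comp ζ (hasDerivAt_zetaInv h0 h1 h)
  rwa [mul_assoc, mul_inv_cancel₀ (zetaDeriv_ne_zero h0 hm), mul_one] at this

/-! ### The limiting consistency function -/

theorem rCrit_pos {ρ : ℝ} (h0 : 0 < ρ) (h1 : ρ < 1) : 0 < rCrit ρ := by
  have : 0 < 1 - ρ := by linarith
  rw [rCrit]; positivity

/-- With r = |C|^(1/p) and p = ρN the abscissa log|C|/N is ρ log r, so radii correspond to abscissas
through r ↦ ρ log r. -/
theorem mul_log_rCrit {ρ : ℝ} (h0 : 0 < ρ) (h1 : ρ < 1) :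
    ρ * Real.log (rCrit ρ) = xCrit ρ := by
  have h2 : 0 < 1 - ρ := by linarith
  rw [rCrit, Real.log_mul (by positivity) (by positivity), Real.log_mul (by positivity) h0.ne',
    Real.log_rpow (by norm_num), Real.log_rpow h2, xCrit]
  field_simp

theorem xCrit_lt_mul_log {ρ : ℝ} (h0 : 0 < ρ) (h1 : ρ < 1) {r : ℝ} (hr : rCrit ρ < r) :
    xCrit ρ < ρ * Real.log r := by
  rw [← mul_log_rCrit h0 h1]
  exact mul_lt_mul_of_pos_left (Real.log_lt_log (rCrit_pos h0 h1) hr) h0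

/-- The point `x + i ρ π` of the logarithmic coordinate. -/
noncomputable def levelPoint (ρ x : ℝ) : ℂ := x + (ρ * Real.pi : ℝ) * Complex.I

@[simp] theorem levelPoint_re (ρ x : ℝ) : (levelPoint ρ x).re = x := by simp [levelPoint]

@[simp] theorem levelPoint_im (ρ x : ℝ) : (levelPoint ρ x).im = ρ * Real.pi := by
  simp [levelPoint]

theorem levelPoint_mem {ρ : ℝ} (h0 : 0 < ρ) (h1 : ρ < 1) {x : ℝ} (hx : xCrit ρ < x) :
    levelPoint ρ x ∈ zetaImage ρ := by
  refine mem_zetaImage h0 h1 (Or.inr ⟨by simpa using hx, ?_⟩)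
  rw [levelPoint_im, abs_of_pos (mul_pos h0 Real.pi_pos)]
  nlinarith [Real.pi_pos]

/-- In the upper half-plane log(1 - u) = log(u - 1) - iπ; hence the power equation fixes Re ζ(u) and
the argument equation fixes Im ζ(u) = ρπ. -/
theorem isUStar_iff {ρ : ℝ} {r : ℝ} (hr : 0 < r) (u : ℂ) :
    IsUStar ρ r u ↔ 0 < u.im ∧ zeta ρ u = levelPoint ρ (ρ * Real.log r) := by
  have key : 0 < u.im → ((1 - u) ^ (ρ : ℂ) * (1 + u) ^ ((1 - ρ : ℝ) : ℂ)
      = Complex.exp (zeta ρ u - (ρ * Real.pi : ℝ) * Complex.I)) ∧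
      ρ * (1 - u).arg + (1 - ρ) * (1 + u).arg = (zeta ρ u).im - ρ * Real.pi := by
    intro hu
    have n1 : 1 - u ≠ 0 := fun h => by
      have := congrArg Complex.im h; simp at this; linarith
    have n2 : 1 + u ≠ 0 := fun h => by
      have := congrArg Complex.im h; simp at this; linarith
    have i1 : (1 - u).arg = (u - 1).arg - Real.pi := by
      rw [← neg_sub, Complex.arg_neg_eq_arg_sub_pi_of_im_pos (by simpa using hu)]
    have i2 : Complex.log (1 - u) = Complex.log (u - 1) - Real.pi * Complex.I := by
      rw [Complex.log, Complex.log, i1, norm_sub_rev]; push_cast; ring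
    constructor
    · rw [Complex.cpow_def_of_ne_zero n1, Complex.cpow_def_of_ne_zero n2, ← Complex.exp_add, i2,
        zeta, add_comm 1 u]
      congr 1; push_cast; ring
    · rw [i1, zeta_im, add_comm 1 u]; ring
  constructor
  · rintro ⟨e1, e2, e3⟩
    refine ⟨e3, ?_⟩
    rw [(key e3).2] at e2
    rw [(key e3).1] at e1
    apply Complex.ext
    · have := congrArg norm e1
      rw [Complex.norm_exp, Complex.norm_real, Real.norm_eq_abs,
        abs_of_pos (Real.rpow_pos_of_pos hr _), Real.rpow_def_of_pos hr] at this
      have := Real.exp_injective this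
      simp at this
      rw [levelPoint_re, this, mul_comm]
    · rw [levelPoint_im]; linarith
  · rintro ⟨e3, e⟩
    refine ⟨?_, ?_, e3⟩
    · rw [(key e3).1, e, levelPoint, add_sub_cancel_right, ← Complex.ofReal_exp,
        Real.rpow_def_of_pos hr, mul_comm]
    · rw [(key e3).2, e, levelPoint_im, sub_self]

theorem isUStar_iff_eq {ρ : ℝ} (h0 : 0 < ρ) (h1 : ρ < 1) {r : ℝ} (hr : rCrit ρ < r) (u : ℂ) :
    IsUStar ρ r u ↔ u = zetaInv ρ (levelPoint ρ (ρ * Real.log r)) := by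
  have hm := levelPoint_mem h0 h1 (xCrit_lt_mul_log h0 h1 hr)
  rw [isUStar_iff ((rCrit_pos h0 h1).trans hr)]
  constructor
  · rintro ⟨hu, e⟩
    rw [← e, zetaInv_zeta h0 h1 (mem_cutPlane_of_im_pos hu)]
  · rintro rfl
    exact ⟨zetaInv_im_pos h0 h1 hm (by simpa using mul_pos h0 Real.pi_pos), zeta_zetaInv hm⟩

theorem existsUnique_isUStar {ρ : ℝ} (h0 : 0 < ρ) (h1 : ρ < 1) {r : ℝ} (hr : rCrit ρ < r) :
    ∃! u, IsUStar ρ r u := by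
  simp only [isUStar_iff_eq h0 h1 hr]
  exact ⟨_, rfl, fun _ h => h⟩

theorem uStar_eq {ρ : ℝ} (h0 : 0 < ρ) (h1 : ρ < 1) {r : ℝ} (hr : rCrit ρ < r) :
    uStar ρ r = zetaInv ρ (levelPoint ρ (ρ * Real.log r)) := by
  rw [← isUStar_iff_eq h0 h1 hr]
  exact Classical.epsilon_spec (existsUnique_isUStar h0 h1 hr).exists

/-- On the level Im ζ = ρπ one has ρ arg(1 - w) = -(1 - ρ) arg(1 + w), which exchanges the two terms
with the factor log 2. -/
theorem GInf_eq {ρ : ℝ} (h0 : 0 < ρ) {w : ℂ} (hw : 0 < w.im)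
    (h : (zeta ρ w).im = ρ * Real.pi) :
    GInf ρ w = (primK ρ w).im / (ρ * Real.pi) := by
  have i1 : (1 - w).arg = (w - 1).arg - Real.pi := by
    rw [← neg_sub, Complex.arg_neg_eq_arg_sub_pi_of_im_pos (by simpa using hw)]
  rw [zeta_im] at h
  have hk : (primK ρ w).im = (1 - ρ) * (Real.log ‖w + 1‖ * (w + 1).arg
      - Real.log 2 * (w + 1).arg) - ρ * (dilog (1 / 2 - w / 2)).im := by
    have e : (1 - ρ : ℂ) = ((1 - ρ : ℝ) : ℂ) := by push_cast; ring
    have e2 : (Complex.log (w + 1) ^ 2 / 2).im = Real.log ‖w + 1‖ * (w + 1).arg := by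
      rw [sq, show Complex.log (w + 1) * Complex.log (w + 1) / 2
        = ((1 / 2 : ℝ) : ℂ) * (Complex.log (w + 1) * Complex.log (w + 1)) by push_cast; ring,
        Complex.im_ofReal_mul, Complex.mul_im, Complex.log_re, Complex.log_im]
      ring
    rw [primK, e, Complex.sub_im, Complex.im_ofReal_mul, Complex.im_ofReal_mul, Complex.sub_im,
      Complex.im_ofReal_mul, e2, Complex.log_im]
  have hpi := Real.pi_pos
  rw [GInf, hk, i1, add_comm 1 w, eq_div_iff (by positivity)]
  field_simp
  linear_combination Real.log 2 * h

/-- The limiting consistency function in the logarithmic coordinate. -/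
noncomputable def consist (ρ x : ℝ) : ℝ :=
  (primK ρ (zetaInv ρ (levelPoint ρ x))).im / (ρ * Real.pi)

theorem GInf_uStar {ρ : ℝ} (h0 : 0 < ρ) (h1 : ρ < 1) {r : ℝ} (hr : rCrit ρ < r) :
    GInf ρ (uStar ρ r) = consist ρ (ρ * Real.log r) := by
  have hm := levelPoint_mem h0 h1 (xCrit_lt_mul_log h0 h1 hr)
  rw [uStar_eq h0 h1 hr, GInf_eq h0 (zetaInv_im_pos h0 h1 hm
    (by simpa using mul_pos h0 Real.pi_pos)) (by rw [zeta_zetaInv hm, levelPoint_im]), consist]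

/-- Moving the abscissa is moving ζ in the real direction, so Im `primK` changes at the rate Im
`ell` = arg(1 + w). -/
theorem hasDerivAt_consist {ρ : ℝ} (h0 : 0 < ρ) (h1 : ρ < 1) {x : ℝ} (hx : xCrit ρ < x) :
    HasDerivAt (consist ρ) ((zetaInv ρ (levelPoint ρ x) + 1).arg / (ρ * Real.pi)) x := by
  have hl : HasDerivAt (fun z : ℂ => z + (ρ * Real.pi : ℝ) * Complex.I) 1 (x : ℂ) :=
    (hasDerivAt_id (x : ℂ)).add_const _
  have h2 := ((hasDerivAt_primK_zetaInv h0 h1 (levelPoint_mem h0 h1 hx)).comp (x : ℂ)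
    hl).comp_ofReal
  have h3 := (Complex.imCLM.hasFDerivAt.comp_hasDerivAt x h2).div_const (ρ * Real.pi)
  rw [mul_one] at h3
  rw [← ell_im]
  exact h3

theorem consist_deriv_pos {ρ : ℝ} (h0 : 0 < ρ) (h1 : ρ < 1) {x : ℝ} (hx : xCrit ρ < x) :
    0 < (zetaInv ρ (levelPoint ρ x) + 1).arg := by
  apply arg_pos_of_im_pos
  simpa using zetaInv_im_pos h0 h1 (levelPoint_mem h0 h1 hx)
    (by simpa using mul_pos h0 Real.pi_pos)

theorem consist_strictMonoOn {ρ : ℝ} (h0 : 0 < ρ) (h1 : ρ < 1) :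
    StrictMonoOn (consist ρ) (Set.Ioi (xCrit ρ)) := by
  refine strictMonoOn_of_deriv_pos (convex_Ioi _)
    (fun x hx => (hasDerivAt_consist h0 h1 hx).continuousAt.continuousWithinAt) ?_
  intro x hx
  rw [interior_Ioi] at hx
  rw [(hasDerivAt_consist h0 h1 hx).deriv]
  exact div_pos (consist_deriv_pos h0 h1 hx) (mul_pos h0 Real.pi_pos)

/-- At the critical slit the primitive becomes real. -/
theorem tendsto_primK_im {ρ : ℝ} (h0 : 0 < ρ) (h1 : ρ < 1) {x : ℝ} (hx : x ≤ xCrit ρ) :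
    Tendsto (fun ζ => (primK ρ (zetaInv ρ ζ)).im) (𝓝[zetaImage ρ] (levelPoint ρ x)) (𝓝 0) := by
  have hpp := mul_pos h0 Real.pi_pos
  refine tendsto_of_seq_tendsto fun z hz => ?_
  refine tendsto_of_subseq_tendsto fun ns hns => ?_
  have hz' := hz.comp hns
  rw [tendsto_nhdsWithin_iff] at hz'
  obtain ⟨hz1, hz2⟩ := hz'
  obtain ⟨m, hm⟩ := eventually_atTop.1 hz2
  have hz3 := hz1.comp (tendsto_add_atTop_nat m)
  set y : ℕ → ℂ := fun n => z (ns (n + m)) with hy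
  have hmem : ∀ n, y n ∈ zetaImage ρ := fun n => hm _ (Nat.le_add_left _ _)
  have hy1 : Tendsto y atTop (𝓝 (levelPoint ρ x)) := hz3
  have hre : Tendsto (fun n => logMod ρ (zetaInv ρ (y n))) atTop (𝓝 x) := by
    simp only [← zeta_re, zeta_zetaInv (hmem _)]
    simpa [Function.comp_def] using (Complex.continuous_re.tendsto _).comp hy1
  have him' : Tendsto (fun n => (y n).im) atTop (𝓝 (ρ * Real.pi)) := by
    simpa [Function.comp_def] using (Complex.continuous_im.tendsto _).comp hy1
  have him : Tendsto (fun n => absArg ρ (zetaInv ρ (y n))) atTop (𝓝 (ρ * Real.pi)) := by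
    simp only [absArg_eq_abs_zeta_im h0 h1, zeta_zetaInv (hmem _)]
    simpa [abs_of_pos Real.pi_pos, abs_of_pos h0] using him'.abs
  obtain ⟨v, φ, hφ, hv, v1, v2, e1, e2⟩ := exists_subseq_tendsto h0 h1
    (fun n => ne_of_mem_cutPlane (zetaInv_mem (hmem n))) hre him
  have hv0 : 0 ≤ v.im := by
    refine ge_of_tendsto ((Complex.continuous_im.tendsto _).comp hv) ?_
    filter_upwards [(him'.comp hφ.tendsto_atTop).eventually (lt_mem_nhds hpp)] with n hn
    exact (zetaInv_im_pos h0 h1 (hmem _) hn).le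
  -- The cluster point has angle ρπ and modulus at most `xCrit`. This rules out the open upper
  -- half-plane by `xCrit_lt_of_im_eq`, the ray (1, ∞), where the angle is 0, and the ray below -1,
  -- where it is π.
  have hvr : v.im = 0 ∧ -1 < v.re := by
    by_cases hc : v ∈ cutPlane
    · rcases hv0.lt_or_eq with h | h
      · rw [absArg_eq_of_im_nonneg hv0] at e2
        have := xCrit_lt_of_im_eq h0 h1 h e2
        rw [zeta_re, e1] at this
        linarith
      · refine absurd e2 ?_
        have h1' : 1 < v.re := (mem_cutPlane_iff.1 hc).resolve_right (by simpa using h.symm)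
        rw [absArg_of_one_lt h.symm h1'.le]
        exact hpp.ne
    · rcases absArg_of_notMem h0 h1 hc v1 v2 with ⟨-, -, a, b⟩ | a
      · exact ⟨a, b⟩
      · rw [a] at e2
        nlinarith [Real.pi_pos]
  have hvs : v + 1 ∈ Complex.slitPlane := by
    rw [Complex.mem_slitPlane_iff]; left; simp; linarith [hvr.2]
  -- `primK` is analytic at `v` and commutes with conjugation, so it is real at the real point `v`.
  have hK : (primK ρ v).im = 0 := by
    have h2 := primK_conj ρ hvs
    rw [Complex.conj_eq_iff_im.2 hvr.1] at h2
    exact Complex.conj_eq_iff_im.1 h2.symm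
  refine ⟨fun n => φ n + m, ?_⟩
  have := (Complex.continuous_im.tendsto _).comp
    ((differentiableAt_primK ρ hvs).continuousAt.tendsto.comp hv)
  rw [hK] at this
  exact this

theorem tendsto_consist_xCrit {ρ : ℝ} (h0 : 0 < ρ) (h1 : ρ < 1) :
    Tendsto (consist ρ) (𝓝[>] (xCrit ρ)) (𝓝 0) := by
  have hl : Tendsto (levelPoint ρ) (𝓝[>] (xCrit ρ))
      (𝓝[zetaImage ρ] (levelPoint ρ (xCrit ρ))) := by
    refine tendsto_nhdsWithin_iff.2 ⟨?_, ?_⟩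
    · have : Continuous (levelPoint ρ) := by unfold levelPoint; fun_prop
      exact (this.tendsto _).mono_left nhdsWithin_le_nhds
    · filter_upwards [self_mem_nhdsWithin] with x hx using levelPoint_mem h0 h1 hx
  have := ((tendsto_primK_im h0 h1 le_rfl).comp hl).div_const (ρ * Real.pi)
  rw [zero_div] at this
  exact this

/-- The real part of `ell` is singular only at -1 and at infinity, and both are out of reach for
bounded `logMod`. The constant serves as the dominating function for the means over the roots. -/
theorem exists_ell_bound {ρ : ℝ} (h0 : 0 < ρ) (h1 : ρ < 1) (a b : ℝ) :
    ∃ M, ∀ w : ℂ, w ≠ 1 → w ≠ -1 → a ≤ logMod ρ w → logMod ρ w ≤ b → |(ell w).re| ≤ M := by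
  refine ⟨max (Real.log (Real.exp b + 2) - Real.log 2)
    (Real.log 2 - (a - ρ * Real.log (Real.exp b + 2)) / (1 - ρ)), fun w w1 w2 ha hb => ?_⟩
  have n := norm_le_exp_logMod h0 h1 w1 w2
  have hbe : Real.exp (logMod ρ w) + 2 ≤ Real.exp b + 2 := by gcongr
  have l1 := Real.log_le_log (norm_sub_one_pos w1) (n.1.trans hbe)
  have l2 := Real.log_le_log (norm_add_one_pos w2) (n.2.trans hbe)
  have l3 : (a - ρ * Real.log (Real.exp b + 2)) / (1 - ρ) ≤ Real.log ‖w + 1‖ := by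
    rw [div_le_iff₀ (sub_pos.2 h1)]
    have e : logMod ρ w = ρ * Real.log ‖w - 1‖ + (1 - ρ) * Real.log ‖w + 1‖ := rfl
    nlinarith [mul_le_mul_of_nonneg_left l1 h0.le]
  rw [ell_re, abs_le]
  constructor
  · linarith [le_max_right (Real.log (Real.exp b + 2) - Real.log 2)
      (Real.log 2 - (a - ρ * Real.log (Real.exp b + 2)) / (1 - ρ))]
  · linarith [le_max_left (Real.log (Real.exp b + 2) - Real.log 2)
      (Real.log 2 - (a - ρ * Real.log (Real.exp b + 2)) / (1 - ρ))]

/-! ### The mean of Re `ell` along a level curve. -/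

/-- The level curve of modulus `x`, parametrized by `y ∈ (0, 1)`. -/
noncomputable def arcPoint (ρ x y : ℝ) : ℂ :=
  x + (ρ * Real.pi * (2 * y - 1) : ℝ) * Complex.I

@[simp] theorem arcPoint_re (ρ x y : ℝ) : (arcPoint ρ x y).re = x := by simp [arcPoint]

@[simp] theorem arcPoint_im (ρ x y : ℝ) : (arcPoint ρ x y).im = ρ * Real.pi * (2 * y - 1) := by
  simp [arcPoint]

theorem arcPoint_one (ρ x : ℝ) : arcPoint ρ x 1 = levelPoint ρ x := by
  apply Complex.ext
  · simp
  · simp; ring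

theorem arcPoint_mem {ρ : ℝ} (h0 : 0 < ρ) (h1 : ρ < 1) (x : ℝ) {y : ℝ}
    (hy : y ∈ Set.Ioo (0 : ℝ) 1) : arcPoint ρ x y ∈ zetaImage ρ := by
  refine mem_zetaImage h0 h1 (Or.inl ?_)
  have hpp := mul_pos h0 Real.pi_pos
  rw [arcPoint_im, abs_mul, abs_of_pos hpp]
  have : |2 * y - 1| < 1 := by rw [abs_lt]; constructor <;> linarith [hy.1, hy.2]
  nlinarith

theorem intervalIntegrable_ell_arc {ρ : ℝ} (h0 : 0 < ρ) (h1 : ρ < 1) (x : ℝ) :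
    IntervalIntegrable (fun y => (ell (zetaInv ρ (arcPoint ρ x y))).re)
      MeasureTheory.volume 0 1 := by
  obtain ⟨M, hM⟩ := exists_ell_bound h0 h1 x x
  rw [intervalIntegrable_iff_integrableOn_Ioo_of_le zero_le_one]
  have hfin : MeasureTheory.IsFiniteMeasure
      (MeasureTheory.volume.restrict (Set.Ioo (0 : ℝ) 1)) := ⟨by simp⟩
  refine MeasureTheory.Integrable.of_bound ?_ M ?_
  · refine ContinuousOn.aestronglyMeasurable ?_ measurableSet_Ioo
    intro y hy
    have hm := arcPoint_mem h0 h1 x hy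
    have c1 : ContinuousAt (fun ζ => (ell (zetaInv ρ ζ)).re) (arcPoint ρ x y) :=
      Complex.continuous_re.continuousAt.comp
        ((hasDerivAt_ell (zetaInv_mem hm)).continuousAt.comp
          (hasDerivAt_zetaInv h0 h1 hm).continuousAt)
    exact (ContinuousAt.comp (f := arcPoint ρ x) c1
      (by unfold arcPoint; fun_prop)).continuousWithinAt
  · refine (MeasureTheory.ae_restrict_iff' (measurableSet_Ioo (α := ℝ))).2 (Eventually.of_forall ?_)
    intro y hy
    have hm := arcPoint_mem h0 h1 x hy
    have hc := zetaInv_mem hm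
    have hl : logMod ρ (zetaInv ρ (arcPoint ρ x y)) = x := by
      rw [← zeta_re, zeta_zetaInv hm, arcPoint_re]
    exact hM _ (ne_of_mem_cutPlane hc).1 (ne_of_mem_cutPlane hc).2 hl.ge hl.le

/-- Along the vertical direction Im `primK` has derivative 2ρπ Re `ell`, and y ↦ 1 - y is
conjugation, so the boundary value at 0 is minus the one at 1. Only one-sided limits are assumed,
because for small `x` the endpoints have no preimage. -/
theorem integral_ell_arc {ρ : ℝ} (h0 : 0 < ρ) (h1 : ρ < 1) {x c : ℝ}
    (h : Tendsto (fun y => (primK ρ (zetaInv ρ (arcPoint ρ x y))).im) (𝓝[<] 1) (𝓝 c)) :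
    ∫ y in (0 : ℝ)..1, (ell (zetaInv ρ (arcPoint ρ x y))).re = c / (ρ * Real.pi) := by
  have hpp := mul_pos h0 Real.pi_pos
  let f : ℝ → ℝ := fun y => (primK ρ (zetaInv ρ (arcPoint ρ x y))).im / (2 * (ρ * Real.pi))
  have hsym : ∀ y ∈ Set.Ioo (0 : ℝ) 1, -f (1 - y) = f y := by
    intro y hy
    have hm := arcPoint_mem h0 h1 x hy
    have e : arcPoint ρ x (1 - y) = (starRingEnd ℂ) (arcPoint ρ x y) := by
      apply Complex.ext
      · simp
      · simp; ring
    simp only [f]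
    rw [e, zetaInv_conj h0 h1 hm, primK_conj ρ (add_one_mem_slitPlane (zetaInv_mem hm)),
      Complex.conj_im]
    ring
  have hb : Tendsto f (𝓝[<] 1) (𝓝 (c / (2 * (ρ * Real.pi)))) := h.div_const _
  have ha : Tendsto f (𝓝[>] 0) (𝓝 (-(c / (2 * (ρ * Real.pi))))) := by
    have t : Tendsto (fun y : ℝ => 1 - y) (𝓝[>] 0) (𝓝[<] 1) := by
      refine tendsto_nhdsWithin_iff.2 ⟨?_, ?_⟩
      · have : Tendsto (fun y : ℝ => 1 - y) (𝓝 0) (𝓝 (1 - 0)) :=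
          (continuous_const.sub continuous_id).tendsto 0
        rw [sub_zero] at this
        exact this.mono_left nhdsWithin_le_nhds
      · filter_upwards [self_mem_nhdsWithin] with y hy
        have : 0 < y := hy
        simp only [Set.mem_Iio]; linarith
    refine (hb.comp t).neg.congr' ?_
    filter_upwards [Ioo_mem_nhdsGT (zero_lt_one (α := ℝ))] with y hy using hsym y hy
  rw [intervalIntegral.integral_eq_sub_of_hasDerivAt_of_tendsto zero_lt_one (f := f) ?_
    (intervalIntegrable_ell_arc h0 h1 x) ha hb]
  · field_simp; ring
  · intro y hy
    have hm := arcPoint_mem h0 h1 x hy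
    have hl : HasDerivAt (fun y : ℂ => (x : ℂ) + (ρ * Real.pi : ℝ) * (2 * y - 1) * Complex.I)
        ((2 * (ρ * Real.pi) : ℝ) * Complex.I) (y : ℂ) := by
      have := ((((((hasDerivAt_id (y : ℂ)).const_mul 2).sub_const 1).const_mul
        ((ρ * Real.pi : ℝ) : ℂ)).mul_const Complex.I).const_add (x : ℂ))
      convert! this using 1
      push_cast; ring
    have e : (x : ℂ) + (ρ * Real.pi : ℝ) * (2 * (y : ℂ) - 1) * Complex.I = arcPoint ρ x y := by
      rw [arcPoint]; push_cast; ring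
    have h2 := ((hasDerivAt_primK_zetaInv h0 h1 (e ▸ hm)).comp (y : ℂ) hl).comp_ofReal
    have h3 := (Complex.imCLM.hasFDerivAt.comp_hasDerivAt y h2).div_const (2 * (ρ * Real.pi))
    rw [e] at h3
    convert! h3 using 1
    · ext t
      simp only [f, Function.comp, Complex.imCLM_apply, arcPoint]
      push_cast; rfl
    · simp only [Complex.imCLM_apply]
      rw [show ell (zetaInv ρ (arcPoint ρ x y)) * ((2 * (ρ * Real.pi) : ℝ) * Complex.I)
        = ((2 * (ρ * Real.pi) : ℝ) : ℂ) * (ell (zetaInv ρ (arcPoint ρ x y)) * Complex.I) by ring,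
        Complex.im_ofReal_mul, Complex.mul_I_im]
      field_simp

theorem integral_ell_arc_of_le {ρ : ℝ} (h0 : 0 < ρ) (h1 : ρ < 1) {x : ℝ} (hx : x ≤ xCrit ρ) :
    ∫ y in (0 : ℝ)..1, (ell (zetaInv ρ (arcPoint ρ x y))).re = 0 := by
  rw [integral_ell_arc h0 h1 (c := 0), zero_div]
  refine (tendsto_primK_im h0 h1 hx).comp (tendsto_nhdsWithin_iff.2 ⟨?_, ?_⟩)
  · have : Continuous (arcPoint ρ x) := by unfold arcPoint; fun_prop
    have := this.tendsto 1
    rw [arcPoint_one] at this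
    exact this.mono_left nhdsWithin_le_nhds
  · filter_upwards [Ioo_mem_nhdsLT (zero_lt_one (α := ℝ))] with y hy
      using arcPoint_mem h0 h1 x hy

theorem integral_ell_arc_of_gt {ρ : ℝ} (h0 : 0 < ρ) (h1 : ρ < 1) {x : ℝ} (hx : xCrit ρ < x) :
    ∫ y in (0 : ℝ)..1, (ell (zetaInv ρ (arcPoint ρ x y))).re = consist ρ x := by
  rw [integral_ell_arc h0 h1 (c := (primK ρ (zetaInv ρ (levelPoint ρ x))).im), consist]
  have hc : ContinuousAt (fun ζ => (primK ρ (zetaInv ρ ζ)).im) (arcPoint ρ x 1) := by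
    rw [arcPoint_one]
    exact Complex.continuous_im.continuousAt.comp
      (hasDerivAt_primK_zetaInv h0 h1 (levelPoint_mem h0 h1 hx)).continuousAt
  have := (ContinuousAt.comp (f := arcPoint ρ x) hc
    (by unfold arcPoint; fun_prop)).tendsto.mono_left (nhdsWithin_le_nhds (s := Set.Iio 1))
  simpa [Function.comp_def, arcPoint_one] using this

/-- `consist` is the mean of log(|1 + w|/2) over the arc, where |1 + w| ≥ exp x - 2. -/
theorem le_consist {ρ : ℝ} (h0 : 0 < ρ) (h1 : ρ < 1) {x : ℝ} (hx : xCrit ρ < x)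
    (hx2 : 2 < Real.exp x) : Real.log (Real.exp x - 2) - Real.log 2 ≤ consist ρ x := by
  rw [← integral_ell_arc_of_gt h0 h1 hx]
  have : ∫ _ in (0 : ℝ)..1, (Real.log (Real.exp x - 2) - Real.log 2)
      = Real.log (Real.exp x - 2) - Real.log 2 := by simp
  rw [← this]
  refine intervalIntegral.integral_mono_on_of_le_Ioo zero_le_one intervalIntegrable_const
    (intervalIntegrable_ell_arc h0 h1 x) fun y hy => ?_
  have hm := arcPoint_mem h0 h1 x hy
  have hc := ne_of_mem_cutPlane (zetaInv_mem hm)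
  have := exp_logMod_le h0 h1 hc.1 hc.2
  rw [← zeta_re, zeta_zetaInv hm, arcPoint_re] at this
  rw [ell_re]
  have := Real.log_le_log (by linarith) (by linarith :
    Real.exp x - 2 ≤ ‖zetaInv ρ (arcPoint ρ x y) + 1‖)
  linarith

theorem tendsto_consist_atTop {ρ : ℝ} (h0 : 0 < ρ) (h1 : ρ < 1) :
    Tendsto (consist ρ) atTop atTop := by
  have : Tendsto (fun x => Real.log (Real.exp x - 2) - Real.log 2) atTop atTop := by
    refine tendsto_atTop_add_const_right _ _ (Real.tendsto_log_atTop.comp ?_)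
    exact tendsto_atTop_add_const_right _ _ Real.tendsto_exp_atTop
  refine tendsto_atTop_mono' _ ?_ this
  filter_upwards [eventually_gt_atTop (xCrit ρ),
    Real.tendsto_exp_atTop.eventually (eventually_gt_atTop 2)] with x hx hx2
    using le_consist h0 h1 hx hx2

theorem consist_pos {ρ : ℝ} (h0 : 0 < ρ) (h1 : ρ < 1) {x : ℝ} (hx : xCrit ρ < x) :
    0 < consist ρ x := by
  obtain ⟨m, hm, hm'⟩ := exists_between hx
  refine lt_of_le_of_lt ?_ (consist_strictMonoOn h0 h1 hm hx hm')
  refine le_of_tendsto (tendsto_consist_xCrit h0 h1) ?_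
  filter_upwards [Ioo_mem_nhdsGT hm] with y hy
  exact (consist_strictMonoOn h0 h1 hy.1 hm hy.2).le

theorem exists_consist_eq {ρ : ℝ} (h0 : 0 < ρ) (h1 : ρ < 1) {γ : ℝ} (hγ : 0 < γ) :
    ∃ x, xCrit ρ < x ∧ consist ρ x = γ := by
  obtain ⟨a, ha, ha'⟩ := (((tendsto_consist_xCrit h0 h1).eventually (gt_mem_nhds hγ)).and
    self_mem_nhdsWithin).exists
  obtain ⟨b, hb, hb'⟩ := (((tendsto_consist_atTop h0 h1).eventually (eventually_ge_atTop γ)).and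
    (eventually_ge_atTop a)).exists
  have ha'' : xCrit ρ < a := ha'
  obtain ⟨x, hx, hxγ⟩ := intermediate_value_Icc hb' (f := consist ρ)
    (fun x hx => (hasDerivAt_consist h0 h1 (ha''.trans_le hx.1)).continuousAt.continuousWithinAt)
    ⟨ha.le, hb⟩
  exact ⟨x, ha''.trans_le hx.1, hxγ⟩

/-! ### The limiting radius and its dependence on γ. -/

theorem isRStar_iff {ρ : ℝ} (h0 : 0 < ρ) (h1 : ρ < 1) {γ r : ℝ} :
    IsRStar ρ γ r ↔ rCrit ρ < r ∧ consist ρ (ρ * Real.log r) = γ := by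
  constructor
  · rintro ⟨h, h'⟩
    exact ⟨h, by rw [h', GInf_uStar h0 h1 h]⟩
  · rintro ⟨h, h'⟩
    exact ⟨h, by rw [← h', GInf_uStar h0 h1 h]⟩

theorem existsUnique_isRStar {ρ : ℝ} (h0 : 0 < ρ) (h1 : ρ < 1) {γ : ℝ} (hγ : 0 < γ) :
    ∃! r, IsRStar ρ γ r := by
  simp only [isRStar_iff h0 h1]
  obtain ⟨x, hx, hxγ⟩ := exists_consist_eq h0 h1 hγ
  refine ⟨Real.exp (x / ρ), ⟨?_, ?_⟩, ?_⟩
  · rw [← Real.log_lt_iff_lt_exp (rCrit_pos h0 h1), lt_div_iff₀ h0, mul_comm, mul_log_rCrit h0 h1]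
    exact hx
  · rw [Real.log_exp, mul_div_cancel₀ _ h0.ne', hxγ]
  · rintro r ⟨hr, hr'⟩
    have := (consist_strictMonoOn h0 h1).injOn (xCrit_lt_mul_log h0 h1 hr) hx (hr'.trans hxγ.symm)
    rw [← this, mul_div_cancel_left₀ _ h0.ne', Real.exp_log ((rCrit_pos h0 h1).trans hr)]

theorem rStar_spec {ρ : ℝ} (h0 : 0 < ρ) (h1 : ρ < 1) {γ : ℝ} (hγ : 0 < γ) :
    rCrit ρ < rStar ρ γ ∧ consist ρ (ρ * Real.log (rStar ρ γ)) = γ :=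
  (isRStar_iff h0 h1).1 (Classical.epsilon_spec (existsUnique_isRStar h0 h1 hγ).exists)

theorem rStar_lt_iff {ρ : ℝ} (h0 : 0 < ρ) (h1 : ρ < 1) {γ : ℝ} (hγ : 0 < γ) {r : ℝ}
    (hr : rCrit ρ < r) : rStar ρ γ < r ↔ γ < consist ρ (ρ * Real.log r) := by
  obtain ⟨a, b⟩ := rStar_spec h0 h1 hγ
  have hp := rCrit_pos h0 h1
  conv_rhs => lhs; rw [← b]
  rw [(consist_strictMonoOn h0 h1).lt_iff_lt (xCrit_lt_mul_log h0 h1 a)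
    (xCrit_lt_mul_log h0 h1 hr), mul_lt_mul_iff_right₀ h0,
    Real.log_lt_log_iff (hp.trans a) (hp.trans hr)]

theorem rStar_strictMonoOn {ρ : ℝ} (h0 : 0 < ρ) (h1 : ρ < 1) :
    StrictMonoOn (rStar ρ) (Set.Ioi 0) := by
  intro a ha b hb hab
  obtain ⟨c, d⟩ := rStar_spec h0 h1 hb
  rw [rStar_lt_iff h0 h1 ha c, d]
  exact hab

theorem tendsto_rStar {ρ : ℝ} (h0 : 0 < ρ) (h1 : ρ < 1) :
    Tendsto (rStar ρ) (𝓝[>] 0) (𝓝 (rCrit ρ)) := by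
  rw [tendsto_order]
  constructor
  · intro a ha
    filter_upwards [self_mem_nhdsWithin] with γ hγ using ha.trans (rStar_spec h0 h1 hγ).1
  · intro a ha
    have := consist_pos h0 h1 (xCrit_lt_mul_log h0 h1 ha)
    filter_upwards [Ioo_mem_nhdsGT this] with γ hγ
    exact (rStar_lt_iff h0 h1 hγ.1 ha).2 hγ.2

/-! ### Bethe roots in the logarithmic coordinate -/

/-- `u` has logarithmic coordinate `x + i ψ`; on the cut `[-1, 1]` both signs of the angle are
admitted. -/
structure RootAt (ρ x ψ : ℝ) (u : ℂ) : Prop where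
  ne_one : u ≠ 1
  ne_neg_one : u ≠ -1
  logMod_eq : logMod ρ u = x
  absArg_eq : absArg ρ u = |ψ|
  sign_nonneg : 0 ≤ ψ * u.im

theorem abs_arg_conj (z : ℂ) : |((starRingEnd ℂ) z).arg| = |z.arg| := by
  rw [Complex.arg_conj]
  split_ifs with h
  · rw [h]
  · rw [abs_neg]

theorem RootAt.conj {ρ x ψ : ℝ} {u : ℂ} (h : RootAt ρ x ψ u) :
    RootAt ρ x (-ψ) ((starRingEnd ℂ) u) := by
  have e1 : (starRingEnd ℂ) u - 1 = (starRingEnd ℂ) (u - 1) := by simp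
  have e2 : (starRingEnd ℂ) u + 1 = (starRingEnd ℂ) (u + 1) := by simp
  refine ⟨fun h' => h.ne_one ?_, fun h' => h.ne_neg_one ?_, ?_, ?_, ?_⟩
  · have := congrArg (starRingEnd ℂ) h'; simpa using this
  · have := congrArg (starRingEnd ℂ) h'; simpa using this
  · rw [← h.logMod_eq, logMod, e1, e2, Complex.norm_conj, Complex.norm_conj, logMod]
  · rw [abs_neg, ← h.absArg_eq, absArg, e1, e2, abs_arg_conj, abs_arg_conj, absArg]
  · simpa using h.sign_nonneg

theorem zeta_im_mul_im_nonneg {ρ : ℝ} (h0 : 0 < ρ) (h1 : ρ < 1) (w : ℂ) :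
    0 ≤ (zeta ρ w).im * w.im := by
  rcases le_or_gt 0 w.im with h | h
  · refine mul_nonneg ?_ h
    rw [← absArg_eq_of_im_nonneg h, absArg_eq_abs_zeta_im h0 h1]
    exact abs_nonneg _
  · exact (mul_pos_of_neg_of_neg (zeta_im_neg h0 h1 h) h).le

theorem rootAt_zeta {ρ : ℝ} (h0 : 0 < ρ) (h1 : ρ < 1) {u : ℂ} (hu : u ≠ 1) (hu' : u ≠ -1) :
    RootAt ρ (zeta ρ u).re (zeta ρ u).im u :=
  ⟨hu, hu', (zeta_re ρ u).symm, absArg_eq_abs_zeta_im h0 h1 u, zeta_im_mul_im_nonneg h0 h1 u⟩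

/-- In these ranges of angle and modulus the root cannot lie on the cut, and off the cut the sign
condition recovers Im ζ from its absolute value. -/
theorem RootAt.eq_zetaInv {ρ x ψ : ℝ} (h0 : 0 < ρ) (h1 : ρ < 1) {u : ℂ} (h : RootAt ρ x ψ u)
    (hψ : |ψ| < ρ * Real.pi ∨ (xCrit ρ < x ∧ |ψ| < Real.pi)) :
    u = zetaInv ρ (x + ψ * Complex.I) := by
  have hp : ρ * Real.pi < Real.pi := by nlinarith [Real.pi_pos]
  have hc : u ∈ cutPlane := by
    by_contra hc
    have e1 := h.absArg_eq
    have e2 := h.logMod_eq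
    rcases absArg_of_notMem h0 h1 hc h.ne_one h.ne_neg_one with ⟨a, b, -, -⟩ | a
    · rcases hψ with h | h
      · linarith
      · linarith [h.1]
    · rcases hψ with h | h
      · linarith
      · linarith [h.2]
  have him : (zeta ρ u).im = ψ := by
    have e := h.absArg_eq
    have hs := h.sign_nonneg
    rw [absArg_eq_abs_zeta_im h0 h1] at e
    rcases lt_trichotomy u.im 0 with h2 | h2 | h2
    · have h3 := zeta_im_neg h0 h1 h2
      have h4 : ψ ≤ 0 := by nlinarith
      rw [abs_of_neg h3, abs_of_nonpos h4] at e
      linarith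
    · rw [zeta_im_eq_zero hc h2, abs_zero] at e
      rw [zeta_im_eq_zero hc h2, abs_eq_zero.1 e.symm]
    · have h3 := zeta_im_pos h0 h1 h2
      have h4 : 0 ≤ ψ := by nlinarith
      rw [abs_of_pos h3, abs_of_nonneg h4] at e
      linarith
  have : zeta ρ u = x + ψ * Complex.I := by
    apply Complex.ext
    · simp [zeta_re, h.logMod_eq]
    · simp [him]
  rw [← this, zetaInv_zeta h0 h1 hc]

/-- `RootAt` is stated through functions that are continuous across the cut so that it survives the
limit δ ↑ 0 defining the roots for C > 0. -/
theorem rootAt_of_tendsto {ρ x ψ : ℝ} {u : ℂ} (hu : u ≠ 1) (hu' : u ≠ -1) {l : Filter ℝ} [l.NeBot]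
    {v : ℝ → ℂ} {ψ' : ℝ → ℝ} (hv : Tendsto v l (𝓝 u)) (hψ : Tendsto ψ' l (𝓝 ψ))
    (h : ∀ᶠ δ in l, RootAt ρ x (ψ' δ) (v δ)) : RootAt ρ x ψ u := by
  refine ⟨hu, hu', ?_, ?_, ?_⟩
  · refine tendsto_nhds_unique ((continuousAt_logMod hu hu').tendsto.comp hv)
      (tendsto_const_nhds.congr' ?_)
    filter_upwards [h] with δ hδ using hδ.logMod_eq.symm
  · refine tendsto_nhds_unique ((continuousAt_absArg hu hu').tendsto.comp hv)
      (hψ.abs.congr' ?_)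
    filter_upwards [h] with δ hδ using hδ.absArg_eq.symm
  · refine ge_of_tendsto (hψ.mul ((Complex.continuous_im.tendsto _).comp hv)) ?_
    filter_upwards [h] with δ hδ using hδ.sign_nonneg

/-- The half-open interval gives positive C the phase 1 and not 0, in agreement with the approach
through negative δ. -/
theorem exists_phase (C : ℂ) : ∃ s ∈ Set.Ioc (0 : ℝ) 1,
    C = ‖C‖ * Complex.exp (2 * Real.pi * s * Complex.I) := by
  have hp := Real.pi_pos
  have e := Complex.norm_mul_exp_arg_mul_I C
  rcases lt_or_ge 0 C.arg with h | h
  · refine ⟨C.arg / (2 * Real.pi), ⟨by positivity, ?_⟩, ?_⟩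
    · rw [div_le_one (by positivity)]; linarith [Complex.arg_le_pi C]
    · conv_lhs => rw [← e]
      congr 2; push_cast; field_simp
  · refine ⟨C.arg / (2 * Real.pi) + 1, ⟨?_, ?_⟩, ?_⟩
    · have : -1 < C.arg / (2 * Real.pi) := by
        rw [lt_div_iff₀ (by positivity)]; linarith [Complex.neg_pi_lt_arg C]
      linarith
    · have : C.arg / (2 * Real.pi) ≤ 0 := div_nonpos_of_nonpos_of_nonneg h (by positivity)
      linarith
    · conv_lhs => rw [← e]
      congr 1
      rw [Complex.exp_eq_exp_iff_exists_int]
      exact ⟨-1, by push_cast; field_simp; ring⟩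

theorem labelF_eq {ρ : ℝ} {N p : ℕ} (hN : 0 < N) (hp : (p : ℝ) = ρ * N) (u : ℂ) :
    labelF N p u = N / Real.pi * (zeta ρ u).im := by
  rw [labelF, zeta_im, hp]; field_simp

theorem pow_mul_pow_eq_exp {ρ : ℝ} {N p : ℕ} (hpN : p ≤ N) (hp : (p : ℝ) = ρ * N) {u : ℂ}
    (hu : u ≠ 1) (hu' : u ≠ -1) :
    (1 - u) ^ p * (1 + u) ^ (N - p)
      = Complex.exp (N * zeta ρ u + Real.pi * p * Complex.I) := by
  have n1 : u - 1 ≠ 0 := sub_ne_zero.2 hu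
  have n2 : u + 1 ≠ 0 := fun h => hu' (eq_neg_of_add_eq_zero_left h)
  have hpc : (p : ℂ) = ρ * N := by exact_mod_cast hp
  have e1 : (1 - u) ^ p = Complex.exp (p * Complex.log (u - 1) + p * (Real.pi * Complex.I)) := by
    rw [Complex.exp_add, Complex.exp_nat_mul, Complex.exp_nat_mul, Complex.exp_log n1,
      Complex.exp_pi_mul_I, ← mul_pow]
    congr 1; ring
  have e2 : (1 + u) ^ (N - p) = Complex.exp ((N - p : ℂ) * Complex.log (u + 1)) := by
    rw [← Nat.cast_sub hpN, Complex.exp_nat_mul, Complex.exp_log n2, add_comm]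
  rw [e1, e2, ← Complex.exp_add, zeta, hpc]
  congr 1; ring

theorem ne_of_pow_mul_pow_eq {N p : ℕ} {C u : ℂ} (h : (1 - u) ^ p * (1 + u) ^ (N - p) = C)
    (hC : C ≠ 0) (hp : 0 < p) (hpN : p < N) : u ≠ 1 ∧ u ≠ -1 := by
  constructor
  · rintro rfl
    apply hC
    rw [← h, sub_self, zero_pow hp.ne', zero_mul]
  · rintro rfl
    apply hC
    rw [← h, add_neg_cancel, zero_pow (Nat.sub_pos_of_lt hpN).ne', mul_zero]

/-- The index, as an integer, which represents the label `j` without reduction modulo `N`. -/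
def IsIndex (N p j : ℕ) (J : ℤ) : Prop := (1 ≤ j ∧ j ≤ p + 1 ∧ J = j) ∨ (j = N ∧ J = 0)

/-- The equation fixes Im ζ up to multiples of 2π/N, the label fixes the multiple modulo N, and the
range (-N, N] of `labelF` removes that ambiguity. As p + 2 < N, the indices 0, …, p + 1 are reached
without wrapping around. -/
theorem IsLabelledRoot.rootAt {ρ : ℝ} (h0 : 0 < ρ) (h1 : ρ < 1) {N p j : ℕ} {J : ℤ}
    (hN : p + 2 < N) (hp0 : 0 < p) (hp : (p : ℝ) = ρ * N) (hJ : IsIndex N p j J) {C u : ℂ}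
    (hC : C ≠ 0) {s : ℝ} (hs : s ∈ Set.Ioc (0 : ℝ) 1)
    (hCs : C = ‖C‖ * Complex.exp (2 * Real.pi * s * Complex.I)) (h : IsLabelledRoot N p j C u) :
    RootAt ρ (Real.log ‖C‖ / N) (Real.pi / N * (-p + 2 * (J - 1 + s))) u := by
  obtain ⟨hu, hm⟩ := h
  obtain ⟨u1, u2⟩ := ne_of_pow_mul_pow_eq hu hC hp0 (by omega)
  have hNr : (0 : ℝ) < N := by exact_mod_cast (by omega : 0 < N)
  have hpi := Real.pi_pos
  rw [pow_mul_pow_eq_exp (by omega) hp u1 u2] at hu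
  have hre : (zeta ρ u).re = Real.log ‖C‖ / N := by
    rw [← hu, Complex.norm_exp, Real.log_exp]
    simp
    field_simp
  obtain ⟨m, hm⟩ := hm
  rw [labelF_eq (by omega) hp] at hm
  have hk : ∃ k : ℤ, N * (zeta ρ u).im + Real.pi * p = 2 * Real.pi * s + 2 * Real.pi * k := by
    have hlog : C = Complex.exp (Real.log ‖C‖ + 2 * Real.pi * s * Complex.I) := by
      rw [Complex.exp_add, ← Complex.ofReal_exp, Real.exp_log (norm_pos_iff.2 hC)]
      exact hCs
    rw [hlog, Complex.exp_eq_exp_iff_exists_int] at hu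
    obtain ⟨k, hk⟩ := hu
    refine ⟨k, ?_⟩
    have := congrArg Complex.im hk
    simp at this
    linarith
  obtain ⟨k, hk⟩ := hk
  have hF : N / Real.pi * (zeta ρ u).im = 2 * s + 2 * k - p := by
    field_simp; linarith
  rw [hF] at hm
  have hkm : k + N * m = j - 1 := by
    have a1 := hm.1
    have a2 := hm.2
    have b1 : (k + N * m : ℝ) < j := by linarith [hs.1]
    have b2 : (j - 2 : ℝ) < k + N * m := by linarith [hs.2]
    have c1 : k + N * m < j := by exact_mod_cast b1
    have c2 : (j : ℤ) - 2 < k + N * m := by exact_mod_cast b2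
    omega
  have hrange : -(N : ℝ) < 2 * s + 2 * k - p ∧ 2 * s + 2 * k - p ≤ N := by
    rw [← hF, zeta_im]
    have r1 := Complex.neg_pi_lt_arg (u - 1)
    have r2 := Complex.arg_le_pi (u - 1)
    have r3 := Complex.neg_pi_lt_arg (u + 1)
    have r4 := Complex.arg_le_pi (u + 1)
    have q : 0 < 1 - ρ := by linarith
    have z1 : -Real.pi < ρ * (u - 1).arg + (1 - ρ) * (u + 1).arg := by nlinarith
    have z2 : ρ * (u - 1).arg + (1 - ρ) * (u + 1).arg ≤ Real.pi := by nlinarith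
    constructor
    · rw [div_mul_eq_mul_div, lt_div_iff₀ hpi]; nlinarith
    · rw [div_mul_eq_mul_div, div_le_iff₀ hpi]; nlinarith
  have hkJ : k = J - 1 := by
    have hNz : (p : ℝ) + 3 ≤ N := by exact_mod_cast hN
    have d1 : -(N : ℤ) < 2 * (k + 1) - p := by
      have : -(N : ℝ) < 2 * (k + 1) - p := by linarith [hrange.1, hs.2]
      exact_mod_cast this
    have d2 : 2 * k - (p : ℤ) < N := by
      have : 2 * (k : ℝ) - p < N := by linarith [hrange.2, hs.1]
      exact_mod_cast this
    have hmm : ∀ q : ℤ, (N : ℤ) * q < N → -(N : ℤ) < N * q → q = 0 := by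
      intro q h2 h3
      have hNp : (0 : ℤ) < N := by omega
      have : q < 1 := by by_contra! h; nlinarith
      have : -1 < q := by by_contra! h; nlinarith
      omega
    rcases hJ with ⟨j1, j2, rfl⟩ | ⟨rfl, rfl⟩
    · have : m = 0 := hmm m (by omega) (by omega)
      subst this
      omega
    · have : 1 - m = 0 := by
        have e : (j : ℤ) * (1 - m) = k + 1 := by linarith
        refine hmm (1 - m) ?_ ?_ <;> rw [e] <;> omega
      have e : m = 1 := by omega
      subst e
      omega
  have him : (zeta ρ u).im = Real.pi / N * (-p + 2 * (J - 1 + s)) := by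
    rw [hkJ] at hF
    push_cast at hF
    field_simp at hF ⊢
    linarith
  rw [← hre, ← him]
  exact rootAt_zeta h0 h1 u1 u2

theorem IsBetheRoot.rootAt {ρ : ℝ} (h0 : 0 < ρ) (h1 : ρ < 1) {N p j : ℕ} {J : ℤ}
    (hN : p + 2 < N) (hp0 : 0 < p) (hp : (p : ℝ) = ρ * N) (hJ : IsIndex N p j J) {C u : ℂ}
    (hC : C ≠ 0) {s : ℝ} (hs : s ∈ Set.Ioc (0 : ℝ) 1)
    (hCs : C = ‖C‖ * Complex.exp (2 * Real.pi * s * Complex.I)) (h : IsBetheRoot N p j C u) :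
    RootAt ρ (Real.log ‖C‖ / N) (Real.pi / N * (-p + 2 * (J - 1 + s))) u := by
  rcases h with ⟨-, h⟩ | ⟨⟨him, hre⟩, v, hv, hvu⟩
  · exact h.rootAt h0 h1 hN hp0 hp hJ hC hs hCs
  have hpi := Real.pi_pos
  have hCr : C = ‖C‖ := by
    have e : C = (C.re : ℂ) := Complex.ext (by simp) (by simp [him])
    rw [e, Complex.norm_real, Real.norm_eq_abs, abs_of_pos hre]
  -- For positive C the phase is an integer in (0, 1].
  have hs1 : s = 1 := by
    have hn : (‖C‖ : ℂ) ≠ 0 := by simpa using hC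
    have e : Complex.exp (2 * Real.pi * s * Complex.I) = 1 := by
      rw [hCr, Complex.norm_real, norm_norm] at hCs
      exact (mul_right_eq_self₀.1 hCs.symm).resolve_right hn
    obtain ⟨n, hn⟩ := Complex.exp_eq_one_iff.1 e
    have := congrArg Complex.im hn
    simp at this
    have hsn : s = n := by
      have : (2 * Real.pi) * s = (2 * Real.pi) * n := by linarith
      exact mul_left_cancel₀ (by positivity) this
    have n1 : 0 < n := by exact_mod_cast (hsn ▸ hs.1 : (0 : ℝ) < n)
    have n2 : n ≤ 1 := by exact_mod_cast (hsn ▸ hs.2 : (n : ℝ) ≤ 1)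
    rw [hsn, show n = 1 by omega]; simp
  have hP : (1 - u) ^ p * (1 + u) ^ (N - p) = C := by
    have c : Continuous fun u : ℂ => (1 - u) ^ p * (1 + u) ^ (N - p) := by fun_prop
    have c2 : Continuous fun δ : ℝ => C * Complex.exp (Complex.I * (δ : ℂ)) := by fun_prop
    have t2 := (c2.tendsto 0).mono_left (nhdsWithin_le_nhds (s := Set.Iio 0))
    simp only [Complex.ofReal_zero, mul_zero, Complex.exp_zero, mul_one] at t2
    refine tendsto_nhds_unique ((c.tendsto u).comp hvu) (t2.congr' ?_)
    filter_upwards [hv] with δ hδ using hδ.1.symm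
  obtain ⟨u1, u2⟩ := ne_of_pow_mul_pow_eq hP hC hp0 (by omega)
  -- The rotated parameter has phase 1 + δ/(2π), which lies in (0, 1] for small negative δ.
  refine rootAt_of_tendsto u1 u2 (l := 𝓝[<] 0) hvu
    (ψ' := fun δ => Real.pi / N * (-p + 2 * (J - 1 + (1 + δ / (2 * Real.pi))))) ?_ ?_
  · have c : Continuous fun δ : ℝ =>
        Real.pi / N * (-p + 2 * (J - 1 + (1 + δ / (2 * Real.pi)))) := by fun_prop
    have := (c.tendsto 0).mono_left (nhdsWithin_le_nhds (s := Set.Iio 0))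
    simpa [hs1] using this
  · filter_upwards [hv, Ioo_mem_nhdsLT (show -1 < (0 : ℝ) by norm_num)] with δ hδ hδ1
    have hn : ‖C * Complex.exp (Complex.I * (δ : ℂ))‖ = ‖C‖ := by
      rw [norm_mul, mul_comm Complex.I, Complex.norm_exp_ofReal_mul_I, mul_one]
    have := hδ.rootAt h0 h1 hN hp0 hp hJ (s := 1 + δ / (2 * Real.pi))
      (mul_ne_zero hC (Complex.exp_ne_zero _)) ?_ ?_
    · rwa [hn] at this
    · have : -1 < δ / (2 * Real.pi) := by
        rw [lt_div_iff₀ (by positivity)]; nlinarith [hδ1.1, Real.pi_gt_three]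
      have : δ / (2 * Real.pi) < 0 := div_neg_of_neg_of_pos hδ1.2 (by positivity)
      constructor <;> linarith
    · rw [hn]
      conv_lhs => rw [hCr]
      congr 1
      rw [Complex.exp_eq_exp_iff_exists_int]
      exact ⟨-1, by push_cast; field_simp; ring⟩

/-! ### Solutions of the consistency equation -/

/-- The solutions of the consistency equation in the logarithmic coordinate: the `p` angles are
equidistant, with the last of them shifted by `e` steps. -/
structure BetheSol (ρ γ : ℝ) (N p e : ℕ) (x s : ℝ) (u : ℕ → ℂ) (l : ℂ) : Prop where
  phase_mem : s ∈ Set.Icc (0 : ℝ) 1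
  root : ∀ i, i + 1 < p → RootAt ρ x (Real.pi / N * (-p + 2 * (i + s))) (u i)
  last : RootAt ρ x (Real.pi / N * (-p + 2 * ((p : ℝ) - 1 + e + s))) (u (p - 1))
  prod_eq : (2 : ℂ) ^ N * (Real.exp (γ * N) : ℂ) * ∏ i ∈ Finset.range p, (u i - 1) / (u i + 1)
    + Complex.exp (N * x + 2 * Real.pi * s * Complex.I) = 0
  val_eq : l = 1 / 2 * ∑ i ∈ Finset.range p, (u i - 1)

theorem eq_exp_of_phase {N : ℕ} (hN : 0 < N) {C : ℂ} (hC : C ≠ 0) {s : ℝ}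
    (hCs : C = ‖C‖ * Complex.exp (2 * Real.pi * s * Complex.I)) :
    C = Complex.exp (N * (Real.log ‖C‖ / N : ℝ) + 2 * Real.pi * s * Complex.I) := by
  have hn : (N : ℂ) ≠ 0 := by exact_mod_cast hN.ne'
  rw [Complex.exp_add, Complex.ofReal_div, Complex.ofReal_natCast, mul_div_cancel₀ _ hn,
    ← Complex.ofReal_exp, Real.exp_log (norm_pos_iff.2 hC)]
  exact hCs

theorem Realizes.betheSol_one {ρ : ℝ} (h0 : 0 < ρ) (h1 : ρ < 1) {N p : ℕ} (hN : p + 2 < N)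
    (hp0 : 0 < p) (hp : (p : ℝ) = ρ * N) {γ : ℝ} {C l : ℂ}
    (h : Realizes N p γ (choiceOne p) C l) :
    ∃ s u, BetheSol ρ γ N p 0 (Real.log ‖C‖ / N) s u l := by
  obtain ⟨hC, u, hu, hprod, hl⟩ := h
  obtain ⟨s, hs, hCs⟩ := exists_phase C
  have hset : choiceOne p = Finset.Ico (0 + 1) (p + 1) := by
    ext j; simp [choiceOne]
  have hroot : ∀ i < p, RootAt ρ (Real.log ‖C‖ / N) (Real.pi / N * (-p + 2 * (i + s)))
      (u (i + 1)) := by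
    intro i hi
    have := (hu (i + 1) (by simp [choiceOne]; omega)).rootAt h0 h1 hN hp0 hp
      (J := (i + 1 : ℕ)) (Or.inl ⟨by omega, by omega, rfl⟩) hC hs hCs
    simpa using this
  refine ⟨s, fun i => u (i + 1), ⟨hs.1.le, hs.2⟩, fun i hi => hroot i (by omega), ?_, ?_, ?_⟩
  · have := hroot (p - 1) (by omega)
    rw [Nat.cast_sub hp0] at this
    simpa using this
  · rw [← eq_exp_of_phase (by omega) hC hCs, ← hprod, hset, Finset.range_eq_Ico,
      Finset.prod_Ico_add' (fun j => (u j - 1) / (u j + 1))]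
  · rw [hl, hset, Finset.range_eq_Ico, Finset.sum_Ico_add' (fun j => u j - 1)]

theorem Realizes.betheSol_two {ρ : ℝ} (h0 : 0 < ρ) (h1 : ρ < 1) {N p : ℕ} (hN : p + 2 < N)
    (hp0 : 0 < p) (hp : (p : ℝ) = ρ * N) {γ : ℝ} {C l : ℂ}
    (h : Realizes N p γ (choiceTwo p) C l) :
    ∃ s u, BetheSol ρ γ N p 1 (Real.log ‖C‖ / N) s u l := by
  obtain ⟨hC, u, hu, hprod, hl⟩ := h
  obtain ⟨s, hs, hCs⟩ := exists_phase C
  obtain ⟨q, rfl⟩ : ∃ q, p = q + 1 := ⟨p - 1, by omega⟩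
  have hset : choiceTwo (q + 1) = insert (q + 2) (Finset.Ico (0 + 1) (q + 1)) := by
    ext j; simp [choiceTwo]
  have hnot : q + 2 ∉ Finset.Ico (0 + 1) (q + 1) := by simp
  let v : ℕ → ℂ := fun i => if i = q then u (q + 2) else u (i + 1)
  have hv : ∀ i ∈ Finset.range q, v i = u (i + 1) := by
    intro i hi
    simp only [v, if_neg (Finset.mem_range.1 hi).ne]
  refine ⟨s, v, ⟨hs.1.le, hs.2⟩, ?_, ?_, ?_, ?_⟩
  · intro i hi
    have := (hu (i + 1) (by rw [hset]; simp; omega)).rootAt h0 h1 hN hp0 hp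
      (J := (i + 1 : ℕ)) (Or.inl ⟨by omega, by omega, rfl⟩) hC hs hCs
    rw [hv i (by simp; omega)]
    simpa using this
  · have := (hu (q + 2) (by rw [hset]; simp)).rootAt h0 h1 hN hp0 hp
      (J := (q + 2 : ℕ)) (Or.inl ⟨by omega, by omega, rfl⟩) hC hs hCs
    simp only [Nat.add_sub_cancel, v, if_true]
    convert this using 2
    push_cast; ring
  · rw [← eq_exp_of_phase (by omega) hC hCs, ← hprod, hset, Finset.prod_insert hnot,
      Finset.prod_range_succ, ← Finset.prod_Ico_add' (fun j => (u j - 1) / (u j + 1)),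
      ← Finset.range_eq_Ico, Finset.prod_congr rfl fun i hi => by rw [hv i hi]]
    simp only [v, if_true]
    ring
  · have hS : ∑ i ∈ Finset.range q, (v i - 1) = ∑ i ∈ Finset.range q, (u (i + 1) - 1) :=
      Finset.sum_congr rfl fun i hi => by rw [hv i hi]
    rw [hl, hset, Finset.sum_insert hnot, Finset.sum_range_succ,
      ← Finset.sum_Ico_add' (fun j => u j - 1), ← Finset.range_eq_Ico, hS]
    simp only [v, if_true]
    ring

/-- Conjugation reflects the angles and replaces s by 1 - s: the label j becomes position p - j,
counted from 0. Thus 2, …, p fill the positions 0, …, p - 2, and N, read as the label 0, becomes the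
position p of an excited last root. -/
theorem Realizes.betheSol_two' {ρ : ℝ} (h0 : 0 < ρ) (h1 : ρ < 1) {N p : ℕ} (hN : p + 2 < N)
    (hp0 : 0 < p) (hp : (p : ℝ) = ρ * N) {γ : ℝ} {C l : ℂ}
    (h : Realizes N p γ (choiceTwo' N p) C l) :
    ∃ s u, BetheSol ρ γ N p 1 (Real.log ‖C‖ / N) s u ((starRingEnd ℂ) l) := by
  obtain ⟨hC, u, hu, hprod, hl⟩ := h
  obtain ⟨s, hs, hCs⟩ := exists_phase C
  obtain ⟨q, rfl⟩ : ∃ q, p = q + 1 := ⟨p - 1, by omega⟩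
  have hnot : N ∉ Finset.Icc 2 (q + 1) := by simp; omega
  let v : ℕ → ℂ := fun i => if i = q then (starRingEnd ℂ) (u N) else (starRingEnd ℂ) (u (q + 1 - i))
  have hv : ∀ i ∈ Finset.range q, v i = (starRingEnd ℂ) (u (q + 1 - i)) := by
    intro i hi
    simp only [v, if_neg (Finset.mem_range.1 hi).ne]
  have hsum : ∀ f : ℕ → ℂ, ∑ j ∈ Finset.Icc 2 (q + 1), f j
      = ∑ i ∈ Finset.range q, f (q + 1 - i) := by
    intro f
    refine Finset.sum_nbij' (fun j => q + 1 - j) (fun i => q + 1 - i) ?_ ?_ ?_ ?_ ?_ <;>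
      simp only [Finset.mem_Icc, Finset.mem_range]
    any_goals (intros; omega)
    intro j hj
    rw [show q + 1 - (q + 1 - j) = j by omega]
  have hpr : ∀ f : ℕ → ℂ, ∏ j ∈ Finset.Icc 2 (q + 1), f j
      = ∏ i ∈ Finset.range q, f (q + 1 - i) := by
    intro f
    refine Finset.prod_nbij' (fun j => q + 1 - j) (fun i => q + 1 - i) ?_ ?_ ?_ ?_ ?_ <;>
      simp only [Finset.mem_Icc, Finset.mem_range]
    any_goals (intros; omega)
    intro j hj
    rw [show q + 1 - (q + 1 - j) = j by omega]
  refine ⟨1 - s, v, ⟨by linarith [hs.2], by linarith [hs.1]⟩, ?_, ?_, ?_, ?_⟩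
  · intro i hi
    have := ((hu (q + 1 - i) (by simp [choiceTwo']; omega)).rootAt h0 h1 hN hp0 hp
      (J := (q + 1 - i : ℕ)) (Or.inl ⟨by omega, by omega, rfl⟩) hC hs hCs).conj
    rw [hv i (by simp; omega)]
    convert this using 1
    rw [Int.cast_natCast, Nat.cast_sub (by omega)]
    push_cast; ring
  · have := ((hu N (by simp [choiceTwo'])).rootAt h0 h1 hN hp0 hp
      (J := 0) (Or.inr ⟨rfl, rfl⟩) hC hs hCs).conj
    simp only [Nat.add_sub_cancel, v, if_true]
    convert this using 1
    push_cast; ring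
  · have e : Complex.exp (N * (Real.log ‖C‖ / N : ℝ) + 2 * Real.pi * (1 - s : ℝ) * Complex.I)
        = (starRingEnd ℂ) C := by
      conv_rhs => rw [eq_exp_of_phase (N := N) (by omega) hC hCs]
      rw [← Complex.exp_conj, Complex.exp_eq_exp_iff_exists_int]
      refine ⟨1, ?_⟩
      simp only [map_add, map_mul, map_ofNat, Complex.conj_ofReal, Complex.conj_I, map_natCast]
      push_cast
      ring
    rw [e]
    have h2 := congrArg (starRingEnd ℂ) hprod
    rw [choiceTwo', Finset.prod_insert hnot, hpr] at h2
    simp only [map_add, map_mul, map_pow, map_ofNat, map_prod, map_div₀, map_sub, map_one,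
      Complex.conj_ofReal, map_zero] at h2
    rw [← h2, Finset.prod_range_succ, Finset.prod_congr rfl fun i hi => by rw [hv i hi]]
    simp only [v, if_true]
    ring
  · have hS : ∑ i ∈ Finset.range q, (v i - 1)
        = ∑ i ∈ Finset.range q, ((starRingEnd ℂ) (u (q + 1 - i)) - 1) :=
      Finset.sum_congr rfl fun i hi => by rw [hv i hi]
    rw [hl, choiceTwo', Finset.sum_insert hnot, hsum]
    simp only [map_add, map_mul, map_ofNat, map_sum, map_div₀, map_sub, map_one]
    rw [Finset.sum_range_succ, hS]
    simp only [v, if_true]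
    ring

theorem BetheSol.rootAt_lt {ρ γ x s : ℝ} {N p e : ℕ} {u : ℕ → ℂ} {l : ℂ}
    (h : BetheSol ρ γ N p e x s u l) {i : ℕ} (hi : i < p) :
    u i ≠ 1 ∧ u i ≠ -1 ∧ logMod ρ (u i) = x := by
  rcases Nat.lt_or_ge (i + 1) p with h' | h'
  · exact ⟨(h.root i h').ne_one, (h.root i h').ne_neg_one, (h.root i h').logMod_eq⟩
  · rw [show i = p - 1 by omega]
    exact ⟨h.last.ne_one, h.last.ne_neg_one, h.last.logMod_eq⟩

/-- The modulus of the consistency equation. -/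
theorem BetheSol.sum_ell_re {ρ : ℝ} (h0 : 0 < ρ) {γ x s : ℝ} {N p e : ℕ}
    (hp : (p : ℝ) = ρ * N) {u : ℕ → ℂ} {l : ℂ} (h : BetheSol ρ γ N p e x s u l) :
    ∑ i ∈ Finset.range p, (ell (u i)).re = p * γ := by
  have h2 := congrArg norm (eq_neg_of_add_eq_zero_left h.prod_eq)
  rw [norm_neg, Complex.norm_exp, norm_mul, norm_mul, norm_pow, Complex.norm_real, norm_prod,
    Real.norm_eq_abs, Real.abs_exp] at h2
  have hpos : ∀ i ∈ Finset.range p, ‖(u i - 1) / (u i + 1)‖ ≠ 0 := by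
    intro i hi
    obtain ⟨a, b, -⟩ := h.rootAt_lt (Finset.mem_range.1 hi)
    rw [norm_div]
    exact (div_pos (norm_sub_one_pos a) (norm_add_one_pos b)).ne'
  have h3 := congrArg Real.log h2
  have hq : ∏ i ∈ Finset.range p, ‖(u i - 1) / (u i + 1)‖ ≠ 0 := Finset.prod_ne_zero_iff.2 hpos
  rw [Real.log_exp, Real.log_mul (by simp) hq, Real.log_mul (by simp) (Real.exp_ne_zero _),
    Real.log_exp, Real.log_pow, Real.log_prod hpos] at h3
  -- The common modulus eliminates |u - 1|. In the sum p(x - log 2)/ρ = N(x - log 2) cancels against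
  -- the other terms, leaving only `ell` and γ.
  have h4 : ∀ i ∈ Finset.range p, Real.log ‖(u i - 1) / (u i + 1)‖
      = (x - Real.log 2) / ρ - (ell (u i)).re / ρ := by
    intro i hi
    obtain ⟨a, b, c⟩ := h.rootAt_lt (Finset.mem_range.1 hi)
    rw [norm_div, Real.log_div (norm_sub_one_pos a).ne' (norm_add_one_pos b).ne', ell_re, ← c,
      logMod]
    field_simp; ring
  rw [Finset.sum_congr rfl h4, Finset.sum_sub_distrib,
    ← Finset.sum_div _ (fun i => (ell (u i)).re)] at h3
  simp at h3
  rw [hp] at h3 ⊢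
  field_simp at h3
  linarith

/-- The mean of Re `ell` is γ, so some root has 2 exp γ ≥ |u + 1| and some root has 2 exp γ ≤ |u +
1|. The first bounds the modulus from above; the second bounds it from below, with content because γ
> 0. -/
theorem BetheSol.bounds {ρ : ℝ} (h0 : 0 < ρ) (h1 : ρ < 1) {γ x s : ℝ} {N p e : ℕ}
    (hp0 : 0 < p) (hp : (p : ℝ) = ρ * N) {u : ℕ → ℂ} {l : ℂ} (h : BetheSol ρ γ N p e x s u l) :
    Real.exp x ≤ 2 * Real.exp γ + 2 ∧ Real.exp γ ≤ 1 + Real.exp (x / ρ) / 2 := by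
  have hsum := h.sum_ell_re h0 hp
  have hne : (Finset.range p).Nonempty := by simpa using hp0.ne'
  constructor
  · obtain ⟨i, hi, hi'⟩ : ∃ i ∈ Finset.range p, (ell (u i)).re ≤ γ := by
      apply Finset.exists_le_of_sum_le hne
      rw [hsum]; simp
    obtain ⟨a, b, c⟩ := h.rootAt_lt (Finset.mem_range.1 hi)
    have h2 := exp_logMod_le h0 h1 a b
    rw [c] at h2
    rw [ell_re, ← Real.log_div (norm_add_one_pos b).ne' (by norm_num),
      Real.log_le_iff_le_exp (div_pos (norm_add_one_pos b) (by norm_num))] at hi'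
    linarith
  · obtain ⟨i, hi, hi'⟩ : ∃ i ∈ Finset.range p, γ ≤ (ell (u i)).re := by
      apply Finset.exists_le_of_sum_le hne
      rw [hsum]; simp
    obtain ⟨a, b, c⟩ := h.rootAt_lt (Finset.mem_range.1 hi)
    rw [ell_re, ← Real.log_div (norm_add_one_pos b).ne' (by norm_num),
      Real.le_log_iff_exp_le (div_pos (norm_add_one_pos b) (by norm_num))] at hi'
    refine hi'.trans ?_
    rcases le_or_gt ‖u i + 1‖ 2 with h2 | h2
    · have := Real.exp_pos (x / ρ)
      linarith
    · have h3 : ‖u i - 1‖ ≤ Real.exp (x / ρ) := by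
        rw [← Real.log_le_iff_le_exp (norm_sub_one_pos a), le_div_iff₀ h0, ← c, logMod]
        have := Real.log_nonneg (by linarith : 1 ≤ ‖u i + 1‖)
        nlinarith [mul_nonneg (sub_pos.2 h1).le this]
      have := norm_add_one_le (u i)
      linarith

/-! ### Convergence of the modulus -/

theorem floor_eq_of_mem_Ioo {p k : ℕ} (hp : 0 < p) {y : ℝ}
    (hy : y ∈ Set.Ioo ((k : ℝ) / p) ((k + 1 : ℕ) / p)) : ⌊p * y⌋₊ = k := by
  have hp' : (0 : ℝ) < p := by exact_mod_cast hp
  have a := (div_lt_iff₀ hp').1 hy.1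
  have b := (lt_div_iff₀ hp').1 hy.2
  rw [mul_comm]
  rw [Nat.floor_eq_iff (by linarith [(Nat.cast_nonneg k : (0 : ℝ) ≤ k)])]
  push_cast at b
  exact ⟨a.le, b⟩

/-- Writes the mean over the roots as an integral over (0, 1), to which dominated convergence
applies. -/
theorem integral_step {p : ℕ} (hp : 0 < p) (g : ℕ → ℝ) :
    ∫ y in (0 : ℝ)..1, g ⌊p * y⌋₊ = (∑ i ∈ Finset.range p, g i) / p := by
  have hp' : (0 : ℝ) < p := by exact_mod_cast hp
  have hle : ∀ k : ℕ, (k : ℝ) / p ≤ (k + 1 : ℕ) / p := fun k => by gcongr; simp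
  have hintg : ∀ k < p, IntervalIntegrable (fun y : ℝ => g ⌊p * y⌋₊) MeasureTheory.volume
      ((k : ℝ) / p) ((k + 1 : ℕ) / p) := by
    intro k _
    rw [intervalIntegrable_iff_integrableOn_Ioo_of_le (hle k)]
    have : MeasureTheory.IntegrableOn (fun _ : ℝ => g k)
        (Set.Ioo ((k : ℝ) / p) ((k + 1 : ℕ) / p)) MeasureTheory.volume :=
      MeasureTheory.integrableOn_const (by simp)
    refine this.congr_fun (fun y hy => ?_) measurableSet_Ioo
    simp only [floor_eq_of_mem_Ioo hp hy]
  have h := intervalIntegral.sum_integral_adjacent_intervals (a := fun k : ℕ => (k : ℝ) / p) hintg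
  simp only [Nat.cast_zero, zero_div, div_self hp'.ne'] at h
  rw [← h, Finset.sum_div]
  refine Finset.sum_congr rfl fun k _ => ?_
  have e : ∫ y in ((k : ℝ) / p)..((k + 1 : ℕ) / p), g ⌊p * y⌋₊
      = ∫ _ in ((k : ℝ) / p)..((k + 1 : ℕ) / p), g k := by
    rw [intervalIntegral.integral_of_le (hle k), intervalIntegral.integral_of_le (hle k),
      MeasureTheory.integral_Ioc_eq_integral_Ioo, MeasureTheory.integral_Ioc_eq_integral_Ioo]
    exact MeasureTheory.setIntegral_congr_fun measurableSet_Ioo fun y hy => by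
      simp only [floor_eq_of_mem_Ioo hp hy]
  rw [e, intervalIntegral.integral_const, smul_eq_mul]
  push_cast
  field_simp
  ring

theorem tendsto_natCast_mul {ρ : ℝ} (h0 : 0 < ρ) {N p : ℕ → ℕ} (hN : Tendsto N atTop atTop)
    (hp : ∀ k, (p k : ℝ) = ρ * N k) : Tendsto (fun k => (p k : ℝ)) atTop atTop := by
  simp only [hp]
  exact (tendsto_natCast_atTop_atTop.comp hN).const_mul_atTop h0

/-- The mean γ over the roots is the integral of a step function that converges pointwise for y < 1
and is bounded uniformly. No uniform convergence is claimed: for subcritical `x'` the ends of the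
arc touch the slit. -/
theorem integral_eq_of_tendsto {ρ : ℝ} (h0 : 0 < ρ) (h1 : ρ < 1) {γ : ℝ} {N p e : ℕ → ℕ}
    (hN : Tendsto N atTop atTop) (hp : ∀ k, (p k : ℝ) = ρ * N k) {x s : ℕ → ℝ} {u : ℕ → ℕ → ℂ}
    {l : ℕ → ℂ} (h : ∀ᶠ k in atTop, BetheSol ρ γ (N k) (p k) (e k) (x k) (s k) (u k) (l k))
    {x' : ℝ} (hx : Tendsto x atTop (𝓝 x')) :
    ∫ y in (0 : ℝ)..1, (ell (zetaInv ρ (arcPoint ρ x' y))).re = γ := by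
  have hpi := Real.pi_pos
  have hpp := mul_pos h0 hpi
  have hpt := tendsto_natCast_mul h0 hN hp
  have hNt : Tendsto (fun k => (N k : ℝ)) atTop atTop := tendsto_natCast_atTop_atTop.comp hN
  have hp0 : ∀ᶠ k in atTop, 0 < p k := by
    filter_upwards [hpt.eventually (eventually_gt_atTop 0)] with k hk
    exact_mod_cast hk
  obtain ⟨M, hM⟩ := exists_ell_bound h0 h1 (x' - 1) (x' + 1)
  have hne : ∀ᵐ y ∂(MeasureTheory.volume : MeasureTheory.Measure ℝ), y ≠ 1 := by
    simp [MeasureTheory.ae_iff]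
  have hlim : Tendsto (fun k => ∫ y in (0 : ℝ)..1, (ell (u k ⌊p k * y⌋₊)).re) atTop
      (𝓝 (∫ y in (0 : ℝ)..1, (ell (zetaInv ρ (arcPoint ρ x' y))).re)) := by
    refine intervalIntegral.tendsto_integral_filter_of_dominated_convergence (fun _ => M) ?_ ?_
      intervalIntegrable_const ?_
    · refine Eventually.of_forall fun k => Measurable.aestronglyMeasurable ?_
      have : Measurable fun i : ℕ => (ell (u k i)).re := measurable_from_top
      exact this.comp (Nat.measurable_floor.comp (by fun_prop))
    · filter_upwards [h, hp0, hx.eventually (Icc_mem_nhds (sub_one_lt x') (lt_add_one x'))]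
        with k hk hk0 hkx
      filter_upwards [hne] with y hy1 hy
      rw [Set.uIoc_of_le zero_le_one] at hy
      have hy' : y < 1 := lt_of_le_of_ne hy.2 hy1
      have hi : ⌊p k * y⌋₊ < p k := by
        rw [Nat.floor_lt (by have := hy.1; positivity)]
        have : (0 : ℝ) < p k := by exact_mod_cast hk0
        nlinarith
      obtain ⟨a, b, c⟩ := hk.rootAt_lt hi
      exact hM _ a b (by rw [c]; exact hkx.1) (by rw [c]; exact hkx.2)
    · filter_upwards [hne] with y hy1 hy
      rw [Set.uIoc_of_le zero_le_one] at hy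
      have hyI : y ∈ Set.Ioo (0 : ℝ) 1 := ⟨hy.1, lt_of_le_of_ne hy.2 hy1⟩
      set ψ : ℕ → ℝ := fun k => Real.pi / N k * (-p k + 2 * (⌊p k * y⌋₊ + s k)) with hψ
      have hψt : Tendsto ψ atTop (𝓝 (ρ * Real.pi * (2 * y - 1))) := by
        rw [tendsto_iff_norm_sub_tendsto_zero]
        have hz : Tendsto (fun k => Real.pi * 4 / (N k : ℝ)) atTop (𝓝 0) :=
          tendsto_const_nhds.div_atTop hNt
        refine squeeze_zero' (Eventually.of_forall fun _ => norm_nonneg _) ?_ hz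
        filter_upwards [h, hNt.eventually (eventually_gt_atTop 0)] with k hk hNk
        have e1 : ψ k - ρ * Real.pi * (2 * y - 1)
            = Real.pi / N k * (2 * (⌊p k * y⌋₊ - p k * y) + 2 * s k) := by
          simp only [hψ]
          rw [hp k]
          field_simp
          ring
        have f1 := Nat.floor_le (by have := hy.1; positivity : 0 ≤ p k * y)
        have f2 := Nat.lt_floor_add_one (p k * y)
        have s1 := hk.phase_mem
        rw [e1, norm_mul, Real.norm_eq_abs, Real.norm_eq_abs,
          abs_of_pos (by positivity), mul_div_right_comm]
        gcongr
        rw [abs_le]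
        constructor <;> linarith [s1.1, s1.2]
      have hup : ∀ᶠ k in atTop, zetaInv ρ (x k + ψ k * Complex.I) = u k ⌊p k * y⌋₊ := by
        have habs : |ρ * Real.pi * (2 * y - 1)| < ρ * Real.pi := by
          rw [abs_mul, abs_of_pos hpp]
          have : |2 * y - 1| < 1 := by rw [abs_lt]; constructor <;> linarith [hyI.1, hyI.2]
          nlinarith
        -- For fixed y < 1 the index finally stays below p - 1, so the possibly displaced last root
        -- does not matter.
        have hbig : ∀ᶠ k in atTop, 1 < (p k : ℝ) * (1 - y) :=
          (hpt.atTop_mul_const (sub_pos.2 hyI.2)).eventually (eventually_gt_atTop 1)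
        filter_upwards [h, hψt.abs.eventually (gt_mem_nhds habs), hbig] with k hk hkψ hkb
        refine ((hk.root _ ?_).eq_zetaInv h0 h1 (Or.inl hkψ)).symm
        have f1 := Nat.floor_le (by have := hy.1; positivity : 0 ≤ p k * y)
        have : ((⌊p k * y⌋₊ + 1 : ℕ) : ℝ) < p k := by push_cast; linarith
        exact_mod_cast this
      have hm := arcPoint_mem h0 h1 x' hyI
      have c1 : ContinuousAt (fun ζ => (ell (zetaInv ρ ζ)).re) (arcPoint ρ x' y) :=
        Complex.continuous_re.continuousAt.comp
          ((hasDerivAt_ell (zetaInv_mem hm)).continuousAt.comp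
            (hasDerivAt_zetaInv h0 h1 hm).continuousAt)
      have hζ : Tendsto (fun k => (x k : ℂ) + ψ k * Complex.I) atTop (𝓝 (arcPoint ρ x' y)) := by
        have t1 := (Complex.continuous_ofReal.tendsto _).comp hx
        have t2 := (Complex.continuous_ofReal.tendsto _).comp hψt
        exact t1.add (t2.mul_const Complex.I)
      refine (c1.tendsto.comp hζ).congr' ?_
      filter_upwards [hup] with k hk
      simp only [Function.comp, hk]
  refine tendsto_nhds_unique hlim (tendsto_const_nhds.congr' ?_)
  filter_upwards [h, hp0] with k hk hk0
  have : (p k : ℝ) ≠ 0 := by exact_mod_cast hk0.ne'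
  rw [integral_step hk0 (fun i => (ell (u k i)).re), hk.sum_ell_re h0 (hp k)]
  field_simp

/-- The solutions of the consistency equation approach the solution of the limiting one. -/
theorem tendsto_of_betheSol {ρ : ℝ} (h0 : 0 < ρ) (h1 : ρ < 1) {γ : ℝ} (hγ : 0 < γ)
    {N p e : ℕ → ℕ} (hN : Tendsto N atTop atTop) (hp : ∀ k, (p k : ℝ) = ρ * N k) {x s : ℕ → ℝ}
    {u : ℕ → ℕ → ℂ} {l : ℕ → ℂ}
    (h : ∀ᶠ k in atTop, BetheSol ρ γ (N k) (p k) (e k) (x k) (s k) (u k) (l k)) :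
    Tendsto x atTop (𝓝 (ρ * Real.log (rStar ρ γ))) := by
  obtain ⟨hr, hrγ⟩ := rStar_spec h0 h1 hγ
  have hpt := tendsto_natCast_mul h0 hN hp
  have hcomp : ∀ᶠ k in atTop, x k ∈ Set.Icc (ρ * Real.log (2 * (Real.exp γ - 1)))
      (Real.log (2 * Real.exp γ + 2)) := by
    filter_upwards [h, hpt.eventually (eventually_gt_atTop 0)] with k hk hk0
    obtain ⟨a, b⟩ := hk.bounds h0 h1 (by exact_mod_cast hk0) (hp k)
    have hg : 0 < 2 * (Real.exp γ - 1) := by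
      have := Real.one_lt_exp_iff.2 hγ
      linarith
    constructor
    · have : Real.log (2 * (Real.exp γ - 1)) ≤ x k / ρ := by
        rw [Real.log_le_iff_le_exp hg]; linarith
      rw [le_div_iff₀ h0] at this
      linarith
    · rwa [Real.le_log_iff_exp_le (by positivity)]
  refine tendsto_of_subseq_tendsto fun ns hns => ?_
  obtain ⟨x', -, φ, hφ, hx'⟩ := isCompact_Icc.tendsto_subseq' (hns.eventually hcomp).frequently
  refine ⟨φ, ?_⟩
  have ht := hns.comp hφ.tendsto_atTop
  have hintg := integral_eq_of_tendsto h0 h1 (γ := γ) (N := fun k => N (ns (φ k)))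
    (p := fun k => p (ns (φ k))) (hN.comp ht) (fun k => hp _) (ht.eventually h) hx'
  -- A subcritical limit would have mean 0 in place of γ > 0.
  have hxc : xCrit ρ < x' := by
    by_contra! hle
    rw [integral_ell_arc_of_le h0 h1 hle] at hintg
    exact hγ.ne hintg
  rw [integral_ell_arc_of_gt h0 h1 hxc] at hintg
  rw [(consist_strictMonoOn h0 h1).injOn (xCrit_lt_mul_log h0 h1 hr) hxc (hrγ.trans hintg.symm)]
  exact hx'

/-! ### Riemann sums over equidistant nodes -/

/-- The midpoints of the `p` cells of length `2π / N` that partition `[-π p / N, π p / N]`. -/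
noncomputable def node (N p i : ℕ) : ℝ := Real.pi / N * (2 * i + 1 - p)

/-- The sum of a function over the nodes, shifted by `σ`. -/
noncomputable def nodeSum (N p : ℕ) (f : ℂ → ℂ) (σ : ℂ) : ℂ :=
  ∑ i ∈ Finset.range p, f (σ + node N p i * Complex.I)

theorem abs_node_le {ρ : ℝ} {N p i : ℕ} (hN : 0 < N) (hp : (p : ℝ) = ρ * N) (hi : i < p) :
    |node N p i| ≤ ρ * Real.pi := by
  have hNr : (0 : ℝ) < N := by exact_mod_cast hN
  have hpi := Real.pi_pos
  have hi' : (i : ℝ) + 1 ≤ p := by exact_mod_cast hi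
  have hi0 : (0 : ℝ) ≤ i := Nat.cast_nonneg i
  have e : ρ * Real.pi = Real.pi / N * p := by rw [hp]; field_simp
  rw [node, abs_mul, abs_of_pos (by positivity), e]
  gcongr
  rw [abs_le]; constructor <;> linarith

/-- A closed rectangle around the vertical segment `x + i [-ρ π, ρ π]`. -/
def levelRect (ρ x δ : ℝ) : Set ℂ :=
  Set.Icc (x - δ) (x + δ) ×ℂ Set.Icc (-(ρ * Real.pi + δ)) (ρ * Real.pi + δ)

theorem mem_levelRect {ρ x δ : ℝ} {σ : ℂ} (hσ : ‖σ - x‖ ≤ δ) {ψ : ℝ} (hψ : |ψ| ≤ ρ * Real.pi) :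
    σ + ψ * Complex.I ∈ levelRect ρ x δ := by
  have a := (Complex.abs_re_le_norm _).trans hσ
  have b := (Complex.abs_im_le_norm _).trans hσ
  simp at a b
  rw [abs_le] at a b hψ
  refine ⟨?_, ?_⟩
  · simp; constructor <;> linarith [a.1, a.2]
  · simp; constructor <;> linarith [b.1, b.2, hψ.1, hψ.2]

theorem exists_levelRect_subset {ρ : ℝ} (h0 : 0 < ρ) (h1 : ρ < 1) {x : ℝ} (hx : xCrit ρ < x) :
    ∃ δ > 0, levelRect ρ x δ ⊆ zetaImage ρ := by
  have hpi := Real.pi_pos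
  refine ⟨min ((x - xCrit ρ) / 2) ((1 - ρ) * Real.pi / 2), ?_, ?_⟩
  · exact lt_min (by linarith) (by have := mul_pos (sub_pos.2 h1) hpi; linarith)
  · intro ζ hζ
    have m1 := min_le_left ((x - xCrit ρ) / 2) ((1 - ρ) * Real.pi / 2)
    have m2 := min_le_right ((x - xCrit ρ) / 2) ((1 - ρ) * Real.pi / 2)
    have p1 := mul_pos (sub_pos.2 h1) hpi
    obtain ⟨⟨a, -⟩, ⟨c, d⟩⟩ := hζ
    refine mem_zetaImage h0 h1 (Or.inr ⟨by linarith, ?_⟩)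
    rw [abs_lt]
    constructor <;> linarith

/-- The midpoint rule on one cell. -/
theorem cell_bound {B : Set ℂ} (hB : Convex ℝ B) {Q q : ℂ → ℂ} {K : ℝ} (hK : 0 ≤ K)
    (hQ : ∀ ζ ∈ B, HasDerivAt Q (q ζ) ζ) (hq : ∀ ζ ∈ B, ∀ ξ ∈ B, ‖q ζ - q ξ‖ ≤ K * ‖ζ - ξ‖)
    {a : ℂ} {h : ℝ} (hh : 0 ≤ h) (ha : a - (h / 2 : ℝ) * Complex.I ∈ B)
    (hb : a + (h / 2 : ℝ) * Complex.I ∈ B) :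
    ‖h * Complex.I * q a - (Q (a + (h / 2 : ℝ) * Complex.I) - Q (a - (h / 2 : ℝ) * Complex.I))‖
      ≤ K * h ^ 2 := by
  set S : Set ℂ := B ∩ Metric.closedBall a (h / 2) with hS
  have hSc : Convex ℝ S := hB.inter (convex_closedBall _ _)
  have hnorm : ‖((h / 2 : ℝ) : ℂ) * Complex.I‖ = h / 2 := by
    rw [norm_mul, Complex.norm_I, mul_one, Complex.norm_real, Real.norm_eq_abs,
      abs_of_nonneg (by linarith)]
  have haS : a - (h / 2 : ℝ) * Complex.I ∈ S := by
    refine ⟨ha, ?_⟩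
    rw [Metric.mem_closedBall, dist_eq_norm, sub_sub_cancel_left, norm_neg, hnorm]
  have hbS : a + (h / 2 : ℝ) * Complex.I ∈ S := by
    refine ⟨hb, ?_⟩
    rw [Metric.mem_closedBall, dist_eq_norm, add_sub_cancel_left, hnorm]
  have haB : a ∈ B := by
    have := hB ha hb (by norm_num : (0 : ℝ) ≤ 1 / 2) (by norm_num : (0 : ℝ) ≤ 1 / 2) (by norm_num)
    convert this using 1
    simp only [Complex.real_smul]
    push_cast; ring
  -- Mean value inequality for `Q` minus its linear part at the midpoint. This first-order error, of
  -- size h² per cell, is enough.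
  have key := Convex.norm_image_sub_le_of_norm_hasDerivWithin_le
    (f := fun ζ => Q ζ - q a * ζ) (f' := fun ζ => q ζ - q a) (C := K * h) (s := S)
    (x := a - (h / 2 : ℝ) * Complex.I) (y := a + (h / 2 : ℝ) * Complex.I)
    (fun ζ hζ => by
      have := ((hQ ζ hζ.1).sub ((hasDerivAt_id ζ).const_mul (q a))).hasDerivWithinAt (s := S)
      rw [mul_one] at this
      exact this)
    (fun ζ hζ => by
      refine (hq ζ hζ.1 a haB).trans ?_
      gcongr
      have := hζ.2
      rw [Metric.mem_closedBall, dist_eq_norm] at this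
      linarith) hSc haS hbS
  have e : a + (h / 2 : ℝ) * Complex.I - (a - (h / 2 : ℝ) * Complex.I) = h * Complex.I := by
    push_cast; ring
  rw [e, norm_mul, Complex.norm_I, mul_one, Complex.norm_real, Real.norm_eq_abs,
    abs_of_nonneg hh] at key
  rw [norm_sub_rev]
  calc _ = _ := by congr 1; push_cast; ring
    _ ≤ K * h * h := key
    _ = K * h ^ 2 := by ring

/-- As the derivative of a holomorphic function `q` is itself holomorphic, and its derivative is
bounded on the compact convex set. -/
theorem exists_lipschitz {U B : Set ℂ} (hU : IsOpen U) (hBU : B ⊆ U) (hB : Convex ℝ B)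
    (hBc : IsCompact B) {Q q : ℂ → ℂ} (hQ : ∀ ζ ∈ U, HasDerivAt Q (q ζ) ζ) :
    ∃ K, 0 ≤ K ∧ ∀ ζ ∈ B, ∀ ξ ∈ B, ‖q ζ - q ξ‖ ≤ K * ‖ζ - ξ‖ := by
  have hQd : DifferentiableOn ℂ Q U := fun ζ hζ => (hQ ζ hζ).differentiableAt.differentiableWithinAt
  have hq : DifferentiableOn ℂ q U :=
    (hQd.deriv hU).congr fun ζ hζ => ((hQ ζ hζ).deriv).symm
  have hq' : ContinuousOn (deriv q) U := (hq.deriv hU).continuousOn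
  obtain ⟨K, hK⟩ := hBc.exists_bound_of_continuousOn (hq'.mono hBU)
  refine ⟨max K 0, le_max_right _ _, fun ζ hζ ξ hξ => ?_⟩
  exact hB.norm_image_sub_le_of_norm_deriv_le
    (fun z hz => (hq z (hBU hz)).differentiableAt (hU.mem_nhds (hBU hz)))
    (fun z hz => (hK z hz).trans (le_max_left _ _)) hξ hζ

/-- The values of `Q` telescope over p cells of length 2π/N, each with an error of order N⁻². The
constant is uniform in the complex shift, so the estimate can be used for the derivative of a node
sum with respect to its shift. -/
theorem riemann_bound {ρ : ℝ} (h0 : 0 < ρ) {x δ : ℝ} (hδ : levelRect ρ x δ ⊆ zetaImage ρ)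
    {Q q : ℂ → ℂ} (hQ : ∀ ζ ∈ zetaImage ρ, HasDerivAt Q (q ζ) ζ) :
    ∃ K, 0 ≤ K ∧ ∀ N p : ℕ, 0 < N → (p : ℝ) = ρ * N → ∀ σ : ℂ, ‖σ - x‖ ≤ δ →
      ‖(2 * Real.pi / N : ℝ) * Complex.I * nodeSum N p q σ
        - (Q (σ + (ρ * Real.pi : ℝ) * Complex.I) - Q (σ + (-(ρ * Real.pi) : ℝ) * Complex.I))‖
      ≤ K / N := by
  have hpi := Real.pi_pos
  have hBconv : Convex ℝ (levelRect ρ x δ) :=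
    ((convex_Icc _ _).linear_preimage Complex.reCLM.toLinearMap).inter
      ((convex_Icc _ _).linear_preimage Complex.imCLM.toLinearMap)
  have hBc : IsCompact (levelRect ρ x δ) := isCompact_Icc.reProdIm isCompact_Icc
  obtain ⟨K, hK0, hK⟩ := exists_lipschitz (isOpen_zetaImage h0) hδ hBconv hBc hQ
  refine ⟨K * (2 * Real.pi) ^ 2 * ρ, by positivity, fun N p hN hp σ hσ => ?_⟩
  have hNr : (0 : ℝ) < N := by exact_mod_cast hN
  set h : ℝ := 2 * Real.pi / N with hh
  have hh0 : 0 ≤ h := by positivity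
  set T : ℕ → ℂ := fun i => σ + (-(ρ * Real.pi) + i * h : ℝ) * Complex.I with hT
  have hph : p * h = 2 * (ρ * Real.pi) := by rw [hp, hh]; field_simp
  have hTp : T p = σ + (ρ * Real.pi : ℝ) * Complex.I := by
    simp only [hT, hph]; congr 3; ring
  have hT0 : T 0 = σ + (-(ρ * Real.pi) : ℝ) * Complex.I := by simp [hT]
  have hTm : ∀ i ≤ p, T i ∈ levelRect ρ x δ := by
    intro i hi
    refine mem_levelRect hσ ?_
    have hi' : (i : ℝ) ≤ p := by exact_mod_cast hi
    have : i * h ≤ p * h := by gcongr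
    rw [abs_le]
    constructor
    · have : 0 ≤ i * h := by positivity
      linarith
    · linarith
  rw [← hTp, ← hT0, ← Finset.sum_range_sub (fun i => Q (T i)), nodeSum, Finset.mul_sum,
    ← Finset.sum_sub_distrib]
  have hcell : ∀ i ∈ Finset.range p,
      ‖h * Complex.I * q (σ + node N p i * Complex.I) - (Q (T (i + 1)) - Q (T i))‖
        ≤ K * h ^ 2 := by
    intro i hi
    have hi' := Finset.mem_range.1 hi
    have hn : node N p i = -(ρ * Real.pi) + i * h + h / 2 := by
      rw [node, hp, hh]; field_simp; ring
    have e1 : σ + node N p i * Complex.I + (h / 2 : ℝ) * Complex.I = T (i + 1) := by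
      simp only [hT, hn]; push_cast; ring
    have e2 : σ + node N p i * Complex.I - (h / 2 : ℝ) * Complex.I = T i := by
      simp only [hT, hn]; push_cast; ring
    have := cell_bound hBconv hK0 (fun ζ hζ => hQ ζ (hδ hζ)) hK (a := σ + node N p i * Complex.I)
      hh0 (by rw [e2]; exact hTm i hi'.le) (by rw [e1]; exact hTm (i + 1) hi')
    rwa [e1, e2] at this
  refine (norm_sum_le_of_le _ hcell).trans ?_
  rw [Finset.sum_const, Finset.card_range, nsmul_eq_mul, hp, hh]
  apply le_of_eq
  field_simp

/-- The increments of a node sum are governed by the boundary values. -/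
theorem nodeSum_sub_isLittleO {ρ : ℝ} (h0 : 0 < ρ) (h1 : ρ < 1) {x : ℝ} (hx : xCrit ρ < x)
    {Q : ℂ → ℂ} (hQ : DifferentiableOn ℂ Q (zetaImage ρ)) {N p : ℕ → ℕ}
    (hN : Tendsto N atTop atTop) (hp : ∀ k, (p k : ℝ) = ρ * N k) {σ τ : ℕ → ℂ}
    (hσ : Tendsto σ atTop (𝓝 (x : ℂ))) (hτ : Tendsto τ atTop (𝓝 (x : ℂ))) :
    (fun k => nodeSum (N k) (p k) Q (σ k) - nodeSum (N k) (p k) Q (τ k)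
      - N k * ((Q (levelPoint ρ x) - Q ((starRingEnd ℂ) (levelPoint ρ x)))
        / (2 * Real.pi * Complex.I)) * (σ k - τ k)) =o[atTop] fun k => N k * (σ k - τ k) := by
  have hpi := Real.pi_pos
  have hNt : Tendsto (fun k => (N k : ℝ)) atTop atTop := tendsto_natCast_atTop_atTop.comp hN
  obtain ⟨δ, hδ0, hδ⟩ := exists_levelRect_subset h0 h1 hx
  have hQ' : ∀ ζ ∈ zetaImage ρ, HasDerivAt Q (deriv Q ζ) ζ := fun ζ hζ =>
    ((hQ ζ hζ).differentiableAt ((isOpen_zetaImage h0).mem_nhds hζ)).hasDerivAt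
  obtain ⟨K, hK0, hK⟩ := riemann_bound h0 hδ hQ'
  set D : ℂ := (Q (levelPoint ρ x) - Q ((starRingEnd ℂ) (levelPoint ρ x)))
    / (2 * Real.pi * Complex.I) with hD
  rw [Asymptotics.isLittleO_iff]
  intro ε hε
  have e1 : (x : ℂ) + (ρ * Real.pi : ℝ) * Complex.I = levelPoint ρ x := rfl
  have e2 : (x : ℂ) + (-(ρ * Real.pi) : ℝ) * Complex.I = (starRingEnd ℂ) (levelPoint ρ x) := by
    simp [levelPoint]
  have hcont : ContinuousAt (fun σ : ℂ => Q (σ + (ρ * Real.pi : ℝ) * Complex.I)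
      - Q (σ + (-(ρ * Real.pi) : ℝ) * Complex.I)) x := by
    have m1 := levelPoint_mem h0 h1 hx
    have m2 := conj_mem_zetaImage m1
    refine ContinuousAt.sub ?_ ?_
    · refine ContinuousAt.comp (f := fun σ : ℂ => σ + (ρ * Real.pi : ℝ) * Complex.I) ?_
        (by fun_prop)
      rw [e1]
      exact (hQ' _ m1).continuousAt
    · refine ContinuousAt.comp (f := fun σ : ℂ => σ + (-(ρ * Real.pi) : ℝ) * Complex.I) ?_
        (by fun_prop)
      rw [e2]
      exact (hQ' _ m2).continuousAt
  obtain ⟨η, hη0, hη⟩ := Metric.continuousAt_iff.1 hcont (Real.pi * ε) (by positivity)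
  simp only [e1, e2] at hη
  set ε' : ℝ := min δ (η / 2) with hε'
  have hε'0 : 0 < ε' := lt_min hδ0 (by linarith)
  have hball : Metric.closedBall (x : ℂ) ε' ∈ 𝓝 (x : ℂ) := Metric.closedBall_mem_nhds _ hε'0
  filter_upwards [hσ.eventually hball, hτ.eventually hball,
    hNt.eventually (eventually_ge_atTop (K / (Real.pi * ε))),
    hNt.eventually (eventually_gt_atTop 0)] with k hkσ hkτ hkN hkN0
  have hNpos : 0 < N k := by exact_mod_cast hkN0
  -- Mean value inequality for the node sum minus N D ξ. Its derivative is the node sum of Q' minus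
  -- N D, at most εN by the Riemann bound, so the error is relative to |σ - τ|.
  have hder : ∀ ξ ∈ Metric.closedBall (x : ℂ) ε',
      HasDerivAt (fun ξ => nodeSum (N k) (p k) Q ξ - N k * D * ξ)
        (nodeSum (N k) (p k) (deriv Q) ξ - N k * D) ξ := by
    intro ξ hξ
    have hξ' : ‖ξ - x‖ ≤ δ := by
      rw [← dist_eq_norm]; exact (Metric.mem_closedBall.1 hξ).trans (min_le_left _ _)
    have a1 : HasDerivAt (fun ξ => nodeSum (N k) (p k) Q ξ)
        (nodeSum (N k) (p k) (deriv Q) ξ) ξ := by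
      unfold nodeSum
      refine HasDerivAt.fun_sum fun i hi => ?_
      have hm := hδ (mem_levelRect hξ' (abs_node_le hNpos (hp k) (Finset.mem_range.1 hi)))
      exact (hQ' _ hm).comp_add_const ξ _
    have a2 : HasDerivAt (fun ξ : ℂ => N k * D * ξ) (N k * D) ξ := by
      simpa using (hasDerivAt_id ξ).const_mul (N k * D)
    exact a1.sub a2
  have hbd : ∀ ξ ∈ Metric.closedBall (x : ℂ) ε',
      ‖nodeSum (N k) (p k) (deriv Q) ξ - N k * D‖ ≤ ε * N k := by
    intro ξ hξ
    have hd := Metric.mem_closedBall.1 hξ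
    have r := hK (N k) (p k) hNpos (hp k) ξ
      (by rw [← dist_eq_norm]; exact hd.trans (min_le_left _ _))
    have c := hη (x := ξ) (lt_of_le_of_lt (hd.trans (min_le_right _ _)) (by linarith))
    rw [dist_eq_norm] at c
    have hDD : Q (levelPoint ρ x) - Q ((starRingEnd ℂ) (levelPoint ρ x))
        = 2 * Real.pi * Complex.I * D := by
      rw [hD, mul_div_cancel₀]
      simp [Real.pi_ne_zero]
    rw [hDD] at c
    have hNc : (N k : ℂ) ≠ 0 := by exact_mod_cast hNpos.ne'
    have e : (2 * Real.pi / N k : ℝ) * Complex.I * nodeSum (N k) (p k) (deriv Q) ξ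
        - 2 * Real.pi * Complex.I * D
        = (2 * Real.pi / N k : ℝ) * (Complex.I * (nodeSum (N k) (p k) (deriv Q) ξ - N k * D)) := by
      push_cast; field_simp
    have t := norm_add_le_of_le r c.le
    rw [sub_add_sub_cancel, e, norm_mul, norm_mul, Complex.norm_I, one_mul, Complex.norm_real,
      Real.norm_eq_abs, abs_of_pos (by positivity)] at t
    have hKN : K / N k ≤ Real.pi * ε := by
      rw [div_le_iff₀ hkN0]
      rwa [div_le_iff₀ (by positivity), mul_comm] at hkN
    have t2 := t.trans (add_le_add_left hKN _)
    rw [div_mul_eq_mul_div, div_le_iff₀ hkN0] at t2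
    have : (2 * Real.pi) * ‖nodeSum (N k) (p k) (deriv Q) ξ - N k * D‖
        ≤ (2 * Real.pi) * (ε * N k) := by linarith
    exact le_of_mul_le_mul_left this (by positivity)
  have := (convex_closedBall (x : ℂ) ε').norm_image_sub_le_of_norm_hasDerivWithin_le
    (fun ξ hξ => (hder ξ hξ).hasDerivWithinAt) hbd hkτ hkσ
  rw [norm_mul, Complex.norm_natCast, ← mul_assoc]
  refine le_trans (le_of_eq ?_) this
  congr 1; ring

/-! ### The consistency equation near the limiting solution -/

theorem ell_conj {w : ℂ} (hw : w + 1 ∈ Complex.slitPlane) :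
    ell ((starRingEnd ℂ) w) = (starRingEnd ℂ) (ell w) := by
  have h1 := Complex.log_conj _ (Complex.slitPlane_arg_ne_pi hw)
  simp only [map_add, map_one] at h1
  rw [ell, ell, h1, map_sub, Complex.conj_ofReal]

theorem node_reflect {N p i : ℕ} (hi : i < p) : node N p (p - 1 - i) = -node N p i := by
  rw [node, node, show p - 1 - i = p - (i + 1) by omega, Nat.cast_sub hi]
  push_cast; ring

theorem sum_node (N p : ℕ) : ∑ i ∈ Finset.range p, node N p i = 0 := by
  have h := Finset.sum_range_reflect (node N p) p
  rw [Finset.sum_congr rfl fun i hi => node_reflect (Finset.mem_range.1 hi),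
    Finset.sum_neg_distrib] at h
  linarith

/-- The nodes are symmetric about 0, so conjugation only reverses their order. -/
theorem nodeSum_conj {N p : ℕ} {f : ℂ → ℂ} {σ : ℂ}
    (hf : ∀ i < p, f ((starRingEnd ℂ) (σ + node N p i * Complex.I))
      = (starRingEnd ℂ) (f (σ + node N p i * Complex.I))) :
    nodeSum N p f ((starRingEnd ℂ) σ) = (starRingEnd ℂ) (nodeSum N p f σ) := by
  rw [nodeSum, nodeSum, map_sum, ← Finset.sum_range_reflect]
  refine Finset.sum_congr rfl fun i hi => ?_
  rw [← hf i (Finset.mem_range.1 hi), node_reflect (Finset.mem_range.1 hi)]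
  congr 1
  simp

/-- The increment of `f` when the last node is moved by `e` steps. -/
noncomputable def lastStep (N p e : ℕ) (f : ℂ → ℂ) (σ : ℂ) : ℂ :=
  f (σ + (node N p (p - 1) + e * (2 * Real.pi / N) : ℝ) * Complex.I)
    - f (σ + node N p (p - 1) * Complex.I)

/-- The shift of the nodes for a solution with modulus `x` and phase `s`. -/
noncomputable def shift (N : ℕ) (x s : ℝ) : ℂ := x + (2 * Real.pi / N * (s - 1 / 2) : ℝ) * Complex.I

theorem BetheSol.eq_zetaInv {ρ : ℝ} (h0 : 0 < ρ) (h1 : ρ < 1) {γ x s : ℝ} {N p e : ℕ}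
    (hN : p + 2 < N) (hp0 : 0 < p) (he : e ≤ 1) (hx : xCrit ρ < x)
    {u : ℕ → ℂ} {l : ℂ} (h : BetheSol ρ γ N p e x s u l) :
    (∀ i, i + 1 < p → shift N x s + node N p i * Complex.I ∈ zetaImage ρ ∧
      u i = zetaInv ρ (shift N x s + node N p i * Complex.I)) ∧
    (shift N x s + (node N p (p - 1) + e * (2 * Real.pi / N) : ℝ) * Complex.I ∈ zetaImage ρ ∧
      u (p - 1) =
        zetaInv ρ (shift N x s + (node N p (p - 1) + e * (2 * Real.pi / N) : ℝ) * Complex.I)) := by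
  have hpi := Real.pi_pos
  have hNr : (0 : ℝ) < N := by exact_mod_cast (by omega : 0 < N)
  have hs := h.phase_mem
  have hNp : (p : ℝ) + 2 < N := by exact_mod_cast hN
  have key : ∀ t : ℝ, 0 ≤ t → t ≤ p → |Real.pi / N * (-p + 2 * (t + s))| < Real.pi := by
    intro t ht htp
    rw [abs_mul, abs_of_pos (by positivity), div_mul_eq_mul_div, div_lt_iff₀ hNr]
    gcongr
    rw [abs_lt]
    constructor <;> linarith [hs.1, hs.2]
  have mem : ∀ ψ : ℝ, |ψ| < Real.pi → (x : ℂ) + ψ * Complex.I ∈ zetaImage ρ := fun ψ hψ =>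
    mem_zetaImage h0 h1 (Or.inr (by simpa using ⟨hx, hψ⟩))
  constructor
  · intro i hi
    have hi' : (i : ℝ) ≤ p := by exact_mod_cast (by omega : i ≤ p)
    have e1 : shift N x s + node N p i * Complex.I
        = x + (Real.pi / N * (-p + 2 * (i + s)) : ℝ) * Complex.I := by
      rw [shift, node]; push_cast; ring
    have hk := key i (Nat.cast_nonneg i) hi'
    rw [e1]
    exact ⟨mem _ hk, (h.root i hi).eq_zetaInv h0 h1 (Or.inr ⟨hx, hk⟩)⟩
  · have he' : (e : ℝ) ≤ 1 := by exact_mod_cast he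
    have he0 : (0 : ℝ) ≤ e := Nat.cast_nonneg e
    have hp1 : (1 : ℝ) ≤ p := by exact_mod_cast hp0
    have e1 : shift N x s + (node N p (p - 1) + e * (2 * Real.pi / N) : ℝ) * Complex.I
        = x + (Real.pi / N * (-p + 2 * ((p : ℝ) - 1 + e + s)) : ℝ) * Complex.I := by
      rw [shift, node, Nat.cast_sub hp0]; push_cast; ring
    have hk := key (p - 1 + e) (by linarith) (by linarith)
    rw [e1]
    exact ⟨mem _ hk, h.last.eq_zetaInv h0 h1 (Or.inr ⟨hx, hk⟩)⟩

theorem sum_eq_nodeSum {N p e : ℕ} (hp0 : 0 < p) {f : ℂ → ℂ} {σ : ℂ} {g : ℕ → ℂ}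
    (h : ∀ i, i + 1 < p → g i = f (σ + node N p i * Complex.I))
    (h' : g (p - 1) = f (σ + (node N p (p - 1) + e * (2 * Real.pi / N) : ℝ) * Complex.I)) :
    ∑ i ∈ Finset.range p, g i = nodeSum N p f σ + lastStep N p e f σ := by
  obtain ⟨q, rfl⟩ : ∃ q, p = q + 1 := ⟨p - 1, by omega⟩
  rw [nodeSum, lastStep, Finset.sum_range_succ, Finset.sum_range_succ,
    Finset.sum_congr rfl fun i hi => h i (by have := Finset.mem_range.1 hi; omega)]
  rw [Nat.add_sub_cancel] at h' ⊢
  rw [h']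
  ring

/-- Expresses each factor of the product through ζ, which is explicit at the roots, and `ell`. -/
theorem div_eq_exp {ρ : ℝ} (h0 : 0 < ρ) {w : ℂ} (hw : w ∈ cutPlane) :
    (w - 1) / (w + 1) = Complex.exp ((zeta ρ w - (Real.log 2 : ℝ) - ell w) / ρ) := by
  have hρ : (ρ : ℂ) ≠ 0 := by exact_mod_cast h0.ne'
  have : (zeta ρ w - (Real.log 2 : ℝ) - ell w) / ρ
      = Complex.log (w - 1) - Complex.log (w + 1) := by
    rw [zeta, ell]; field_simp; ring
  rw [this, Complex.exp_sub, Complex.exp_log (Complex.slitPlane_ne_zero hw),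
    Complex.exp_log (Complex.slitPlane_ne_zero (add_one_mem_slitPlane hw))]

/-- Logarithm of the consistency equation, multiplied by ρ. The nodes sum to 0, so the values of ζ
contribute pσ and the displacement of the last root. -/
theorem BetheSol.exists_int {ρ : ℝ} (h0 : 0 < ρ) (h1 : ρ < 1) {γ x s : ℝ} {N p e : ℕ}
    (hN : p + 2 < N) (hp0 : 0 < p) (hp : (p : ℝ) = ρ * N) (he : e ≤ 1) (hx : xCrit ρ < x)
    {u : ℕ → ℂ} {l : ℂ} (h : BetheSol ρ γ N p e x s u l) :
    ∃ n : ℤ, (p : ℂ) * γ + e * (2 * Real.pi / N) * Complex.I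
      - (nodeSum N p (fun ζ => ell (zetaInv ρ ζ)) (shift N x s)
        + lastStep N p e (fun ζ => ell (zetaInv ρ ζ)) (shift N x s))
      = n * (2 * Real.pi * ρ * Complex.I) := by
  obtain ⟨hu, hu'⟩ := h.eq_zetaInv h0 h1 hN hp0 he hx
  set σ := shift N x s with hσ
  have hρ : (ρ : ℂ) ≠ 0 := by exact_mod_cast h0.ne'
  have hpc : (p : ℂ) = ρ * N := by exact_mod_cast hp
  have hNc : (N : ℂ) ≠ 0 := by exact_mod_cast (by omega : N ≠ 0)
  have hmem : ∀ i ∈ Finset.range p, u i ∈ cutPlane := by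
    intro i hi
    rcases Nat.lt_or_ge (i + 1) p with h' | h'
    · rw [(hu i h').2]; exact zetaInv_mem (hu i h').1
    · have := Finset.mem_range.1 hi
      rw [show i = p - 1 by omega, hu'.2]; exact zetaInv_mem hu'.1
  have hell := sum_eq_nodeSum (N := N) (e := e) hp0 (f := fun ζ => ell (zetaInv ρ ζ)) (σ := σ)
    (g := fun i => ell (u i)) (fun i hi => by rw [(hu i hi).2]) (by rw [hu'.2])
  have hze := sum_eq_nodeSum (N := N) (e := e) hp0 (f := id) (σ := σ)
    (g := fun i => zeta ρ (u i)) (fun i hi => by rw [(hu i hi).2, zeta_zetaInv (hu i hi).1]; rfl)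
    (by rw [hu'.2, zeta_zetaInv hu'.1]; rfl)
  have hid : nodeSum N p id σ + lastStep N p e id σ
      = p * σ + e * (2 * Real.pi / N) * Complex.I := by
    simp only [nodeSum, lastStep, id]
    rw [Finset.sum_add_distrib, ← Finset.sum_mul, ← Complex.ofReal_sum, sum_node]
    simp
    ring
  have hprod := h.prod_eq
  have h2 : (2 : ℂ) ^ N = Complex.exp (N * (Real.log 2 : ℝ)) := by
    rw [Complex.exp_nat_mul, ← Complex.ofReal_exp, Real.exp_log (by norm_num)]
    simp
  -- The half step in `shift` absorbs the minus sign of the consistency equation.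
  have h3 : Complex.exp (N * x + 2 * Real.pi * s * Complex.I) = -Complex.exp (N * σ) := by
    rw [← neg_one_mul, ← Complex.exp_pi_mul_I, ← Complex.exp_add]
    congr 1
    rw [hσ, shift]; push_cast; field_simp; ring
  rw [Finset.prod_congr rfl fun i hi => div_eq_exp h0 (hmem i hi), ← Complex.exp_sum, h2, h3,
    Complex.ofReal_exp, ← Complex.exp_add, ← Complex.exp_add, ← sub_eq_add_neg, sub_eq_zero,
    Complex.exp_eq_exp_iff_exists_int, ← Finset.sum_div, Finset.sum_sub_distrib,
    Finset.sum_sub_distrib, hell, hze, hid, Finset.sum_const, Finset.card_range,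
    nsmul_eq_mul] at hprod
  obtain ⟨n, hn⟩ := hprod
  refine ⟨n, ?_⟩
  generalize nodeSum N p (fun ζ => ell (zetaInv ρ ζ)) σ
    + lastStep N p e (fun ζ => ell (zetaInv ρ ζ)) σ = A at hn ⊢
  rw [hpc] at hn ⊢
  push_cast at hn
  have hn' := congrArg (fun z => (ρ : ℂ) * z) hn
  simp only [mul_add, mul_div_cancel₀ _ hρ] at hn'
  linear_combination hn'

theorem BetheSol.val_eq_nodeSum {ρ : ℝ} (h0 : 0 < ρ) (h1 : ρ < 1) {γ x s : ℝ} {N p e : ℕ}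
    (hN : p + 2 < N) (hp0 : 0 < p) (he : e ≤ 1) (hx : xCrit ρ < x)
    {u : ℕ → ℂ} {l : ℂ} (h : BetheSol ρ γ N p e x s u l) :
    l = 1 / 2 * (nodeSum N p (zetaInv ρ) (shift N x s) + lastStep N p e (zetaInv ρ) (shift N x s)
      - p) := by
  obtain ⟨hu, hu'⟩ := h.eq_zetaInv h0 h1 hN hp0 he hx
  rw [h.val_eq, Finset.sum_sub_distrib, sum_eq_nodeSum (N := N) (e := e) hp0
    (fun i hi => (hu i hi).2) hu'.2]
  simp

theorem tendsto_last_node {ρ : ℝ} (h0 : 0 < ρ) {x : ℝ} {N p : ℕ → ℕ} (hN : Tendsto N atTop atTop)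
    (hp : ∀ k, (p k : ℝ) = ρ * N k) {σ : ℕ → ℂ} (hσ : Tendsto σ atTop (𝓝 (x : ℂ))) (e : ℕ) :
    Tendsto (fun k => σ k + (node (N k) (p k) (p k - 1) + e * (2 * Real.pi / N k) : ℝ)
      * Complex.I) atTop (𝓝 (levelPoint ρ x)) := by
  have hNt : Tendsto (fun k => (N k : ℝ)) atTop atTop := tendsto_natCast_atTop_atTop.comp hN
  have hr : Tendsto (fun k => (node (N k) (p k) (p k - 1) + e * (2 * Real.pi / N k) : ℝ)) atTop
      (𝓝 (ρ * Real.pi)) := by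
    have hz : Tendsto (fun k => ρ * Real.pi + Real.pi * (2 * e - 1) / (N k : ℝ)) atTop
        (𝓝 (ρ * Real.pi + 0)) := tendsto_const_nhds.add (tendsto_const_nhds.div_atTop hNt)
    rw [add_zero] at hz
    refine hz.congr' ?_
    filter_upwards [hNt.eventually (eventually_gt_atTop 0),
      (tendsto_natCast_mul h0 hN hp).eventually (eventually_gt_atTop 0)] with k hk hpk
    have hpk' : 0 < p k := by exact_mod_cast hpk
    rw [node, Nat.cast_sub hpk', hp k]
    field_simp
    push_cast
    ring
  exact hσ.add (((Complex.continuous_ofReal.tendsto _).comp hr).mul_const Complex.I)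

/-- Both ends of the step move with k, hence the strict derivative at the limit point. -/
theorem tendsto_mul_lastStep {ρ : ℝ} (h0 : 0 < ρ) {x : ℝ} {N p : ℕ → ℕ}
    (hN : Tendsto N atTop atTop) (hp : ∀ k, (p k : ℝ) = ρ * N k) {σ : ℕ → ℂ}
    (hσ : Tendsto σ atTop (𝓝 (x : ℂ))) (e : ℕ) {f : ℂ → ℂ} {f' : ℂ}
    (hf : HasStrictDerivAt f f' (levelPoint ρ x)) :
    Tendsto (fun k => N k * lastStep (N k) (p k) e f (σ k)) atTop
      (𝓝 (e * (2 * Real.pi) * Complex.I * f')) := by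
  have t1 := tendsto_last_node h0 hN hp hσ e
  have t0 := tendsto_last_node h0 hN hp hσ 0
  simp only [Nat.cast_zero, zero_mul, add_zero] at t0
  have ho := (hf.hasStrictFDerivAt.isLittleO).comp_tendsto (t1.prodMk_nhds t0)
  have ho2 := (Asymptotics.isBigO_refl (fun k => (N k : ℂ)) atTop).mul_isLittleO ho
  have hNt : Tendsto (fun k => (N k : ℝ)) atTop atTop := tendsto_natCast_atTop_atTop.comp hN
  have hc : ∀ᶠ k in atTop, (N k : ℂ) ≠ 0 := by
    filter_upwards [hNt.eventually (eventually_gt_atTop 0)] with k hk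
    exact_mod_cast hk.ne'
  have ho3 := ho2.congr' (f₂ := fun k => N k * lastStep (N k) (p k) e f (σ k)
    - e * (2 * Real.pi) * Complex.I * f') (g₂ := fun _ => (e * (2 * Real.pi) * Complex.I : ℂ)) ?_ ?_
  · have hz : Tendsto (fun k => N k * lastStep (N k) (p k) e f (σ k)
        - e * (2 * Real.pi) * Complex.I * f') atTop (𝓝 0) :=
      (Asymptotics.isLittleO_one_iff ℝ).1
        (ho3.trans_isBigO (Asymptotics.isBigO_const_const _ one_ne_zero _))
    simpa using hz.add_const (e * (2 * Real.pi) * Complex.I * f')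
  · filter_upwards [hc] with k hk
    simp only [Function.comp, lastStep]
    push_cast
    simp
    field_simp
    ring
  · filter_upwards [hc] with k hk
    simp only [Function.comp]
    push_cast
    field_simp
    ring

theorem tendsto_zero_of_mul {N : ℕ → ℕ} (hN : Tendsto N atTop atTop) {f : ℕ → ℂ} {c : ℂ}
    (h : Tendsto (fun k => N k * f k) atTop (𝓝 c)) : Tendsto f atTop (𝓝 0) := by
  have hNt : Tendsto (fun k => ((N k : ℂ))⁻¹) atTop (𝓝 0) := by
    have : Tendsto (fun k => ((N k : ℝ))⁻¹) atTop (𝓝 0) :=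
      tendsto_inv_atTop_zero.comp (tendsto_natCast_atTop_atTop.comp hN)
    have := (Complex.continuous_ofReal.tendsto _).comp this
    simpa [Function.comp_def] using this
  have := hNt.mul h
  rw [zero_mul] at this
  refine this.congr' ?_
  filter_upwards [hN.eventually (eventually_gt_atTop 0)] with k hk
  have : (N k : ℂ) ≠ 0 := by exact_mod_cast hk.ne'
  field_simp

/-- The sine of the difference of the angles is 2 Im w/(|w - 1||w + 1|) > 0. -/
theorem arg_add_one_lt {w : ℂ} (hw : 0 < w.im) : (w + 1).arg < (w - 1).arg := by
  have i1 : 0 < (w + 1).im := by simpa using hw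
  have i2 : 0 < (w - 1).im := by simpa using hw
  have a1 := arg_pos_of_im_pos i1
  have a2 := arg_pos_of_im_pos i2
  have b1 := Complex.arg_le_pi (w + 1)
  have b2 := Complex.arg_le_pi (w - 1)
  have n1 : w + 1 ≠ 0 := fun h => by rw [h] at i1; simp at i1
  have n2 : w - 1 ≠ 0 := fun h => by rw [h] at i2; simp at i2
  have hs : 0 < Real.sin ((w - 1).arg - (w + 1).arg) := by
    rw [Real.sin_sub, Complex.sin_arg, Complex.sin_arg, Complex.cos_arg n1, Complex.cos_arg n2]
    have p1 := norm_pos_iff.2 n1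
    have p2 := norm_pos_iff.2 n2
    have : (w - 1).im / ‖w - 1‖ * ((w + 1).re / ‖w + 1‖) - (w - 1).re / ‖w - 1‖
        * ((w + 1).im / ‖w + 1‖) = 2 * w.im / (‖w - 1‖ * ‖w + 1‖) := by
      field_simp; simp; ring
    rw [this]; positivity
  by_contra! h
  have := Real.sin_nonpos_of_nonpos_of_neg_pi_le (x := (w - 1).arg - (w + 1).arg) (by linarith)
    (by linarith)
  linarith

/-- ρπ is the weighted mean of arg(w - 1) and arg(w + 1), of which the latter is smaller. The bound
excludes other branches of the logarithm in `eventually_nodeSum_eq`. -/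
theorem arg_level_lt {ρ : ℝ} (h0 : 0 < ρ) (h1 : ρ < 1) {x : ℝ} (hx : xCrit ρ < x) :
    (zetaInv ρ (levelPoint ρ x) + 1).arg < ρ * Real.pi := by
  have hm := levelPoint_mem h0 h1 hx
  have hw := zetaInv_im_pos h0 h1 hm (by simpa using mul_pos h0 Real.pi_pos)
  have e := zeta_im ρ (zetaInv ρ (levelPoint ρ x))
  rw [zeta_zetaInv hm, levelPoint_im] at e
  nlinarith [arg_add_one_lt hw]

theorem hasStrictDerivAt_of_mem {ρ : ℝ} (h0 : 0 < ρ) {f : ℂ → ℂ}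
    (hf : DifferentiableOn ℂ f (zetaImage ρ)) {ζ : ℂ} (h : ζ ∈ zetaImage ρ) {f' : ℂ}
    (hd : HasDerivAt f f' ζ) : HasStrictDerivAt f f' ζ := by
  have := ((hf.analyticOnNhd (isOpen_zetaImage h0)) ζ h).hasStrictDerivAt
  rwa [hd.deriv] at this

theorem hasDerivAt_ell_zetaInv {ρ : ℝ} (h0 : 0 < ρ) (h1 : ρ < 1) {ζ : ℂ} (h : ζ ∈ zetaImage ρ) :
    HasDerivAt (fun ζ => ell (zetaInv ρ ζ))
      (1 / (zetaInv ρ ζ + 1) * (zetaDeriv ρ (zetaInv ρ ζ))⁻¹) ζ :=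
  (hasDerivAt_ell (zetaInv_mem h)).comp ζ (hasDerivAt_zetaInv h0 h1 h)

theorem differentiableOn_ell_zetaInv {ρ : ℝ} (h0 : 0 < ρ) (h1 : ρ < 1) :
    DifferentiableOn ℂ (fun ζ => ell (zetaInv ρ ζ)) (zetaImage ρ) := fun _ h =>
  (hasDerivAt_ell_zetaInv h0 h1 h).differentiableAt.differentiableWithinAt

theorem differentiableOn_zetaInv {ρ : ℝ} (h0 : 0 < ρ) (h1 : ρ < 1) :
    DifferentiableOn ℂ (zetaInv ρ) (zetaImage ρ) := fun _ h =>
  (hasDerivAt_zetaInv h0 h1 h).differentiableAt.differentiableWithinAt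

theorem ell_slope {ρ : ℝ} (h0 : 0 < ρ) (h1 : ρ < 1) {x : ℝ} (hx : xCrit ρ < x) :
    (ell (zetaInv ρ (levelPoint ρ x)) - ell (zetaInv ρ ((starRingEnd ℂ) (levelPoint ρ x))))
      / (2 * Real.pi * Complex.I)
      = (((zetaInv ρ (levelPoint ρ x) + 1).arg / Real.pi : ℝ) : ℂ) := by
  have hm := levelPoint_mem h0 h1 hx
  have hpi : (Real.pi : ℂ) ≠ 0 := by exact_mod_cast Real.pi_ne_zero
  rw [zetaInv_conj h0 h1 hm, ell_conj (add_one_mem_slitPlane (zetaInv_mem hm)), Complex.sub_conj,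
    ell_im]
  push_cast
  field_simp

theorem tendsto_shift {N : ℕ → ℕ} (hN : Tendsto N atTop atTop) {x s : ℕ → ℝ} {x' : ℝ}
    (hx : Tendsto x atTop (𝓝 x')) (hs : ∀ᶠ k in atTop, s k ∈ Set.Icc (0 : ℝ) 1) :
    Tendsto (fun k => shift (N k) (x k) (s k)) atTop (𝓝 (x' : ℂ)) := by
  have hNt : Tendsto (fun k => (N k : ℝ)) atTop atTop := tendsto_natCast_atTop_atTop.comp hN
  have hz : Tendsto (fun k => 2 * Real.pi / N k * (s k - 1 / 2)) atTop (𝓝 0) := by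
    have h1 : Tendsto (fun k => 2 * Real.pi / (N k : ℝ)) atTop (𝓝 0) :=
      tendsto_const_nhds.div_atTop hNt
    refine h1.zero_mul_isBoundedUnder_le ⟨1, ?_⟩
    rw [eventually_map]
    filter_upwards [hs] with k hk
    simp only [Function.comp, Real.norm_eq_abs]
    rw [abs_le]; constructor <;> linarith [hk.1, hk.2]
  have := ((Complex.continuous_ofReal.tendsto _).comp hx).add
    (((Complex.continuous_ofReal.tendsto _).comp hz).mul_const Complex.I)
  simpa [shift, Function.comp_def] using this

/-- The logarithm of the consistency equation, without ambiguity of the branch. -/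
theorem eventually_nodeSum_eq {ρ : ℝ} (h0 : 0 < ρ) (h1 : ρ < 1) {γ : ℝ} {x' : ℝ}
    (hx' : xCrit ρ < x') {N p : ℕ → ℕ} {e : ℕ} (he : e ≤ 1) (hN : Tendsto N atTop atTop)
    (hp : ∀ k, (p k : ℝ) = ρ * N k) (hpN : ∀ᶠ k in atTop, 0 < p k ∧ p k + 2 < N k) {x s : ℕ → ℝ}
    {u : ℕ → ℕ → ℂ} {l : ℕ → ℂ}
    (h : ∀ᶠ k in atTop, BetheSol ρ γ (N k) (p k) e (x k) (s k) (u k) (l k))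
    (hx : Tendsto x atTop (𝓝 x')) :
    ∀ᶠ k in atTop, nodeSum (N k) (p k) (fun ζ => ell (zetaInv ρ ζ)) (shift (N k) (x k) (s k))
      = p k * γ + e * (2 * Real.pi / N k) * Complex.I
        - lastStep (N k) (p k) e (fun ζ => ell (zetaInv ρ ζ)) (shift (N k) (x k) (s k)) := by
  have hpi := Real.pi_pos
  have hs : ∀ᶠ k in atTop, s k ∈ Set.Icc (0 : ℝ) 1 := h.mono fun k hk => hk.phase_mem
  have hσ := tendsto_shift hN hx hs
  have hτ : Tendsto (fun k => (x k : ℂ)) atTop (𝓝 (x' : ℂ)) :=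
    (Complex.continuous_ofReal.tendsto _).comp hx
  have hm := levelPoint_mem h0 h1 hx'
  have hNt : Tendsto (fun k => (N k : ℝ)) atTop atTop := tendsto_natCast_atTop_atTop.comp hN
  have ho := nodeSum_sub_isLittleO h0 h1 hx' (differentiableOn_ell_zetaInv h0 h1) hN hp hσ hτ
  rw [ell_slope h0 h1 hx'] at ho
  have hlast := tendsto_zero_of_mul hN (tendsto_mul_lastStep h0 hN hp hσ e
    (hasStrictDerivAt_of_mem h0 (differentiableOn_ell_zetaInv h0 h1) hm
      (hasDerivAt_ell_zetaInv h0 h1 hm)))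
  have hlast' := hlast.norm
  rw [norm_zero] at hlast'
  have hβ := arg_level_lt h0 h1 hx'
  have hβ0 := consist_deriv_pos h0 h1 hx'
  set β := (zetaInv ρ (levelPoint ρ x') + 1).arg with hβdef
  have hh : Tendsto (fun k => 2 * Real.pi / (N k : ℝ)) atTop (𝓝 0) :=
    tendsto_const_nhds.div_atTop hNt
  have hρ3 : 0 < ρ * Real.pi / 3 := by positivity
  filter_upwards [h, hpN, hx.eventually (lt_mem_nhds hx'),
    Asymptotics.isLittleO_iff.1 ho (show 0 < ρ / 3 by positivity),
    hlast'.eventually (gt_mem_nhds hρ3), hh.eventually (gt_mem_nhds hρ3)]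
    with k hk hkp hkx hko hkl hkh
  obtain ⟨n, hn⟩ := hk.exists_int h0 h1 hkp.2 hkp.1 (hp k) he hkx
  have hNr : (0 : ℝ) < N k := by exact_mod_cast (by omega : 0 < N k)
  set σ := shift (N k) (x k) (s k) with hσd
  set A := nodeSum (N k) (p k) (fun ζ => ell (zetaInv ρ ζ)) σ with hA
  set A' := nodeSum (N k) (p k) (fun ζ => ell (zetaInv ρ ζ)) (x k) with hA'
  set L := lastStep (N k) (p k) e (fun ζ => ell (zetaInv ρ ζ)) σ with hL
  -- At a real shift the node sum is real by symmetry; the actual shift differs by at most π/N.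
  have hreal : A'.im = 0 := by
    have := nodeSum_conj (N := N k) (p := p k) (f := fun ζ => ell (zetaInv ρ ζ)) (σ := (x k : ℂ))
      (fun i hi => by
        have hmi : (x k : ℂ) + node (N k) (p k) i * Complex.I ∈ zetaImage ρ := by
          refine mem_zetaImage h0 h1 (Or.inr ⟨by simpa using hkx, ?_⟩)
          have := abs_node_le (by omega) (hp k) hi
          simp only [Complex.add_im, Complex.ofReal_im, zero_add, Complex.mul_I_im,
            Complex.ofReal_re]
          nlinarith
        rw [zetaInv_conj h0 h1 hmi, ell_conj (add_one_mem_slitPlane (zetaInv_mem hmi))])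
    rw [Complex.conj_ofReal] at this
    exact Complex.conj_eq_iff_im.1 this.symm
  have hσx : ‖(N k : ℂ) * (σ - x k)‖ ≤ Real.pi := by
    have : (N k : ℂ) * (σ - x k) = (2 * Real.pi * (s k - 1 / 2) : ℝ) * Complex.I := by
      have : (N k : ℂ) ≠ 0 := by exact_mod_cast hNr.ne'
      rw [hσd, shift]; push_cast; field_simp; ring
    rw [this, norm_mul, Complex.norm_I, mul_one, Complex.norm_real, Real.norm_eq_abs, abs_le]
    have := hk.phase_mem
    constructor <;> nlinarith [this.1, this.2]
  have hAim : |A.im| ≤ β + ρ * Real.pi / 3 := by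
    have e1 : A = A' + ((A - A' - N k * ((β / Real.pi : ℝ) : ℂ) * (σ - x k))
        + ((β / Real.pi : ℝ) : ℂ) * (N k * (σ - x k))) := by ring
    rw [e1, Complex.add_im, hreal, zero_add]
    refine (Complex.abs_im_le_norm _).trans ((norm_add_le _ _).trans ?_)
    rw [norm_mul, Complex.norm_real, Real.norm_eq_abs, abs_of_pos (by positivity)]
    have q1 : ρ / 3 * ‖(N k : ℂ) * (σ - x k)‖ ≤ ρ / 3 * Real.pi := by gcongr
    have q2 : β / Real.pi * ‖(N k : ℂ) * (σ - x k)‖ ≤ β / Real.pi * Real.pi := by gcongr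
    rw [div_mul_cancel₀ _ hpi.ne'] at q2
    linarith
  -- The imaginary part is below β + 3 · ρπ/3 < 2πρ, one period, because β < ρπ.
  have hn0 : n = 0 := by
    have him := congrArg Complex.im hn
    have e2 : ((p k : ℂ) * γ + e * (2 * Real.pi / N k) * Complex.I - (A + L)).im
        = e * (2 * Real.pi / N k) - (A.im + L.im) := by
      have : (p k : ℂ) * γ + e * (2 * Real.pi / N k) * Complex.I - (A + L)
          = ((p k * γ : ℝ) : ℂ) + ((e * (2 * Real.pi / N k) : ℝ) : ℂ) * Complex.I - (A + L) := by
        push_cast; ring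
      rw [this]; simp
    have e3 : ((n : ℂ) * (2 * Real.pi * ρ * Complex.I)).im = n * (2 * Real.pi * ρ) := by
      have : (n : ℂ) * (2 * Real.pi * ρ * Complex.I)
          = ((n * (2 * Real.pi * ρ) : ℝ) : ℂ) * Complex.I := by push_cast; ring
      rw [this]; simp
    rw [e2, e3] at him
    have hLim := (Complex.abs_im_le_norm L).trans hkl.le
    have he1 : (e : ℝ) ≤ 1 := by exact_mod_cast he
    have he0 : (0 : ℝ) ≤ e := Nat.cast_nonneg e
    have hh0 : 0 < 2 * Real.pi / (N k : ℝ) := by positivity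
    have hehle : e * (2 * Real.pi / N k) ≤ 2 * Real.pi / N k := by nlinarith
    have heh0 : 0 ≤ e * (2 * Real.pi / N k) := by positivity
    rw [abs_le] at hLim hAim
    have r1 : (n : ℝ) * (2 * Real.pi * ρ) < 1 * (2 * Real.pi * ρ) := by
      linarith [hLim.1, hAim.1]
    have r2 : (-1 : ℝ) * (2 * Real.pi * ρ) < n * (2 * Real.pi * ρ) := by
      linarith [hLim.2, hAim.2]
    have hpos : 0 < 2 * Real.pi * ρ := by positivity
    have s1 : (n : ℝ) < 1 := lt_of_mul_lt_mul_right r1 hpos.le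
    have s2 : (-1 : ℝ) < n := lt_of_mul_lt_mul_right r2 hpos.le
    have s1' : n < 1 := by exact_mod_cast s1
    have s2' : -1 < n := by exact_mod_cast s2
    omega
  rw [hn0, Int.cast_zero, zero_mul] at hn
  linear_combination -hn

/-! ### The thermodynamic limit -/

theorem eventually_size {ρ : ℝ} (h0 : 0 < ρ) (h1 : ρ < 1) {N p : ℕ → ℕ}
    (hN : Tendsto N atTop atTop) (hp : ∀ k, (p k : ℝ) = ρ * N k) :
    ∀ᶠ k in atTop, 0 < p k ∧ p k + 2 < N k := by
  have hNt : Tendsto (fun k => (N k : ℝ)) atTop atTop := tendsto_natCast_atTop_atTop.comp hN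
  filter_upwards [(tendsto_natCast_mul h0 hN hp).eventually (eventually_gt_atTop 0),
    (hNt.const_mul_atTop (sub_pos.2 h1)).eventually (eventually_gt_atTop 2)] with k hk hk2
  refine ⟨by exact_mod_cast hk, ?_⟩
  have : (p k : ℝ) + 2 < N k := by rw [hp k]; linarith
  exact_mod_cast this

/-- The node sums of a sequence of solutions with excitation `e`, near the limiting solution. -/
theorem exists_shift {ρ : ℝ} (h0 : 0 < ρ) (h1 : ρ < 1) {γ : ℝ} (hγ : 0 < γ) {N p : ℕ → ℕ} {e : ℕ}
    (he : e ≤ 1) (hN : Tendsto N atTop atTop) (hp : ∀ k, (p k : ℝ) = ρ * N k) {l : ℕ → ℂ}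
    (h : ∀ᶠ k in atTop, ∃ x s u, BetheSol ρ γ (N k) (p k) e x s u (l k)) :
    ∃ σ : ℕ → ℂ, Tendsto σ atTop (𝓝 ((ρ * Real.log (rStar ρ γ) : ℝ) : ℂ)) ∧
      (∀ᶠ k in atTop, nodeSum (N k) (p k) (fun ζ => ell (zetaInv ρ ζ)) (σ k)
        = p k * γ + e * (2 * Real.pi / N k) * Complex.I
          - lastStep (N k) (p k) e (fun ζ => ell (zetaInv ρ ζ)) (σ k)) ∧
      ∀ᶠ k in atTop, l k = 1 / 2 * (nodeSum (N k) (p k) (zetaInv ρ) (σ k)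
        + lastStep (N k) (p k) e (zetaInv ρ) (σ k) - p k) := by
  have h' : ∀ k, ∃ (x s : ℝ) (u : ℕ → ℂ), (∃ x s u, BetheSol ρ γ (N k) (p k) e x s u (l k)) →
      BetheSol ρ γ (N k) (p k) e x s u (l k) := by
    intro k
    by_cases hk : ∃ x s u, BetheSol ρ γ (N k) (p k) e x s u (l k)
    · obtain ⟨x, s, u, hu⟩ := hk
      exact ⟨x, s, u, fun _ => hu⟩
    -- Arbitrary values at the indices without a solution; only large k matter.
    · exact ⟨0, 0, 0, fun h => absurd h hk⟩
  choose x s u hu using h'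
  have hsol : ∀ᶠ k in atTop, BetheSol ρ γ (N k) (p k) e (x k) (s k) (u k) (l k) :=
    h.mono fun k hk => hu k hk
  have hpN := eventually_size h0 h1 hN hp
  have hx := tendsto_of_betheSol h0 h1 hγ hN hp hsol
  have hxc := xCrit_lt_mul_log h0 h1 (rStar_spec h0 h1 hγ).1
  refine ⟨fun k => shift (N k) (x k) (s k), tendsto_shift hN hx
    (hsol.mono fun k hk => hk.phase_mem), eventually_nodeSum_eq h0 h1 hxc he hN hp hpN hsol hx, ?_⟩
  filter_upwards [hsol, hpN, hx.eventually (lt_mem_nhds hxc)] with k hk hkp hkx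
  exact hk.val_eq_nodeSum h0 h1 hkp.2 hkp.1 he hkx

theorem zetaInv_slope {ρ : ℝ} (h0 : 0 < ρ) (h1 : ρ < 1) {x : ℝ} (hx : xCrit ρ < x) :
    (zetaInv ρ (levelPoint ρ x) - zetaInv ρ ((starRingEnd ℂ) (levelPoint ρ x)))
      / (2 * Real.pi * Complex.I) = (((zetaInv ρ (levelPoint ρ x)).im / Real.pi : ℝ) : ℂ) := by
  have hpi : (Real.pi : ℂ) ≠ 0 := by exact_mod_cast Real.pi_ne_zero
  rw [zetaInv_conj h0 h1 (levelPoint_mem h0 h1 hx), Complex.sub_conj]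
  push_cast
  field_simp

/-- The limit of the rescaled difference of the shifts and of the eigenvalues. -/
theorem tendsto_gap {ρ : ℝ} (h0 : 0 < ρ) (h1 : ρ < 1) {x : ℝ} (hx : xCrit ρ < x)
    {N p : ℕ → ℕ} (hN : Tendsto N atTop atTop) (hp : ∀ k, (p k : ℝ) = ρ * N k) {γ : ℝ}
    {σ τ l₁ l₂ : ℕ → ℂ} (hσ : Tendsto σ atTop (𝓝 (x : ℂ))) (hτ : Tendsto τ atTop (𝓝 (x : ℂ)))
    (hσe : ∀ᶠ k in atTop, nodeSum (N k) (p k) (fun ζ => ell (zetaInv ρ ζ)) (σ k) = p k * γ)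
    (hτe : ∀ᶠ k in atTop, nodeSum (N k) (p k) (fun ζ => ell (zetaInv ρ ζ)) (τ k)
      = p k * γ + (2 * Real.pi / N k) * Complex.I
        - lastStep (N k) (p k) 1 (fun ζ => ell (zetaInv ρ ζ)) (τ k))
    (hl₁ : ∀ᶠ k in atTop, l₁ k = 1 / 2 * (nodeSum (N k) (p k) (zetaInv ρ) (σ k) - p k))
    (hl₂ : ∀ᶠ k in atTop, l₂ k = 1 / 2 * (nodeSum (N k) (p k) (zetaInv ρ) (τ k)
      + lastStep (N k) (p k) 1 (zetaInv ρ) (τ k) - p k)) :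
    Tendsto (fun k => (N k : ℂ) * (l₁ k - l₂ k)) atTop
      (𝓝 (gInf ρ (zetaInv ρ (levelPoint ρ x)))) := by
  have hpi : (Real.pi : ℂ) ≠ 0 := by exact_mod_cast Real.pi_ne_zero
  have hm := levelPoint_mem h0 h1 hx
  have hwm := zetaInv_mem hm
  have hβ := consist_deriv_pos h0 h1 hx
  have hoA := nodeSum_sub_isLittleO h0 h1 hx (differentiableOn_ell_zetaInv h0 h1) hN hp hτ hσ
  have hoW := nodeSum_sub_isLittleO h0 h1 hx (differentiableOn_zetaInv h0 h1) hN hp hτ hσ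
  rw [ell_slope h0 h1 hx] at hoA
  rw [zetaInv_slope h0 h1 hx] at hoW
  have hsA := tendsto_mul_lastStep h0 hN hp hτ 1
    (hasStrictDerivAt_of_mem h0 (differentiableOn_ell_zetaInv h0 h1) hm
      (hasDerivAt_ell_zetaInv h0 h1 hm))
  have hsW := tendsto_mul_lastStep h0 hN hp hτ 1
    (hasStrictDerivAt_of_mem h0 (differentiableOn_zetaInv h0 h1) hm (hasDerivAt_zetaInv h0 h1 hm))
  set w := zetaInv ρ (levelPoint ρ x) with hw
  set β : ℝ := (w + 1).arg with hβd
  have hNc : ∀ᶠ k in atTop, (N k : ℂ) ≠ 0 := by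
    filter_upwards [hN.eventually (eventually_gt_atTop 0)] with k hk
    exact_mod_cast hk.ne'
  have hDne : ((β / Real.pi : ℝ) : ℂ) ≠ 0 := by
    exact_mod_cast (div_pos hβ Real.pi_pos).ne'
  -- `R` is the difference of the two consistency equations. It is of order 1/N, and its comparison
  -- with N(β/π)(τ - σ) gives the limit of N²(τ - σ).
  set R : ℕ → ℂ := fun k => (2 * Real.pi / N k) * Complex.I
    - lastStep (N k) (p k) 1 (fun ζ => ell (zetaInv ρ ζ)) (τ k) with hR
  have hNR : Tendsto (fun k => N k * R k) atTop
      (𝓝 (2 * Real.pi * Complex.I - 2 * Real.pi * Complex.I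
        * (1 / (w + 1) * (zetaDeriv ρ w)⁻¹))) := by
    have hsA' := (tendsto_const_nhds (x := 2 * (Real.pi : ℂ) * Complex.I)).sub hsA
    rw [Nat.cast_one, one_mul] at hsA'
    refine hsA'.congr' ?_
    filter_upwards [hNc] with k hk
    simp only [hR]
    field_simp
  have hequiv : Asymptotics.IsEquivalent atTop (fun k => N k * R k)
      (fun k => N k * (N k * ((β / Real.pi : ℝ) : ℂ) * (τ k - σ k))) := by
    refine (Asymptotics.IsEquivalent.refl (u := fun k => (N k : ℂ))).mul ?_
    have h2 : (fun k => R k - N k * ((β / Real.pi : ℝ) : ℂ) * (τ k - σ k)) =o[atTop]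
        fun k => N k * (τ k - σ k) := by
      refine hoA.congr' ?_ EventuallyEq.rfl
      filter_upwards [hσe, hτe] with k e1 e2
      rw [e1, e2]
      simp only [hR]
      ring
    refine h2.trans_isBigO ?_
    refine (Asymptotics.isBigO_const_mul_self (((β / Real.pi : ℝ) : ℂ)⁻¹)
      (fun k => N k * ((β / Real.pi : ℝ) : ℂ) * (τ k - σ k)) atTop).congr_left fun k => ?_
    field_simp
  have hd := hequiv.tendsto_nhds hNR
  have hd2 : Tendsto (fun k => N k * (N k * (τ k - σ k))) atTop
      (𝓝 (((β / Real.pi : ℝ) : ℂ)⁻¹ * (2 * Real.pi * Complex.I - 2 * Real.pi * Complex.I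
        * (1 / (w + 1) * (zetaDeriv ρ w)⁻¹)))) := by
    refine (hd.const_mul (((β / Real.pi : ℝ) : ℂ)⁻¹)).congr fun k => ?_
    field_simp
  have hW : Tendsto (fun k => N k * (nodeSum (N k) (p k) (zetaInv ρ) (τ k)
      - nodeSum (N k) (p k) (zetaInv ρ) (σ k))) atTop
      (𝓝 (((w.im / Real.pi : ℝ) : ℂ) * (((β / Real.pi : ℝ) : ℂ)⁻¹ * (2 * Real.pi * Complex.I
        - 2 * Real.pi * Complex.I * (1 / (w + 1) * (zetaDeriv ρ w)⁻¹))))) := by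
    have h3 := (Asymptotics.isBigO_refl (fun k => (N k : ℂ)) atTop).mul_isLittleO hoW
    have h4 := (Asymptotics.isLittleO_one_iff ℂ).1 (h3.trans_isBigO (hd2.isBigO_one ℂ))
    have h5 := h4.add (hd2.const_mul ((w.im / Real.pi : ℝ) : ℂ))
    rw [zero_add] at h5
    refine h5.congr fun k => ?_
    ring
  have hfin := ((hW.add hsW).const_mul (-(1 / 2) : ℂ))
  -- From ζ'(w) = (w - 1 + 2ρ)/(w² - 1) one gets 1 - 1/((w + 1)ζ') = 2ρ/(w - 1 + 2ρ), the source of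
  -- the common denominator in `gInf`.
  have hlim : -(1 / 2) * (((w.im / Real.pi : ℝ) : ℂ) * (((β / Real.pi : ℝ) : ℂ)⁻¹
      * (2 * Real.pi * Complex.I - 2 * Real.pi * Complex.I
        * (1 / (w + 1) * (zetaDeriv ρ w)⁻¹)))
      + (1 : ℕ) * (2 * Real.pi) * Complex.I * (zetaDeriv ρ w)⁻¹) = gInf ρ w := by
    have n1 : w - 1 ≠ 0 := Complex.slitPlane_ne_zero hwm
    have n2 : w + 1 ≠ 0 := Complex.slitPlane_ne_zero (add_one_mem_slitPlane hwm)
    have n3 : w - 1 + 2 * ρ ≠ 0 := by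
      intro h
      apply zetaDeriv_ne_zero h0 hwm
      rw [zetaDeriv, h, zero_div]
    have n4 : (β : ℂ) ≠ 0 := by exact_mod_cast hβ.ne'
    rw [gInf, zetaDeriv, add_comm 1 w, ← hβd]
    push_cast
    field_simp
    ring
  rw [hlim] at hfin
  refine hfin.congr' ?_
  filter_upwards [hl₁, hl₂] with k e1 e2
  rw [e1, e2]
  ring

/-! ### The extensive part of the largest eigenvalue. -/

/-- A primitive of `(w - 1) / 2` with respect to the logarithmic coordinate. -/
noncomputable def primL (ρ : ℝ) (w : ℂ) : ℂ := 1 / 2 * (w - 2 * (1 - ρ) * ell w)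

theorem hasDerivAt_primL {ρ : ℝ} (h0 : 0 < ρ) (h1 : ρ < 1) {ζ : ℂ} (h : ζ ∈ zetaImage ρ) :
    HasDerivAt (fun ζ => primL ρ (zetaInv ρ ζ)) (1 / 2 * (zetaInv ρ ζ - 1)) ζ := by
  have d1 := hasDerivAt_zetaInv h0 h1 h
  have d2 := hasDerivAt_ell_zetaInv h0 h1 h
  have hm := zetaInv_mem h
  have n1 : zetaInv ρ ζ - 1 ≠ 0 := Complex.slitPlane_ne_zero hm
  have n2 : zetaInv ρ ζ + 1 ≠ 0 := Complex.slitPlane_ne_zero (add_one_mem_slitPlane hm)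
  have n3 : zetaInv ρ ζ - 1 + 2 * ρ ≠ 0 := by
    intro h'
    apply zetaDeriv_ne_zero h0 hm
    rw [zetaDeriv, h', zero_div]
  have := (d1.sub (d2.const_mul (2 * (1 - ρ : ℂ)))).const_mul (1 / 2 : ℂ)
  convert! this using 1
  rw [zetaDeriv]
  field_simp
  ring

/-- The Riemann bound at the limiting real shift, where conjugation symmetry turns the boundary
difference into 2i Im Q. -/
theorem nodeSum_isBigO {ρ : ℝ} (h0 : 0 < ρ) (h1 : ρ < 1) {x : ℝ} (hx : xCrit ρ < x) {Q q : ℂ → ℂ}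
    (hQ : ∀ ζ ∈ zetaImage ρ, HasDerivAt Q (q ζ) ζ)
    (hc : Q ((starRingEnd ℂ) (levelPoint ρ x)) = (starRingEnd ℂ) (Q (levelPoint ρ x)))
    {N p : ℕ → ℕ} (hN : Tendsto N atTop atTop) (hp : ∀ k, (p k : ℝ) = ρ * N k) :
    (fun k => nodeSum (N k) (p k) q x - ((N k * ((Q (levelPoint ρ x)).im / Real.pi) : ℝ) : ℂ))
      =O[atTop] fun _ => (1 : ℝ) := by
  have hpi := Real.pi_pos
  have hpic : (Real.pi : ℂ) ≠ 0 := by exact_mod_cast Real.pi_ne_zero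
  obtain ⟨δ, hδ0, hδ⟩ := exists_levelRect_subset h0 h1 hx
  obtain ⟨K, hK0, hK⟩ := riemann_bound h0 hδ hQ
  refine Asymptotics.IsBigO.of_bound (K / (2 * Real.pi)) ?_
  filter_upwards [hN.eventually (eventually_gt_atTop 0)] with k hk
  have r := hK (N k) (p k) hk (hp k) x (by simpa using hδ0.le)
  have e1 : (x : ℂ) + (ρ * Real.pi : ℝ) * Complex.I = levelPoint ρ x := rfl
  have e2 : (x : ℂ) + (-(ρ * Real.pi) : ℝ) * Complex.I = (starRingEnd ℂ) (levelPoint ρ x) := by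
    simp [levelPoint]
  have hNr : (0 : ℝ) < N k := by exact_mod_cast hk
  have hNc : (N k : ℂ) ≠ 0 := by exact_mod_cast hk.ne'
  rw [e1, e2, hc, Complex.sub_conj] at r
  have e3 : (2 * Real.pi / N k : ℝ) * Complex.I * nodeSum (N k) (p k) q x
      - ((2 * (Q (levelPoint ρ x)).im : ℝ) : ℂ) * Complex.I
      = (2 * Real.pi / N k : ℝ) * (Complex.I * (nodeSum (N k) (p k) q x
        - ((N k * ((Q (levelPoint ρ x)).im / Real.pi) : ℝ) : ℂ))) := by
    push_cast; field_simp
  rw [e3, norm_mul, norm_mul, Complex.norm_I, one_mul, Complex.norm_real, Real.norm_eq_abs,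
    abs_of_pos (by positivity), div_mul_eq_mul_div, div_le_div_iff_of_pos_right hNr] at r
  rw [norm_one, mul_one, le_div_iff₀ (by positivity)]
  linarith

theorem primL_im {ρ : ℝ} (w : ℂ) : (primL ρ w).im / Real.pi = LambdaInf ρ w := by
  have : primL ρ w = ((1 / 2 : ℝ) : ℂ) * (w - ((2 * (1 - ρ) : ℝ) : ℂ) * ell w) := by
    rw [primL]; push_cast; ring
  rw [this, Complex.im_ofReal_mul, Complex.sub_im, Complex.im_ofReal_mul, ell_im, LambdaInf,
    add_comm 1 w]
  ring

theorem primL_conj {ρ : ℝ} {w : ℂ} (hw : w + 1 ∈ Complex.slitPlane) :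
    primL ρ ((starRingEnd ℂ) w) = (starRingEnd ℂ) (primL ρ w) := by
  rw [primL, ell_conj hw, primL]
  simp only [map_mul, map_sub, map_div₀, map_one, map_ofNat, Complex.conj_ofReal]

/-- The deviation of the largest eigenvalue from its extensive part is bounded. -/
theorem eigenvalue_isBigO {ρ : ℝ} (h0 : 0 < ρ) (h1 : ρ < 1) {x : ℝ} (hx : xCrit ρ < x)
    {N p : ℕ → ℕ} (hN : Tendsto N atTop atTop) (hp : ∀ k, (p k : ℝ) = ρ * N k) {γ : ℝ}
    (hγ : consist ρ x = γ) {σ l : ℕ → ℂ} (hσ : Tendsto σ atTop (𝓝 (x : ℂ)))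
    (hσe : ∀ᶠ k in atTop, nodeSum (N k) (p k) (fun ζ => ell (zetaInv ρ ζ)) (σ k) = p k * γ)
    (hl : ∀ᶠ k in atTop, l k = 1 / 2 * (nodeSum (N k) (p k) (zetaInv ρ) (σ k) - p k)) :
    (fun k => l k - ((N k * LambdaInf ρ (zetaInv ρ (levelPoint ρ x)) : ℝ) : ℂ))
      =O[atTop] fun _ => (1 : ℝ) := by
  have hpi := Real.pi_pos
  have hm := levelPoint_mem h0 h1 hx
  have hw1 := add_one_mem_slitPlane (zetaInv_mem hm)
  have hx0 : Tendsto (fun _ : ℕ => (x : ℂ)) atTop (𝓝 (x : ℂ)) := tendsto_const_nhds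
  have hoA := nodeSum_sub_isLittleO h0 h1 hx (differentiableOn_ell_zetaInv h0 h1) hN hp hσ hx0
  have hoW := nodeSum_sub_isLittleO h0 h1 hx (differentiableOn_zetaInv h0 h1) hN hp hσ hx0
  rw [ell_slope h0 h1 hx] at hoA
  rw [zetaInv_slope h0 h1 hx] at hoW
  have hβ := consist_deriv_pos h0 h1 hx
  have hA := nodeSum_isBigO h0 h1 hx (fun ζ hζ => hasDerivAt_primK_zetaInv h0 h1 hζ)
    (by rw [zetaInv_conj h0 h1 hm, primK_conj ρ hw1]) hN hp
  have hL := nodeSum_isBigO h0 h1 hx (fun ζ hζ => hasDerivAt_primL h0 h1 hζ)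
    (by rw [zetaInv_conj h0 h1 hm, primL_conj hw1]) hN hp
  rw [primL_im] at hL
  set w := zetaInv ρ (levelPoint ρ x) with hw
  set β : ℝ := (w + 1).arg with hβd
  have hDne : ((β / Real.pi : ℝ) : ℂ) ≠ 0 := by
    exact_mod_cast (div_pos hβ Real.pi_pos).ne'
  have hdiff : (fun k => nodeSum (N k) (p k) (fun ζ => ell (zetaInv ρ ζ)) (σ k)
      - nodeSum (N k) (p k) (fun ζ => ell (zetaInv ρ ζ)) x) =O[atTop] fun _ => (1 : ℝ) := by
    refine hA.neg_left.congr' ?_ EventuallyEq.rfl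
    filter_upwards [hσe] with k hk
    have e : ((N k * ((primK ρ w).im / Real.pi) : ℝ) : ℂ) = p k * γ := by
      have : N k * ((primK ρ w).im / Real.pi) = p k * γ := by
        rw [← hγ, consist, ← hw, hp k]; field_simp
      rw [this]; push_cast; ring
    rw [hk, e]; ring
  have hself : (fun k => (N k : ℂ) * (σ k - x)) =O[atTop]
      fun k => N k * ((β / Real.pi : ℝ) : ℂ) * (σ k - x) := by
    refine (Asymptotics.isBigO_const_mul_self (((β / Real.pi : ℝ) : ℂ)⁻¹)
      (fun k => N k * ((β / Real.pi : ℝ) : ℂ) * (σ k - x)) atTop).congr_left fun k => ?_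
    field_simp
  have hequiv : Asymptotics.IsEquivalent atTop
      (fun k => nodeSum (N k) (p k) (fun ζ => ell (zetaInv ρ ζ)) (σ k)
      - nodeSum (N k) (p k) (fun ζ => ell (zetaInv ρ ζ)) x)
      (fun k => N k * ((β / Real.pi : ℝ) : ℂ) * (σ k - x)) := hoA.trans_isBigO hself
  -- As `consist` takes the value γ at `x`, the node sums of `ell` at `σ` and at `x` differ by O(1);
  -- the nonzero slope β/π then gives σ - x = O(1/N).
  have hN1 : (fun k => (N k : ℂ) * (σ k - x)) =O[atTop] fun _ => (1 : ℝ) :=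
    (hself.trans hequiv.isBigO_symm).trans hdiff
  have hWO : (fun k => nodeSum (N k) (p k) (zetaInv ρ) (σ k)
      - nodeSum (N k) (p k) (zetaInv ρ) x) =O[atTop] fun _ => (1 : ℝ) := by
    have := (hoW.isBigO.trans hN1).add (hN1.const_mul_left ((w.im / Real.pi : ℝ) : ℂ))
    refine this.congr_left fun k => ?_
    ring
  refine ((hWO.const_mul_left (1 / 2 : ℂ)).add hL).congr' ?_ EventuallyEq.rfl
  filter_upwards [hl] with k hk
  have e : nodeSum (N k) (p k) (fun ζ => 1 / 2 * (zetaInv ρ ζ - 1)) x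
      = 1 / 2 * (nodeSum (N k) (p k) (zetaInv ρ) x - p k) := by
    simp only [nodeSum]
    rw [← Finset.mul_sum, Finset.sum_sub_distrib]
    simp
  rw [hk, e]
  ring

/-! ### The limits along the sequence of system sizes -/

theorem lastStep_zero (N p : ℕ) (f : ℂ → ℂ) (σ : ℂ) : lastStep N p 0 f σ = 0 := by
  simp [lastStep]

/-- |C|^(1/p) is the exponential of (log|C|/N)/ρ. The excitation `e` may vary with k, so that both
choices for λ₂ can alternate. -/
theorem tendsto_norm_rpow {ρ : ℝ} (h0 : 0 < ρ) (h1 : ρ < 1) {γ : ℝ} (hγ : 0 < γ) {N p : ℕ → ℕ}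
    (hN : Tendsto N atTop atTop) (hp : ∀ k, (p k : ℝ) = ρ * N k) {C : ℕ → ℂ}
    (hC : ∀ᶠ k in atTop, C k ≠ 0)
    (h : ∀ᶠ k in atTop, ∃ e s u l, BetheSol ρ γ (N k) (p k) e (Real.log ‖C k‖ / N k) s u l) :
    Tendsto (fun k => ‖C k‖ ^ (1 / (p k : ℝ))) atTop (𝓝 (rStar ρ γ)) := by
  have h' : ∀ k, ∃ (e : ℕ) (s : ℝ) (u : ℕ → ℂ) (l : ℂ),
      (∃ e s u l, BetheSol ρ γ (N k) (p k) e (Real.log ‖C k‖ / N k) s u l) →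
      BetheSol ρ γ (N k) (p k) e (Real.log ‖C k‖ / N k) s u l := by
    intro k
    by_cases hk : ∃ e s u l, BetheSol ρ γ (N k) (p k) e (Real.log ‖C k‖ / N k) s u l
    · obtain ⟨e, s, u, l, hu⟩ := hk
      exact ⟨e, s, u, l, fun _ => hu⟩
    · exact ⟨0, 0, fun _ => 0, 0, fun h => absurd h hk⟩
  choose e s u l hsol using h'
  have hx := tendsto_of_betheSol h0 h1 hγ hN hp (h.mono fun k hk => hsol k hk)
  have hr := (rCrit_pos h0 h1).trans (rStar_spec h0 h1 hγ).1
  have hexp := (Real.continuous_exp.tendsto _).comp (hx.div_const ρ)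
  rw [mul_div_cancel_left₀ _ h0.ne', Real.exp_log hr] at hexp
  refine hexp.congr' ?_
  filter_upwards [hC] with k hk
  rw [Real.rpow_def_of_pos (norm_pos_iff.2 hk), Function.comp, hp k]
  congr 1
  rw [div_div, mul_one_div, mul_comm ρ]

theorem eventually_conj_nodeSum {ρ : ℝ} (h0 : 0 < ρ) (h1 : ρ < 1) {x : ℝ} (hx : xCrit ρ < x)
    {N p : ℕ → ℕ} (hN : Tendsto N atTop atTop) (hp : ∀ k, (p k : ℝ) = ρ * N k) {σ : ℕ → ℂ}
    (hσ : Tendsto σ atTop (𝓝 (x : ℂ))) :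
    ∀ᶠ k in atTop,
      nodeSum (N k) (p k) (fun ζ => ell (zetaInv ρ ζ)) ((starRingEnd ℂ) (σ k))
        = (starRingEnd ℂ) (nodeSum (N k) (p k) (fun ζ => ell (zetaInv ρ ζ)) (σ k)) ∧
      nodeSum (N k) (p k) (zetaInv ρ) ((starRingEnd ℂ) (σ k))
        = (starRingEnd ℂ) (nodeSum (N k) (p k) (zetaInv ρ) (σ k)) := by
  have hre := (Complex.continuous_re.tendsto _).comp hσ
  have him := ((Complex.continuous_im.tendsto _).comp hσ).abs
  simp only [Complex.ofReal_re, Complex.ofReal_im, abs_zero] at hre him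
  filter_upwards [hN.eventually (eventually_gt_atTop 0), hre.eventually (lt_mem_nhds hx),
    him.eventually (gt_mem_nhds (mul_pos (sub_pos.2 h1) Real.pi_pos))] with k hk hkr hki
  simp only [Function.comp] at hkr hki
  have hmem : ∀ i < p k, σ k + node (N k) (p k) i * Complex.I ∈ zetaImage ρ := by
    intro i hi
    refine mem_zetaImage h0 h1 (Or.inr ⟨by simpa using hkr, ?_⟩)
    have hn := abs_node_le hk (hp k) hi
    have ha := abs_add_le (σ k).im (node (N k) (p k) i)
    simp only [Complex.add_im, Complex.mul_I_im, Complex.ofReal_re]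
    linarith
  exact ⟨nodeSum_conj fun i hi => by
      rw [zetaInv_conj h0 h1 (hmem i hi), ell_conj (add_one_mem_slitPlane
        (zetaInv_mem (hmem i hi)))],
    nodeSum_conj fun i hi => zetaInv_conj h0 h1 (hmem i hi)⟩

/-- The node sum of a sequence of ground states. -/
theorem exists_shift_ground {ρ : ℝ} (h0 : 0 < ρ) (h1 : ρ < 1) {γ : ℝ} (hγ : 0 < γ) {N p : ℕ → ℕ}
    (hN : Tendsto N atTop atTop) (hp : ∀ k, (p k : ℝ) = ρ * N k) {l : ℕ → ℂ}
    (h : ∀ᶠ k in atTop, ∃ x s u, BetheSol ρ γ (N k) (p k) 0 x s u (l k)) :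
    ∃ σ : ℕ → ℂ, Tendsto σ atTop (𝓝 ((ρ * Real.log (rStar ρ γ) : ℝ) : ℂ)) ∧
      (∀ᶠ k in atTop, nodeSum (N k) (p k) (fun ζ => ell (zetaInv ρ ζ)) (σ k) = p k * γ) ∧
      ∀ᶠ k in atTop, l k = 1 / 2 * (nodeSum (N k) (p k) (zetaInv ρ) (σ k) - p k) := by
  obtain ⟨σ, hσ, hσe, hσl⟩ := exists_shift h0 h1 hγ zero_le_one hN hp h
  simp only [lastStep_zero, Nat.cast_zero, zero_mul, add_zero, sub_zero] at hσe hσl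
  exact ⟨σ, hσ, hσe, hσl⟩

/-- The second limit serves the conjugated choice of λ₂. Since pγ is real, the conjugate of the
ground state shift solves the same equation, so reality of λ₁ need not be known. -/
theorem tendsto_gap_of_betheSol {ρ : ℝ} (h0 : 0 < ρ) (h1 : ρ < 1) {γ : ℝ} (hγ : 0 < γ)
    {N p : ℕ → ℕ} (hN : Tendsto N atTop atTop) (hp : ∀ k, (p k : ℝ) = ρ * N k) {l₁ l₂ : ℕ → ℂ}
    (hsol₁ : ∀ᶠ k in atTop, ∃ x s u, BetheSol ρ γ (N k) (p k) 0 x s u (l₁ k))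
    (hsol₂ : ∀ᶠ k in atTop, ∃ x s u, BetheSol ρ γ (N k) (p k) 1 x s u (l₂ k)) :
    Tendsto (fun k => (N k : ℂ) * (l₁ k - l₂ k)) atTop (𝓝 (gapConst γ ρ)) ∧
    Tendsto (fun k => (N k : ℂ) * ((starRingEnd ℂ) (l₁ k) - l₂ k)) atTop
      (𝓝 (gapConst γ ρ)) := by
  have hr := (rStar_spec h0 h1 hγ).1
  have hx := xCrit_lt_mul_log h0 h1 hr
  obtain ⟨σ, hσ, hσe, hσl⟩ := exists_shift_ground h0 h1 hγ hN hp hsol₁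
  obtain ⟨τ, hτ, hτe, hτl⟩ := exists_shift h0 h1 hγ le_rfl hN hp hsol₂
  simp only [Nat.cast_one, one_mul] at hτe
  have hconj := eventually_conj_nodeSum h0 h1 hx hN hp hσ
  rw [gapConst, uStar_eq h0 h1 hr]
  refine ⟨tendsto_gap h0 h1 hx hN hp hσ hτ hσe hτe hσl hτl,
    tendsto_gap h0 h1 hx hN hp (σ := fun k => (starRingEnd ℂ) (σ k)) ?_ hτ ?_ hτe ?_ hτl⟩
  · simpa [Function.comp_def] using (Complex.continuous_conj.tendsto _).comp hσ
  · filter_upwards [hconj, hσe] with k hk hke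
    rw [hk.1, hke]
    simp
  · filter_upwards [hconj, hσl] with k hk hkl
    rw [hk.2, hkl]
    simp [map_ofNat]

/-- A limit along a subset of the indices, from the limits along its subsequences. -/
theorem tendsto_inf_principal_of_subseq {S : Set ℕ} {f : ℕ → ℂ} {a : ℂ}
    (h : ∀ n : ℕ → ℕ, Tendsto n atTop atTop → (∀ᶠ k in atTop, n k ∈ S) →
      Tendsto (fun k => f (n k)) atTop (𝓝 a)) :
    Tendsto f (atTop ⊓ 𝓟 S) (𝓝 a) :=
  tendsto_of_seq_tendsto fun n hn =>
    h n (hn.mono_right inf_le_left) (tendsto_principal.1 (hn.mono_right inf_le_right))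

end TASEP

/-! ### The theorem. -/

open TASEP in
theorem theorem4p2 (ρ : ℝ) (hρ0 : 0 < ρ) (hρ1 : ρ < 1) :
    -- `u_*` is well defined
    (∀ r, rCrit ρ < r → ∃! u, IsUStar ρ r u) ∧
    -- the limiting consistency equation has a unique solution
    (∀ γ, 0 < γ → ∃! r, IsRStar ρ γ r) ∧
    StrictMonoOn (rStar ρ) (Set.Ioi 0) ∧
    Tendsto (rStar ρ) (𝓝[>] 0) (𝓝 (rCrit ρ)) ∧
    -- the thermodynamic limit, under the root-selection assumption
    ∀ γ : ℝ, 0 < γ →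
    ∀ N p : ℕ → ℕ, Tendsto N atTop atTop → (∀ k, (p k : ℝ) = ρ * N k) →
    ∀ l₁ l₂ : ℕ → ℂ,
      (∀ᶠ k in atTop, IsLargestEigenvalue (N k) (p k) γ (l₁ k)) →
      (∀ᶠ k in atTop, IsSecondEigenvalue (N k) (p k) γ (l₁ k) (l₂ k)) →
      (∀ᶠ k in atTop, RootSelection (N k) (p k) γ (l₁ k) (l₂ k)) →
      -- the consistency equations of both eigenvalues become the limiting one
      (∀ C : ℕ → ℂ,
        (∀ᶠ k in atTop, Realizes (N k) (p k) γ (choiceOne (p k)) (C k) (l₁ k)) →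
        Tendsto (fun k => ‖C k‖ ^ (1 / (p k : ℝ))) atTop (𝓝 (rStar ρ γ))) ∧
      (∀ C : ℕ → ℂ,
        (∀ᶠ k in atTop, Realizes (N k) (p k) γ (choiceTwo (p k)) (C k) (l₂ k) ∨
          Realizes (N k) (p k) γ (choiceTwo' (N k) (p k)) (C k) (l₂ k)) →
        Tendsto (fun k => ‖C k‖ ^ (1 / (p k : ℝ))) atTop (𝓝 (rStar ρ γ))) ∧
      -- the largest eigenvalue
      (∃ K : ℝ, ∀ᶠ k in atTop, ‖l₁ k - ((N k * Lam γ ρ : ℝ) : ℂ)‖ ≤ K) ∧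
      -- the spectral gap, for each of the two complex conjugate choices of `l₂`
      Tendsto (fun k => (N k : ℂ) * (l₁ k - l₂ k))
        (atTop ⊓ 𝓟 {k | ∃ C, Realizes (N k) (p k) γ (choiceTwo (p k)) C (l₂ k)})
        (𝓝 (gapConst γ ρ)) ∧
      Tendsto (fun k => (N k : ℂ) * (l₁ k - l₂ k))
        (atTop ⊓ 𝓟 {k | ∃ C, Realizes (N k) (p k) γ (choiceTwo' (N k) (p k)) C (l₂ k)})
        (𝓝 (starRingEnd ℂ (gapConst γ ρ))) := by
  refine ⟨fun r hr => existsUnique_isUStar hρ0 hρ1 hr, fun γ hγ => existsUnique_isRStar hρ0 hρ1 hγ,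
    rStar_strictMonoOn hρ0 hρ1, tendsto_rStar hρ0 hρ1, ?_⟩
  intro γ hγ N p hN hp l₁ l₂ _ _ hsel
  have hsize := eventually_size hρ0 hρ1 hN hp
  have hsol₁ : ∀ᶠ k in atTop, ∃ x s u, BetheSol ρ γ (N k) (p k) 0 x s u (l₁ k) := by
    filter_upwards [hsel, hsize] with k ⟨⟨C, hC⟩, _⟩ hk
    exact ⟨_, hC.betheSol_one hρ0 hρ1 hk.2 hk.1 (hp k)⟩
  refine ⟨fun C hC => ?_, fun C hC => ?_, ?_, ?_, ?_⟩
  · refine tendsto_norm_rpow hρ0 hρ1 hγ hN hp (hC.mono fun k hk => hk.1) ?_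
    filter_upwards [hC, hsize] with k hkC hk
    obtain ⟨s, u, h⟩ := hkC.betheSol_one hρ0 hρ1 hk.2 hk.1 (hp k)
    exact ⟨_, s, u, _, h⟩
  · refine tendsto_norm_rpow hρ0 hρ1 hγ hN hp
      (hC.mono fun k hk => hk.elim (fun h => h.1) fun h => h.1) ?_
    filter_upwards [hC, hsize] with k hkC hk
    rcases hkC with hkC | hkC
    · obtain ⟨s, u, h⟩ := hkC.betheSol_two hρ0 hρ1 hk.2 hk.1 (hp k)
      exact ⟨_, s, u, _, h⟩
    · obtain ⟨s, u, h⟩ := hkC.betheSol_two' hρ0 hρ1 hk.2 hk.1 (hp k)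
      exact ⟨_, s, u, _, h⟩
  · obtain ⟨hr, hrγ⟩ := rStar_spec hρ0 hρ1 hγ
    obtain ⟨σ, hσ, hσe, hσl⟩ := exists_shift_ground hρ0 hρ1 hγ hN hp hsol₁
    obtain ⟨K, hK⟩ := (eigenvalue_isBigO hρ0 hρ1 (xCrit_lt_mul_log hρ0 hρ1 hr) hN hp hrγ hσ hσe
      hσl).bound
    rw [Lam, uStar_eq hρ0 hρ1 hr]
    exact ⟨K, by simpa using hK⟩
  · refine tendsto_inf_principal_of_subseq fun n hn hS => ?_
    refine (tendsto_gap_of_betheSol hρ0 hρ1 hγ (hN.comp hn) (p := fun k => p (n k))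
      (fun k => hp (n k)) (l₁ := fun k => l₁ (n k)) (l₂ := fun k => l₂ (n k))
      (hn.eventually hsol₁) ?_).1
    filter_upwards [hS, hn.eventually hsize] with k ⟨C, hC⟩ hk
    exact ⟨_, hC.betheSol_two hρ0 hρ1 hk.2 hk.1 (hp (n k))⟩
  · refine tendsto_inf_principal_of_subseq fun n hn hS => ?_
    -- Conjugation makes λ₂ an excitation of the last root; the limit is then conjugated back.
    have := (tendsto_gap_of_betheSol hρ0 hρ1 hγ (hN.comp hn) (p := fun k => p (n k))
      (fun k => hp (n k)) (l₁ := fun k => l₁ (n k)) (l₂ := fun k => (starRingEnd ℂ) (l₂ (n k)))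
      (hn.eventually hsol₁) (by
        filter_upwards [hS, hn.eventually hsize] with k ⟨C, hC⟩ hk
        exact ⟨_, hC.betheSol_two' hρ0 hρ1 hk.2 hk.1 (hp (n k))⟩)).2
    simpa [Function.comp_def] using (Complex.continuous_conj.tendsto _).comp this
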